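/- We work in second-order arithmetic (numbers and sets of numbers). $\mathrm{RCA}_0$ consists of the basic axioms, $\Sigma^0_1$ induction and $\Delta^0_1$ comprehension; $\mathrm{WKL}_0$ is $\mathrm{RCA}_0$ together with weak König's lemma (every infinite tree $T \subseteq 2^{<\mathbb{N}}$ has a path). Finite sets, finite sequences and finite functions are represented by their number codes. A set $H$ is homogeneous for a colouring $C$ of $d$-element sets if $C$ is constant on the set $[H]^d$ of $d$-element subsets of $H$. A function $F$ from (codes of) finite subsets of $\mathbb{N}$ to $\mathbb{N}$ is *asymptotically stable* if for every sequence $X_0 \subseteq X_1 \subseteq X_2 \subseteq \dots$ of finite sets there exists $i$ such that $F(X_j) = F(X_i)$ for all $j \ge i$. For numbers $k, d$: * $\mathrm{RT}^k_d$ is the statement: for every $C \colon [\mathbb{N}]^d \to \{0,\dots,k-1\}$ there exists an infinite $C$-homogeneous set. * $\mathrm{FRT}^k_d$ is the statement: for every asymptotically stable $F$ there exists $R$ such that for every $C \colon [\{0,\dots,R\}]^d \to \{0,\dots,k-1\}$ there exists a $C$-homogeneous set $H \subseteq \{0,\dots,R\}$ with $|H| > F(H)$. Theorem. (a) $\mathrm{RCA}_0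 \vdash \forall k\, \forall d\, (\mathrm{FRT}^k_d \to \mathrm{RT}^k_d)$. (b) $\mathrm{WKL}_0 \vdash \forall k\, \forall d\, (\mathrm{RT}^k_d \to \mathrm{FRT}^k_d)$. -/

import Mathlib

/-! Second-order arithmetic: the two-sorted language, a classical deductive calculus,
the systems `RCA₀` and `WKL₀`, and the sentences involved. -/

namespace SOA

/-! ### Syntax

Number variables and set variables are two separate families of de Bruijn indices;
`all` binds number variable `0`, `allS` binds set variable `0`. -/

/-- Number terms. -/
inductive Tm : Type
  | var (i : ℕ) : Tm
  | zero : Tm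
  | one : Tm
  | add (s t : Tm) : Tm
  | mul (s t : Tm) : Tm

/-- Formulas of the language of second-order arithmetic. -/
inductive Fm : Type
  | eq (s t : Tm) : Fm
  | lt (s t : Tm) : Fm
  | mem (t : Tm) (X : ℕ) : Fm
  | bot : Fm
  | imp (φ ψ : Fm) : Fm
  | all (φ : Fm) : Fm
  | allS (φ : Fm) : Fm

namespace Tm

/-- Simultaneous substitution in terms. -/
def subst (σ : ℕ → Tm) : Tm → Tm
  | var i => σ i
  | zero => zero
  | one => one
  | add s t => add (s.subst σ) (t.subst σ)
  | mul s t => mul (s.subst σ) (t.subst σ)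

/-- Increase all variable indices by one. -/
def shift (t : Tm) : Tm := t.subst fun i => var (i + 1)

/-- The substitution `0 ↦ t`, `i + 1 ↦ i`. -/
def single (t : Tm) : ℕ → Tm
  | 0 => t
  | i + 1 => var i

/-- A substitution moved under a number quantifier. -/
def up (σ : ℕ → Tm) : ℕ → Tm
  | 0 => var 0
  | i + 1 => (σ i).shift

end Tm

/-- The renaming `0 ↦ X`, `i + 1 ↦ i` of set variables. -/
def singleS (X : ℕ) : ℕ → ℕ
  | 0 => X
  | i + 1 => i

/-- A renaming of set variables moved under a set quantifier. -/
def upS (ρ : ℕ → ℕ) : ℕ → ℕ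
  | 0 => 0
  | i + 1 => ρ i + 1

namespace Fm

/-- Capture-avoiding simultaneous substitution of terms for number variables and of set
variables for set variables. -/
def subst (σ : ℕ → Tm) (ρ : ℕ → ℕ) : Fm → Fm
  | eq s t => eq (s.subst σ) (t.subst σ)
  | lt s t => lt (s.subst σ) (t.subst σ)
  | mem t X => mem (t.subst σ) (ρ X)
  | bot => bot
  | imp φ ψ => imp (φ.subst σ ρ) (ψ.subst σ ρ)
  | all φ => all (φ.subst (Tm.up σ) ρ)
  | allS φ => allS (φ.subst σ (upS ρ))

/-- Weakening by a fresh number variable `0`. -/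
def shift (φ : Fm) : Fm := φ.subst (fun i => Tm.var (i + 1)) id

/-- Weakening by a fresh set variable `0`. -/
def shiftS (φ : Fm) : Fm := φ.subst Tm.var (· + 1)

/-- `φ(t)`: instantiate number variable `0`. -/
def inst (φ : Fm) (t : Tm) : Fm := φ.subst (Tm.single t) id

/-- `φ(X)`: instantiate set variable `0`. -/
def instS (φ : Fm) (X : ℕ) : Fm := φ.subst Tm.var (singleS X)

def neg (φ : Fm) : Fm := imp φ bot
def or (φ ψ : Fm) : Fm := imp (neg φ) ψ
def and (φ ψ : Fm) : Fm := neg (imp φ (neg ψ))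
def iff (φ ψ : Fm) : Fm := and (imp φ ψ) (imp ψ φ)
def ex (φ : Fm) : Fm := neg (all (neg φ))
def exS (φ : Fm) : Fm := neg (allS (neg φ))

end Fm

/-! ### Provability -/

/-- `Prf A Γ φ`: classical two-sorted natural deduction with equality (on numbers),
deriving `φ` from the finitely many hypotheses `Γ` and the axioms in `A`.
The axioms are understood as universally closed, the hypotheses `Γ` are not. -/
inductive Prf (A : Set Fm) : List Fm → Fm → Prop
  | ax {Γ : List Fm} {φ : Fm} : φ ∈ A → Prf A Γ φ
  | hyp {Γ : List Fm} {φ : Fm} : φ ∈ Γ → Prf A Γ φ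
  | impI {Γ : List Fm} {φ ψ : Fm} : Prf A (φ :: Γ) ψ → Prf A Γ (φ.imp ψ)
  | impE {Γ : List Fm} {φ ψ : Fm} : Prf A Γ (φ.imp ψ) → Prf A Γ φ → Prf A Γ ψ
  | raa {Γ : List Fm} {φ : Fm} : Prf A (φ.neg :: Γ) Fm.bot → Prf A Γ φ
  | allI {Γ : List Fm} {φ : Fm} : Prf A (Γ.map Fm.shift) φ → Prf A Γ φ.all
  | allE {Γ : List Fm} {φ : Fm} (t : Tm) : Prf A Γ φ.all → Prf A Γ (φ.inst t)
  | allSI {Γ : List Fm} {φ : Fm} : Prf A (Γ.map Fm.shiftS) φ → Prf A Γ φ.allS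
  | allSE {Γ : List Fm} {φ : Fm} (X : ℕ) : Prf A Γ φ.allS → Prf A Γ (φ.instS X)
  | eqI {Γ : List Fm} (t : Tm) : Prf A Γ (Fm.eq t t)
  | eqE {Γ : List Fm} {φ : Fm} {s t : Tm} :
      Prf A Γ (Fm.eq s t) → Prf A Γ (φ.inst s) → Prf A Γ (φ.inst t)

/-- `A ⊢ φ`. -/
def Provable (A : Set Fm) (φ : Fm) : Prop := Prf A [] φ

/-! ### The axioms of `RCA₀` -/

/-- `Σ⁰₀` (bounded) formulas; set variables may occur free. In a bounded quantifier
`∀ m < t` or `∃ m < t` the term `t` does not contain `m`. -/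
inductive IsSigma00 : Fm → Prop
  | eq (s t : Tm) : IsSigma00 (Fm.eq s t)
  | lt (s t : Tm) : IsSigma00 (Fm.lt s t)
  | mem (t : Tm) (X : ℕ) : IsSigma00 (Fm.mem t X)
  | bot : IsSigma00 Fm.bot
  | imp {φ ψ : Fm} : IsSigma00 φ → IsSigma00 ψ → IsSigma00 (φ.imp ψ)
  | ball (t : Tm) {φ : Fm} : IsSigma00 φ →
      IsSigma00 (Fm.all (Fm.imp (Fm.lt (Tm.var 0) t.shift) φ))
  | bex (t : Tm) {φ : Fm} : IsSigma00 φ →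
      IsSigma00 (Fm.ex (Fm.and (Fm.lt (Tm.var 0) t.shift) φ))

/-- `Σ⁰₁` formulas `∃ m θ` with `θ` bounded. -/
def IsSigma01 (φ : Fm) : Prop := ∃ θ, IsSigma00 θ ∧ φ = Fm.ex θ

/-- `Π⁰₁` formulas `∀ m θ` with `θ` bounded. -/
def IsPi01 (φ : Fm) : Prop := ∃ θ, IsSigma00 θ ∧ φ = Fm.all θ

/-- The basic axioms, with free number variables `m = var 0` and `n = var 1`. -/
inductive Basic : Fm → Prop
  | succ_ne_zero : Basic (Fm.neg (.eq (.add (.var 0) .one) .zero))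
  | succ_inj : Basic
      (.imp (.eq (.add (.var 0) .one) (.add (.var 1) .one)) (.eq (.var 0) (.var 1)))
  | add_zero : Basic (.eq (.add (.var 0) .zero) (.var 0))
  | add_succ : Basic
      (.eq (.add (.var 0) (.add (.var 1) .one)) (.add (.add (.var 0) (.var 1)) .one))
  | mul_zero : Basic (.eq (.mul (.var 0) .zero) .zero)
  | mul_succ : Basic
      (.eq (.mul (.var 0) (.add (.var 1) .one)) (.add (.mul (.var 0) (.var 1)) (.var 0)))
  | not_lt_zero : Basic (Fm.neg (.lt (.var 0) .zero))
  | lt_succ : Basic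
      (Fm.iff (.lt (.var 0) (.add (.var 1) .one))
        (Fm.or (.lt (.var 0) (.var 1)) (.eq (.var 0) (.var 1))))

/-- The substitution `n ↦ n + 1` for `n = var 0`, fixing all other variables. -/
def succSubst : ℕ → Tm
  | 0 => .add (.var 0) .one
  | i + 1 => .var (i + 1)

/-- `(φ(0) ∧ ∀ n (φ(n) → φ(n+1))) → ∀ n φ(n)`, where `n` is variable `0` of `φ`. -/
def inductionAx (φ : Fm) : Fm :=
  Fm.imp (Fm.and (φ.inst .zero) (Fm.all (Fm.imp φ (φ.subst succSubst id)))) (Fm.all φ)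

/-- `∀ n (φ(n) ↔ ψ(n)) → ∃ X ∀ n (n ∈ X ↔ φ(n))`, with `X` not free in `φ`;
`n` is variable `0` of `φ` and `ψ`. -/
def comprehensionAx (φ ψ : Fm) : Fm :=
  Fm.imp (Fm.all (Fm.iff φ ψ))
    (Fm.exS (Fm.all (Fm.iff (Fm.mem (.var 0) 0) φ.shiftS)))

/-- `RCA₀`: basic axioms, `Σ⁰₁` induction and `Δ⁰₁` comprehension (with parameters). -/
inductive RCA0 : Set Fm
  | basic {φ : Fm} : Basic φ → RCA0 φ
  | induction {φ : Fm} : IsSigma01 φ → RCA0 (inductionAx φ)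
  | comprehension {φ ψ : Fm} : IsSigma01 φ → IsPi01 ψ → RCA0 (comprehensionAx φ ψ)

/-! ### Writing formulas with Lean-level binders

`Form` is a formula as a function of the numbers `n`, `m` of enclosing number and set
quantifiers; `Ter` and `SVar` are terms and set variables in the same style. A quantifier
hands its variable to its body, in the form that gives the right de Bruijn index
at every depth below it. -/

abbrev Ter : Type := ℕ → Tm
abbrev SVar : Type := ℕ → ℕ
abbrev Form : Type := ℕ → ℕ → Fm

/-- The formula denoted by a `Form` without enclosing quantifiers. -/
def Form.close (φ : Form) : Fm := φ 0 0

def zero : Ter := fun _ => .zero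
def one : Ter := fun _ => .one
def add (s t : Ter) : Ter := fun n => .add (s n) (t n)
def mul (s t : Ter) : Ter := fun n => .mul (s n) (t n)

def eq (s t : Ter) : Form := fun n _ => .eq (s n) (t n)
def lt (s t : Ter) : Form := fun n _ => .lt (s n) (t n)
def mem (t : Ter) (X : SVar) : Form := fun n m => .mem (t n) (X m)
def neg (φ : Form) : Form := fun n m => (φ n m).neg
def imp (φ ψ : Form) : Form := fun n m => (φ n m).imp (ψ n m)
def and (φ ψ : Form) : Form := fun n m => (φ n m).and (ψ n m)
def or (φ ψ : Form) : Form := fun n m => (φ n m).or (ψ n m)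
def iff (φ ψ : Form) : Form := fun n m => (φ n m).iff (ψ n m)
def all (φ : Ter → Form) : Form :=
  fun n m => .all (φ (fun n' => .var (n' - (n + 1))) (n + 1) m)
def ex (φ : Ter → Form) : Form :=
  fun n m => .ex (φ (fun n' => .var (n' - (n + 1))) (n + 1) m)
def allS (φ : SVar → Form) : Form :=
  fun n m => .allS (φ (fun m' => m' - (m + 1)) n (m + 1))
def exS (φ : SVar → Form) : Form :=
  fun n m => .exS (φ (fun m' => m' - (m + 1)) n (m + 1))

infixr:35 " ⋏ " => and
infixr:30 " ⋎ " => or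
infixr:25 " ⇒ " => imp
infix:20 " ⇔ " => iff
infix:50 " ≐ " => eq
infix:50 " ≺ " => lt
infixl:65 " ⊹ " => add
infixl:70 " ⊛ " => mul

def le (s t : Ter) : Form := s ≺ t ⋎ s ≐ t

/-- A definable class of numbers: a set, the elements of a coded finite set, … -/
abbrev Cls : Type := Ter → Form

/-- The class `ℕ`. -/
def univ : Cls := fun x => x ≐ x

/-- The class of elements of the set `X`. -/
def ofSet (X : SVar) : Cls := fun x => mem x X

/-! ### Coding of pairs, finite sets and finite sequences -/

/-- The pair `(i, j) = (i + j)² + i`. -/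
def pair (i j : Ter) : Ter := (i ⊹ j) ⊛ (i ⊹ j) ⊹ i

def dvd (a b : Ter) : Form := ex fun q => a ⊛ q ≐ b

/-- `x` is of the form `(k, (m, n))`. -/
def isTriple (x : Ter) : Form :=
  ex fun k => ex fun m => ex fun n => x ≐ pair k (pair m n)

/-- The elements of the finite set given by `x = (k, (m, n))`: those `i < k` for which
`m (i + 1) + 1` divides `n`. -/
def elts (x : Ter) : Cls := fun i =>
  ex fun k => ex fun m => ex fun n =>
    x ≐ pair k (pair m n) ⋏ i ≺ k ⋏ dvd (m ⊛ (i ⊹ one) ⊹ one) n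

/-- `P ⊆ Q`. -/
def sub (P Q : Cls) : Form := all fun i => P i ⇒ Q i

/-- `x` is the code of a finite set: the least triple with the elements that it has. -/
def isFin : Cls := fun x =>
  isTriple x ⋏
    all fun y => y ≺ x ⇒ isTriple y ⇒ neg (sub (elts y) (elts x) ⋏ sub (elts x) (elts y))

/-- `f : P → Q`, where the class `f` of pairs is the graph. -/
def isFun (f P Q : Cls) : Form :=
  (all fun z => f z ⇒ ex fun x => ex fun y => z ≐ pair x y ⋏ P x ⋏ Q y) ⋏
  (all fun x => P x ⇒ ex fun y =>
    f (pair x y) ⋏ all fun y' => f (pair x y') ⇒ y' ≐ y)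

/-- The class `{i : i < l}`. -/
def below (l : Ter) : Cls := fun i => i ≺ l

/-- `s` is (the code of) a finite sequence of length `l` with entries in `P`. -/
def isSeq (P : Cls) (l s : Ter) : Form := isFin s ⋏ isFun (elts s) (below l) P

/-- `[P]^d`: the `d`-element subsets of `P`, as increasing sequences of length `d`. -/
def tuples (P : Cls) (d : Ter) : Cls := fun s =>
  isSeq P d s ⋏
  all fun i => all fun i' => all fun x => all fun x' =>
    elts s (pair i x) ⋏ elts s (pair i' x') ⋏ i ≺ i' ⇒ x ≺ x'

/-- `|H| = n`: some increasing sequence of length `n` enumerates `H`. -/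
def hasSize (H : Cls) (n : Ter) : Form :=
  ex fun s => tuples H n s ⋏ all fun x => H x ⇒ ex fun i => elts s (pair i x)

/-- The class `P` is unbounded. -/
def isInfinite (P : Cls) : Form := all fun m => ex fun n => m ≺ n ⋏ P n

/-! ### Weak König's lemma -/

/-- `T ⊆ 2^{<ℕ}` is a tree: a set of finite `0`-`1` sequences, closed under initial
segments (the finite sequences included in a given one as sets of pairs). -/
def isBinTree (T : SVar) : Form :=
  (all fun s => mem s T ⇒ ex fun l => isSeq (below (one ⊹ one)) l s) ⋏
  (all fun s => all fun t => all fun l =>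
    mem s T ⋏ isSeq univ l t ⋏ sub (elts t) (elts s) ⇒ mem t T)

/-- `g : ℕ → {0, 1}` is a path through `T`: all its restrictions to `{i : i < n}` are
in `T`. -/
def isPath (g T : SVar) : Form :=
  isFun (ofSet g) univ (below (one ⊹ one)) ⋏
  all fun n => ex fun s => mem s T ⋏ isSeq univ n s ⋏ sub (elts s) (ofSet g)

/-- Weak König's lemma: every infinite tree `T ⊆ 2^{<ℕ}` has a path. -/
def WKL : Form :=
  allS fun T => isBinTree T ⋏ isInfinite (ofSet T) ⇒ exS fun g => isPath g T

/-- `WKL₀`: `RCA₀` together with weak König's lemma. -/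
def WKL0 : Set Fm := RCA0 ∪ {WKL.close}

/-! ### Ramsey's theorem and its finitary version -/

/-- `H` is homogeneous for the colouring with graph `C`: `C` is constant on `[H]^d`. -/
def isHomog (d : Ter) (C H : Cls) : Form :=
  all fun s => all fun t => all fun c =>
    tuples H d s ⋏ tuples H d t ⋏ C (pair s c) ⇒ C (pair t c)

/-- `RT^k_d`: every `C : [ℕ]^d → k` has an infinite homogeneous set. -/
def RT (k d : Ter) : Form :=
  allS fun C => isFun (ofSet C) (tuples univ d) (below k) ⇒
    exS fun H => isInfinite (ofSet H) ⋏ isHomog d (ofSet C) (ofSet H)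

/-- `F` is asymptotically stable: it is a function from codes of finite sets to numbers
which is eventually constant along every sequence `X₀ ⊆ X₁ ⊆ …` of finite sets. -/
def isAS (F : SVar) : Form :=
  isFun (ofSet F) isFin univ ⋏
  allS fun X =>
    isFun (ofSet X) univ isFin ⋏
    (all fun i => all fun x => all fun y =>
      mem (pair i x) X ⋏ mem (pair (i ⊹ one) y) X ⇒ sub (elts x) (elts y)) ⇒
    ex fun i => all fun j => le i j ⇒
      all fun x => all fun y => all fun u =>
        mem (pair i x) X ⋏ mem (pair j y) X ⋏ mem (pair x u) F ⇒ mem (pair y u) F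

/-- `FRT^k_d`: for every asymptotically stable `F` there is `R` such that every (coded
finite) colouring `C : [0,R]^d → k` has a homogeneous `H ⊆ [0,R]` with `|H| > F(H)`. -/
def FRT (k d : Ter) : Form :=
  allS fun F => isAS F ⇒
    ex fun R => all fun C =>
      isFin C ⋏ isFun (elts C) (tuples (fun i => le i R) d) (below k) ⇒
        ex fun H => isFin H ⋏ sub (elts H) (fun i => le i R) ⋏ isHomog d (elts C) (elts H) ⋏
          ex fun n => ex fun y => hasSize (elts H) n ⋏ mem (pair H y) F ⋏ y ≺ n

end SOA

/-! Both parts are proved semantically. Henkin completeness of the calculus (`provable_of_holds`)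
reduces provability to truth in all models, nonstandard ones included, and `provable_close` together
with the `FDen` lemmas turns the sentences into statements `FRTIn`, `RTIn`, `WKLIn` about one model.
Inside a model only Σ⁰₁ induction and Δ⁰₁ comprehension are available, so definability is tracked by
the classes `Sig0` and `Sig1`. They yield Σ⁰₁ collection, least elements of Π⁰₁ predicates, and
codes for bounded Σ⁰₁ sets (`CodeBound.exists_code`).

For (a), `RTIn.of_frtIn`: suppose C has no infinite homogeneous set. Let F(H) be 0 if H visibly
contains two d-subsets of different colours, and the code of H otherwise; that code is at least |H|.
F is asymptotically stable: once it is 0 along a chain it stays 0, and a chain with bounded union is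
eventually constant. If the union is unbounded, the maxima of the members form an infinite set (the
union itself need not be a set in RCA₀). This set is not homogeneous, and two differently coloured
d-subsets of it already show up in a single member, so F does become 0. Now the finitary theorem,
applied to F and a restriction of C, gives a homogeneous H with |H| > F(H); but homogeneity makes
F(H) the code of H, a contradiction.

For (b), `FRTIn.of_rtIn`: suppose F is asymptotically stable and every R has a bad colouring. Weak
König's lemma, in the form `WKLIn.compactness`, gives one colouring of all d-subsets for which every
finite homogeneous H has |H| ≤ F(H). An infinite homogeneous set exists by Ramsey's theorem. F
stabilises along its initial segments, while their sizes are unbounded, a contradiction. -/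

namespace SOA

/-! ### Substitution -/

namespace Tm

theorem subst_subst (t : Tm) (σ τ : ℕ → Tm) :
    (t.subst σ).subst τ = t.subst fun i => (σ i).subst τ := by
  induction t <;> simp_all [subst]

theorem subst_var (t : Tm) : t.subst var = t := by
  induction t <;> simp_all [subst]

theorem shift_subst_up (t : Tm) (σ : ℕ → Tm) : t.shift.subst (up σ) = (t.subst σ).shift := by
  simp only [shift, subst_subst]; rfl

theorem shift_subst_single (t u : Tm) : t.shift.subst (single u) = t := by
  simp only [shift, subst_subst]; exact subst_var t

theorem up_comp (σ τ : ℕ → Tm) : (fun i => (up σ i).subst (up τ)) = up fun i => (σ i).subst τ := by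
  funext i; cases i with
  | zero => rfl
  | succ i => exact shift_subst_up _ _

theorem up_var : up var = var := by funext i; cases i <;> rfl

/-- A bound for the variables of a term. -/
def bound : Tm → ℕ
  | var i => i + 1
  | zero => 0
  | one => 0
  | add s t => max s.bound t.bound
  | mul s t => max s.bound t.bound

theorem subst_congr {t : Tm} {σ τ : ℕ → Tm} (h : ∀ i < t.bound, σ i = τ i) :
    t.subst σ = t.subst τ := by
  induction t <;> simp_all [subst, bound]

end Tm

theorem upS_comp (ρ π : ℕ → ℕ) : upS π ∘ upS ρ = upS (π ∘ ρ) := by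
  funext i; cases i <;> rfl

theorem upS_id : upS id = id := by funext i; cases i <;> rfl

namespace Fm

theorem subst_subst (φ : Fm) (σ τ : ℕ → Tm) (ρ π : ℕ → ℕ) :
    (φ.subst σ ρ).subst τ π = φ.subst (fun i => (σ i).subst τ) (π ∘ ρ) := by
  induction φ generalizing σ τ ρ π <;>
    simp_all [subst, Tm.subst_subst, Tm.up_comp, upS_comp]

theorem subst_var (φ : Fm) : φ.subst Tm.var id = φ := by
  induction φ <;> simp_all [subst, Tm.subst_var, Tm.up_var, upS_id]

/-- A bound for the free number variables of a formula. -/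
def bound : Fm → ℕ
  | eq s t => max s.bound t.bound
  | lt s t => max s.bound t.bound
  | mem t _ => t.bound
  | bot => 0
  | imp φ ψ => max φ.bound ψ.bound
  | all φ => φ.bound
  | allS φ => φ.bound

/-- A bound for the free set variables of a formula. -/
def boundS : Fm → ℕ
  | eq _ _ => 0
  | lt _ _ => 0
  | mem _ X => X + 1
  | bot => 0
  | imp φ ψ => max φ.boundS ψ.boundS
  | all φ => φ.boundS
  | allS φ => φ.boundS

theorem subst_congr {φ : Fm} {σ τ : ℕ → Tm} {ρ π : ℕ → ℕ} (h : ∀ i < φ.bound, σ i = τ i)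
    (h' : ∀ i < φ.boundS, ρ i = π i) : φ.subst σ ρ = φ.subst τ π := by
  induction φ generalizing σ τ ρ π with
  | eq s t =>
    simp only [bound, lt_max_iff] at h
    simp only [subst]
    rw [Tm.subst_congr fun i hi => h i (.inl hi), Tm.subst_congr fun i hi => h i (.inr hi)]
  | lt s t =>
    simp only [bound, lt_max_iff] at h
    simp only [subst]
    rw [Tm.subst_congr fun i hi => h i (.inl hi), Tm.subst_congr fun i hi => h i (.inr hi)]
  | mem t X =>
    simp only [subst]
    rw [Tm.subst_congr h, h' X (by simp [boundS])]
  | bot => rfl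
  | imp φ ψ ihφ ihψ =>
    simp only [bound, boundS, lt_max_iff] at h h'
    simp only [subst]
    rw [ihφ (fun i hi => h i (.inl hi)) fun i hi => h' i (.inl hi),
      ihψ (fun i hi => h i (.inr hi)) fun i hi => h' i (.inr hi)]
  | all φ ih =>
    simp only [subst]
    rw [ih (fun i hi => ?_) h']
    cases i with
    | zero => rfl
    | succ i => simp only [Tm.up]; rw [h i (by simp only [bound]; omega)]
  | allS φ ih =>
    simp only [subst]
    rw [ih h fun i hi => ?_]
    cases i with
    | zero => rfl
    | succ i => simp only [upS]; rw [h' i (by simp only [boundS]; omega)]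

end Fm

/-- Put `x` in front of the sequence `v`. -/
def scons {α : Type} (x : α) (v : ℕ → α) : ℕ → α
  | 0 => x
  | i + 1 => v i

@[simp] theorem scons_zero {α : Type} (x : α) (v : ℕ → α) : scons x v 0 = x := rfl
@[simp] theorem scons_succ {α : Type} (x : α) (v : ℕ → α) (i : ℕ) : scons x v (i + 1) = v i := rfl

theorem Fm.subst_up_inst (φ : Fm) (σ : ℕ → Tm) (ρ : ℕ → ℕ) (t : Tm) :
    (φ.subst (Tm.up σ) ρ).inst t = φ.subst (scons t σ) ρ := by
  rw [inst, subst_subst]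
  congr 1
  funext i; cases i with
  | zero => rfl
  | succ i => exact Tm.shift_subst_single _ _

theorem Fm.subst_upS_instS (φ : Fm) (σ : ℕ → Tm) (ρ : ℕ → ℕ) (X : ℕ) :
    (φ.subst σ (upS ρ)).instS X = φ.subst σ (scons X ρ) := by
  rw [instS, subst_subst]
  congr 1
  · funext i; exact Tm.subst_var _
  · funext i; cases i <;> rfl

theorem Fm.inst_subst (φ : Fm) (σ : ℕ → Tm) (ρ : ℕ → ℕ) (t : Tm) :
    (φ.inst t).subst σ ρ = (φ.subst (Tm.up σ) ρ).inst (t.subst σ) := by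
  rw [subst_up_inst, inst, subst_subst]
  congr 1
  funext i; cases i <;> rfl

theorem Fm.instS_subst (φ : Fm) (σ : ℕ → Tm) (ρ : ℕ → ℕ) (X : ℕ) :
    (φ.instS X).subst σ ρ = (φ.subst σ (upS ρ)).instS (ρ X) := by
  rw [subst_upS_instS, instS, subst_subst]
  congr 1
  funext i; cases i <;> rfl

theorem Fm.shift_subst_up (φ : Fm) (σ : ℕ → Tm) (ρ : ℕ → ℕ) :
    φ.shift.subst (Tm.up σ) ρ = (φ.subst σ ρ).shift := by
  simp only [shift, subst_subst]; rfl

theorem Fm.shiftS_subst_upS (φ : Fm) (σ : ℕ → Tm) (ρ : ℕ → ℕ) :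
    φ.shiftS.subst σ (upS ρ) = (φ.subst σ ρ).shiftS := by
  simp only [shiftS, subst_subst]
  congr 1
  funext i; exact (Tm.subst_var _).symm

/-! ### Admissible rules -/

namespace Prf

variable {A : Set Fm} {Γ Δ : List Fm} {φ ψ : Fm}

theorem weaken (h : Prf A Γ φ) (hΓ : Γ ⊆ Δ) : Prf A Δ φ := by
  induction h generalizing Δ with
  | ax h => exact .ax h
  | hyp h => exact .hyp (hΓ h)
  | impI _ ih => exact .impI (ih (List.cons_subset_cons _ hΓ))
  | impE _ _ ih₁ ih₂ => exact .impE (ih₁ hΓ) (ih₂ hΓ)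
  | raa _ ih => exact .raa (ih (List.cons_subset_cons _ hΓ))
  | allI _ ih => exact .allI (ih (List.map_subset _ hΓ))
  | allE t _ ih => exact .allE t (ih hΓ)
  | allSI _ ih => exact .allSI (ih (List.map_subset _ hΓ))
  | allSE X _ ih => exact .allSE X (ih hΓ)
  | eqI t => exact .eqI t
  | eqE _ _ ih₁ ih₂ => exact .eqE (ih₁ hΓ) (ih₂ hΓ)

theorem iterate_all_inst (N : ℕ) (σ : ℕ → Tm) (h : Prf A Γ (Fm.all^[N] φ)) :
    Prf A Γ (φ.subst (fun i => if i < N then σ i else .var (i - N)) id) := by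
  induction N generalizing σ φ with
  | zero => simpa [Fm.subst_var] using h
  | succ N ih =>
    have := (ih (fun i => σ (i + 1)) h).allE (σ 0)
    rw [Fm.subst_up_inst] at this
    convert this using 2
    funext i; cases i with
    | zero => simp
    | succ i => simp

theorem iterate_allS_inst (N : ℕ) (ρ : ℕ → ℕ) (h : Prf A Γ (Fm.allS^[N] φ)) :
    Prf A Γ (φ.subst .var (fun i => if i < N then ρ i else i - N)) := by
  induction N generalizing ρ φ with
  | zero => simpa using (Fm.subst_var φ).symm ▸ h
  | succ N ih =>
    have := (ih (fun i => ρ (i + 1)) h).allSE (ρ 0)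
    rw [Fm.subst_upS_instS] at this
    convert this using 2
    funext i; cases i with
    | zero => simp
    | succ i => simp

/-- The axioms need not be closed under substitution, so an induction on derivations would fail at
`ax`. Derivability from every context allows generalisation over all free variables, first numbers
and then sets, followed by instantiation. -/
theorem subst_of_forall (h : ∀ Γ, Prf A Γ φ) (σ : ℕ → Tm) (ρ : ℕ → ℕ) :
    Prf A Γ (φ.subst σ ρ) := by
  have h₁ : ∀ N Γ, Prf A Γ (Fm.all^[N] φ) := by
    intro N
    induction N with
    | zero => exact h
    | succ N ih => intro Γ; rw [Function.iterate_succ_apply']; exact .allI (ih _)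
  have h₂ : ∀ Γ, Prf A Γ (φ.subst σ id) := fun Γ => by
    have := iterate_all_inst φ.bound σ (h₁ φ.bound Γ)
    rwa [Fm.subst_congr (τ := σ) (π := id) (fun i hi => by simp [hi]) fun _ _ => rfl] at this
  have h₃ : ∀ N Γ, Prf A Γ (Fm.allS^[N] (φ.subst σ id)) := by
    intro N
    induction N with
    | zero => exact h₂
    | succ N ih => intro Γ; rw [Function.iterate_succ_apply']; exact .allSI (ih _)
  have := iterate_allS_inst (φ.subst σ id).boundS ρ (h₃ _ Γ)
  rw [Fm.subst_congr (τ := .var) (π := ρ) (fun _ _ => rfl) fun i hi => by simp [hi]] at this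
  rw [Fm.subst_subst] at this
  convert this using 2
  · funext i; exact (Tm.subst_var _).symm
  · rfl

theorem subst (h : Prf A Γ φ) (σ : ℕ → Tm) (ρ : ℕ → ℕ) :
    Prf A (Γ.map fun ψ => ψ.subst σ ρ) (φ.subst σ ρ) := by
  induction h generalizing σ ρ with
  | ax h => exact subst_of_forall (fun _ => .ax h) σ ρ
  | hyp h => exact .hyp (List.mem_map_of_mem h)
  | impI _ ih => exact .impI (ih σ ρ)
  | impE _ _ ih₁ ih₂ => exact .impE (ih₁ σ ρ) (ih₂ σ ρ)
  | raa _ ih => exact .raa (ih σ ρ)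
  | allI _ ih =>
    refine .allI ?_
    have := ih (Tm.up σ) ρ
    simpa only [List.map_map, Function.comp_def, Fm.shift_subst_up] using this
  | allE t _ ih => rw [Fm.inst_subst]; exact .allE _ (ih σ ρ)
  | allSI _ ih =>
    refine .allSI ?_
    have := ih σ (upS ρ)
    simpa only [List.map_map, Function.comp_def, Fm.shiftS_subst_upS] using this
  | allSE X _ ih => rw [Fm.instS_subst]; exact .allSE _ (ih σ ρ)
  | eqI t => exact .eqI _
  | eqE _ _ ih₁ ih₂ =>
    have h₁ := ih₁ σ ρ
    have h₂ := ih₂ σ ρ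
    rw [Fm.inst_subst] at h₂ ⊢
    exact .eqE h₁ h₂

/-- Generalization on a variable that is not free in the hypotheses or the conclusion. -/
theorem gen {x : ℕ} (hΓ : ∀ ψ ∈ Γ, ψ.bound ≤ x) (hφ : φ.bound ≤ x)
    (h : Prf A Γ (φ.inst (.var x))) : Prf A Γ φ.all := by
  refine .allI ?_
  -- On the hypotheses, where x does not occur, this renaming acts as `shift`; it also turns the
  -- instance of φ at x back into φ.
  have := h.subst (fun i => if i = x then .var 0 else .var (i + 1)) id
  rw [Fm.inst_subst, Fm.subst_up_inst,
    Fm.subst_congr (τ := .var) (π := id) (fun i hi => ?_) fun _ _ => rfl, Fm.subst_var] at this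
  · convert this using 1
    refine List.map_congr_left fun ψ hψ => Fm.subst_congr (fun i hi => ?_) fun _ _ => rfl
    have := hΓ ψ hψ
    rw [if_neg (by omega)]
  · cases i with
    | zero => simp [Tm.subst]
    | succ i => simp only [scons_succ]; rw [if_neg (by omega)]

/-- Generalization on a set variable that is not free in the hypotheses or the conclusion. -/
theorem genS {x : ℕ} (hΓ : ∀ ψ ∈ Γ, ψ.boundS ≤ x) (hφ : φ.boundS ≤ x)
    (h : Prf A Γ (φ.instS x)) : Prf A Γ φ.allS := by
  refine .allSI ?_
  have := h.subst .var (fun i => if i = x then 0 else i + 1)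
  rw [Fm.instS_subst, Fm.subst_upS_instS,
    Fm.subst_congr (τ := .var) (π := id) (fun _ _ => rfl) (fun i hi => ?_), Fm.subst_var] at this
  · convert this using 1
    refine List.map_congr_left fun ψ hψ => Fm.subst_congr (fun _ _ => rfl) (fun i hi => ?_)
    have := hΓ ψ hψ
    rw [if_neg (by omega)]
  · cases i with
    | zero => simp
    | succ i => simp only [scons_succ]; rw [if_neg (by omega)]; rfl

theorem efq (h : Prf A Γ .bot) : Prf A Γ φ := .raa (h.weaken (List.subset_cons_self _ _))

theorem em (h₁ : Prf A (φ :: Γ) .bot) (h₂ : Prf A (φ.neg :: Γ) .bot) : Prf A Γ .bot :=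
  .impE (.impI h₁) (.raa h₂)

end Prf

/-! ### Enumeration of formulas -/

namespace Tm

def code : Tm → ℕ
  | var i => Nat.pair 0 i
  | zero => Nat.pair 1 0
  | one => Nat.pair 2 0
  | add s t => Nat.pair 3 (Nat.pair s.code t.code)
  | mul s t => Nat.pair 4 (Nat.pair s.code t.code)

theorem code_injective : Function.Injective code := by
  intro s t h
  induction s generalizing t <;> cases t <;> simp_all [code, Nat.pair_eq_pair] <;>
    constructor <;> solve_by_elim [And.left, And.right]

end Tm

namespace Fm

def code : Fm → ℕ
  | eq s t => Nat.pair 0 (Nat.pair s.code t.code)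
  | lt s t => Nat.pair 1 (Nat.pair s.code t.code)
  | mem t X => Nat.pair 2 (Nat.pair t.code X)
  | bot => Nat.pair 3 0
  | imp φ ψ => Nat.pair 4 (Nat.pair φ.code ψ.code)
  | all φ => Nat.pair 5 φ.code
  | allS φ => Nat.pair 6 φ.code

theorem code_injective : Function.Injective code := by
  intro s t h
  induction s generalizing t with
  | imp φ ψ ih₁ ih₂ =>
    cases t <;> simp only [code, Nat.pair_eq_pair] at h <;> try omega
    rw [ih₁ h.2.1, ih₂ h.2.2]
  | all φ ih =>
    cases t <;> simp only [code, Nat.pair_eq_pair] at h <;> try omega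
    rw [ih h.2]
  | allS φ ih =>
    cases t <;> simp only [code, Nat.pair_eq_pair] at h <;> try omega
    rw [ih h.2]
  | _ => cases t <;> simp_all [code, Nat.pair_eq_pair, Tm.code_injective.eq_iff]

instance : Countable Fm := code_injective.countable
instance : Nonempty Fm := ⟨bot⟩

end Fm

end SOA

/-! ### Completeness of the calculus for two-sorted structures. -/

namespace SOA

/-! ### Structures and truth -/

/-- A structure for the language of second-order arithmetic, with equality interpreted
as equality. -/
structure Str where
  M : Type
  S : Type
  zero : M
  one : M
  add : M → M → M
  mul : M → M → M
  lt : M → M → Prop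
  mem : M → S → Prop

def Tm.val (𝔐 : Str) (v : ℕ → 𝔐.M) : Tm → 𝔐.M
  | var i => v i
  | zero => 𝔐.zero
  | one => 𝔐.one
  | add s t => 𝔐.add (s.val 𝔐 v) (t.val 𝔐 v)
  | mul s t => 𝔐.mul (s.val 𝔐 v) (t.val 𝔐 v)

/-- Truth of a formula in a structure. -/
def Fm.Holds (𝔐 : Str) : (ℕ → 𝔐.M) → (ℕ → 𝔐.S) → Fm → Prop
  | v, _, eq s t => s.val 𝔐 v = t.val 𝔐 v
  | v, _, lt s t => 𝔐.lt (s.val 𝔐 v) (t.val 𝔐 v)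
  | v, e, mem t X => 𝔐.mem (t.val 𝔐 v) (e X)
  | _, _, bot => False
  | v, e, imp φ ψ => φ.Holds 𝔐 v e → ψ.Holds 𝔐 v e
  | v, e, all φ => ∀ x, φ.Holds 𝔐 (scons x v) e
  | v, e, allS φ => ∀ X, φ.Holds 𝔐 v (scons X e)

/-! ### Henkin sets -/

/-- A complete consistent theory with witnesses among the variables. -/
structure Henkin (A : Set Fm) (T : Set Fm) : Prop where
  closed : ∀ {Γ : List Fm} {ψ : Fm}, (∀ γ ∈ Γ, γ ∈ T) → Prf A Γ ψ → ψ ∈ T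
  bot : Fm.bot ∉ T
  complete : ∀ ψ, ψ ∉ T → ψ.neg ∈ T
  wit : ∀ χ : Fm, (∀ t, χ.inst t ∈ T) → χ.all ∈ T
  witS : ∀ χ : Fm, (∀ X, χ.instS X ∈ T) → χ.allS ∈ T

namespace Henkin

variable {A T : Set Fm} (h : Henkin A T)
include h

theorem imp_iff (φ ψ : Fm) : φ.imp ψ ∈ T ↔ (φ ∈ T → ψ ∈ T) := by
  constructor
  · intro h₁ h₂
    exact h.closed (Γ := [φ.imp ψ, φ]) (by simp [h₁, h₂])
      (.impE (φ := φ) (.hyp (by simp)) (.hyp (by simp)))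
  · intro h₁
    by_cases hφ : φ ∈ T
    · exact h.closed (Γ := [ψ]) (by simp [h₁ hφ]) (.impI (.hyp (by simp)))
    · exact h.closed (Γ := [φ.neg]) (by simp [h.complete φ hφ])
        (.impI (.efq (.impE (φ := φ) (.hyp (by simp [Fm.neg])) (.hyp (by simp)))))

theorem all_iff (φ : Fm) : φ.all ∈ T ↔ ∀ t, φ.inst t ∈ T :=
  ⟨fun h₁ t => h.closed (Γ := [φ.all]) (by simp [h₁]) (.allE t (.hyp (by simp))), h.wit φ⟩

theorem allS_iff (φ : Fm) : φ.allS ∈ T ↔ ∀ X, φ.instS X ∈ T :=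
  ⟨fun h₁ X => h.closed (Γ := [φ.allS]) (by simp [h₁]) (.allSE X (.hyp (by simp))), h.witS φ⟩

theorem eq_refl (t : Tm) : Fm.eq t t ∈ T := h.closed (Γ := []) (by simp) (.eqI t)

theorem eq_subst {s t : Tm} (φ : Fm) (h₁ : Fm.eq s t ∈ T) (h₂ : φ.inst s ∈ T) :
    φ.inst t ∈ T :=
  h.closed (Γ := [Fm.eq s t, φ.inst s]) (by simp [h₁, h₂])
    (.eqE (s := s) (.hyp (by simp)) (.hyp (by simp)))

theorem eq_symm {s t : Tm} (h₁ : Fm.eq s t ∈ T) : Fm.eq t s ∈ T := by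
  have := h.eq_subst (.eq (.var 0) s.shift) h₁
  simp only [Fm.inst, Fm.subst, Tm.subst, Tm.single, Tm.shift_subst_single] at this
  exact this (h.eq_refl s)

theorem eq_trans {s t u : Tm} (h₁ : Fm.eq s t ∈ T) (h₂ : Fm.eq t u ∈ T) : Fm.eq s u ∈ T := by
  have := h.eq_subst (.eq s.shift (.var 0)) h₂
  simp only [Fm.inst, Fm.subst, Tm.subst, Tm.single, Tm.shift_subst_single] at this
  exact this h₁

/-- Terms up to provable equality. -/
def setoid : Setoid Tm where
  r s t := Fm.eq s t ∈ T
  iseqv := ⟨h.eq_refl, h.eq_symm, h.eq_trans⟩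

theorem congr₂ (f : Tm → Tm → Tm)
    (hf : ∀ a b σ, (f a b).subst σ = f (a.subst σ) (b.subst σ))
    {s s' t t' : Tm} (hs : Fm.eq s s' ∈ T) (ht : Fm.eq t t' ∈ T) :
    Fm.eq (f s t) (f s' t') ∈ T := by
  have h₁ := h.eq_subst (.eq (f s t).shift (f (.var 0) t.shift)) hs
  have h₂ := h.eq_subst (.eq (f s t).shift (f s'.shift (.var 0))) ht
  simp only [Fm.inst, Fm.subst, hf, Tm.subst, Tm.single, Tm.shift_subst_single] at h₁ h₂
  exact h₂ (h₁ (h.eq_refl _))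

theorem lt_congr {s s' t t' : Tm} (hs : Fm.eq s s' ∈ T) (ht : Fm.eq t t' ∈ T)
    (hst : Fm.lt s t ∈ T) : Fm.lt s' t' ∈ T := by
  have h₁ := h.eq_subst (.lt (.var 0) t.shift) hs
  have h₂ := h.eq_subst (.lt s'.shift (.var 0)) ht
  simp only [Fm.inst, Fm.subst, Tm.subst, Tm.single, Tm.shift_subst_single] at h₁ h₂
  exact h₂ (h₁ hst)

theorem mem_congr {s s' : Tm} (hs : Fm.eq s s' ∈ T) {X : ℕ}
    (hst : Fm.mem s X ∈ T) : Fm.mem s' X ∈ T := by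
  have h₁ := h.eq_subst (.mem (.var 0) X) hs
  simp only [Fm.inst, Fm.subst, Tm.subst, Tm.single] at h₁
  exact h₁ hst

/-- The term model. -/
def model : Str where
  M := Quotient h.setoid
  S := ℕ
  zero := Quotient.mk _ .zero
  one := Quotient.mk _ .one
  add := Quotient.map₂ .add fun _ _ hs _ _ ht => h.congr₂ .add (fun _ _ _ => rfl) hs ht
  mul := Quotient.map₂ .mul fun _ _ hs _ _ ht => h.congr₂ .mul (fun _ _ _ => rfl) hs ht
  lt := Quotient.lift₂ (fun s t => Fm.lt s t ∈ T) fun _ _ _ _ hs ht =>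
    propext ⟨h.lt_congr hs ht, h.lt_congr (h.eq_symm hs) (h.eq_symm ht)⟩
  mem x X := Quotient.lift (fun s => Fm.mem s X ∈ T)
    (fun _ _ hs => propext ⟨h.mem_congr hs, h.mem_congr (h.eq_symm hs)⟩) x

theorem val_model (t : Tm) (σ : ℕ → Tm) :
    t.val h.model (fun i => Quotient.mk h.setoid (σ i)) = Quotient.mk h.setoid (t.subst σ) := by
  induction t with
  | var i => rfl
  | zero => rfl
  | one => rfl
  | add s t ihs iht => simp only [Tm.val, ihs, iht]; rfl
  | mul s t ihs iht => simp only [Tm.val, ihs, iht]; rfl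

/-- The truth lemma. It is stated for substitutions because they represent all valuations in the
term model; completeness of T settles implications and the witness properties settle the
quantifiers. -/
theorem holds_model (φ : Fm) (σ : ℕ → Tm) (ρ : ℕ → ℕ) :
    φ.Holds h.model (fun i => Quotient.mk h.setoid (σ i)) ρ ↔ φ.subst σ ρ ∈ T := by
  induction φ generalizing σ ρ with
  | eq s t =>
    simp only [Fm.Holds, h.val_model]
    exact Quotient.eq (r := h.setoid)
  | lt s t =>
    simp only [Fm.Holds, h.val_model]
    exact Iff.rfl
  | mem t X =>
    simp only [Fm.Holds, h.val_model]
    exact Iff.rfl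
  | bot => exact ⟨False.elim, fun hb => h.bot hb⟩
  | imp φ ψ ihφ ihψ =>
    simp only [Fm.Holds, Fm.subst, h.imp_iff]
    rw [ihφ, ihψ]
  | all φ ih =>
    simp only [Fm.Holds, Fm.subst, h.all_iff, Fm.subst_up_inst]
    refine (Quotient.forall (s := h.setoid)).trans (forall_congr' fun t => ?_)
    rw [← ih]
    refine iff_of_eq (congrArg (fun v => Fm.Holds h.model v ρ φ) ?_)
    funext i; cases i <;> rfl
  | allS φ ih =>
    simp only [Fm.Holds, Fm.subst, h.allS_iff, Fm.subst_upS_instS]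
    exact forall_congr' fun X => ih _ _

end Henkin

/-! ### Completeness -/

open Classical in
/-- Decide `ψ`, and add a counterexample if `ψ` is a refuted universal formula. -/
noncomputable def henkinStep (A : Set Fm) (Γ : List Fm) (ψ : Fm) : List Fm :=
  if Prf A (ψ :: Γ) .bot then
    match ψ with
    | .all χ => (χ.inst (.var ((χ :: Γ).map Fm.bound).sum)).neg :: ψ.neg :: Γ
    | .allS χ => (χ.instS ((χ :: Γ).map Fm.boundS).sum).neg :: ψ.neg :: Γ
    | _ => ψ.neg :: Γ
  else ψ :: Γ

variable {A : Set Fm}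

theorem subset_henkinStep (Γ : List Fm) (ψ : Fm) : Γ ⊆ henkinStep A Γ ψ := by
  intro γ hγ
  unfold henkinStep
  split_ifs
  · split <;> simp [hγ]
  · simp [hγ]

/-- The index of the new variable is a sum of bounds, hence at least each of them, so the variable
is fresh. If adding the counterexample were inconsistent, `gen` or `genS` would derive the universal
formula whose negation has just been added. -/
theorem henkinStep_consistent {Γ : List Fm} {ψ : Fm} (h : ¬ Prf A Γ .bot) :
    ¬ Prf A (henkinStep A Γ ψ) .bot := by
  unfold henkinStep
  split_ifs with h₁
  swap
  · exact h₁
  have h₂ : ¬ Prf A (ψ.neg :: Γ) .bot := fun h₂ => h (h₁.em h₂)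
  split
  · rename_i χ
    intro h₃
    refine h₂ (.impE (φ := χ.all) (.hyp (by simp [Fm.neg])) (Prf.gen ?_ ?_ (.raa h₃)))
    · have hle : ∀ γ ∈ χ :: Γ, γ.bound ≤ ((χ :: Γ).map Fm.bound).sum := fun γ hγ =>
        List.le_sum_of_mem (List.mem_map_of_mem hγ)
      intro γ hγ
      rcases List.mem_cons.mp hγ with rfl | hγ
      · simp [Fm.neg, Fm.bound]
      · exact hle γ (by simp [hγ])
    · simp
  · rename_i χ
    intro h₃
    refine h₂ (.impE (φ := χ.allS) (.hyp (by simp [Fm.neg])) (Prf.genS ?_ ?_ (.raa h₃)))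
    · have hle : ∀ γ ∈ χ :: Γ, γ.boundS ≤ ((χ :: Γ).map Fm.boundS).sum := fun γ hγ =>
        List.le_sum_of_mem (List.mem_map_of_mem hγ)
      intro γ hγ
      rcases List.mem_cons.mp hγ with rfl | hγ
      · simp [Fm.neg, Fm.boundS]
      · exact hle γ (by simp [hγ])
    · simp
  · exact h₂

/-- Lindenbaum's construction along an enumeration of the formulas, with T the union of the stages.
Every stage is a finite list, so a fresh variable is always available and no new constants are
needed. -/
theorem exists_henkin {φ : Fm} (h : ¬ Prf A [] φ) : ∃ T, Henkin A T ∧ φ.neg ∈ T := by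
  obtain ⟨enum, henum⟩ := exists_surjective_nat Fm
  let Γ : ℕ → List Fm := fun n => n.rec [φ.neg] fun i Δ => henkinStep A Δ (enum i)
  have hmono : ∀ i j, i ≤ j → Γ i ⊆ Γ j := fun i j hij => by
    induction hij with
    | refl => exact fun _ => id
    | step _ ih => exact fun γ hγ => subset_henkinStep _ _ (ih hγ)
  have hcon : ∀ i, ¬ Prf A (Γ i) .bot := fun i => by
    induction i with
    | zero => exact fun h' => h (.raa h')
    | succ i ih => exact henkinStep_consistent ih
  have hfin : ∀ Δ : List Fm, (∀ γ ∈ Δ, ∃ i, γ ∈ Γ i) → ∃ i, Δ ⊆ Γ i := by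
    intro Δ hΔ
    induction Δ with
    | nil => exact ⟨0, by simp⟩
    | cons δ Δ ih =>
      obtain ⟨i, hi⟩ := ih fun γ hγ => hΔ γ (by simp [hγ])
      obtain ⟨j, hj⟩ := hΔ δ (by simp)
      refine ⟨max i j, List.cons_subset.mpr ⟨hmono _ _ (le_max_right _ _) hj, fun γ hγ => ?_⟩⟩
      exact hmono _ _ (le_max_left _ _) (hi hγ)
  have hcon' : ∀ Δ : List Fm, (∀ γ ∈ Δ, ∃ i, γ ∈ Γ i) → ¬ Prf A Δ .bot := fun Δ hΔ h' => by
    obtain ⟨i, hi⟩ := hfin Δ hΔ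
    exact hcon i (h'.weaken hi)
  -- A formula that never enters was refuted at its turn, when its negation and, for a quantified
  -- formula, a counterexample were added.
  have hstep : ∀ ψ, (¬ ∃ i, ψ ∈ Γ i) → ∃ i, ψ.neg ∈ Γ i ∧
      (∀ χ, ψ = .all χ → ∃ t, (χ.inst t).neg ∈ Γ i) ∧
      (∀ χ, ψ = .allS χ → ∃ X, (χ.instS X).neg ∈ Γ i) := by
    intro ψ hψ
    obtain ⟨i, rfl⟩ := henum ψ
    refine ⟨i + 1, ?_⟩
    have hstep : Γ (i + 1) = henkinStep A (Γ i) (enum i) := rfl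
    have hi : Prf A (enum i :: Γ i) .bot := Classical.byContradiction fun hi =>
      hψ ⟨i + 1, by rw [hstep]; unfold henkinStep; rw [if_neg hi]; exact List.mem_cons_self⟩
    rw [hstep]
    unfold henkinStep
    rw [if_pos hi]
    split
    · rename_i χ heq
      refine ⟨by simp, fun χ' h' => ?_, fun χ' h' => ?_⟩
      · cases heq.symm.trans h'; exact ⟨_, List.mem_cons_self⟩
      · cases heq.symm.trans h'
    · rename_i χ heq
      refine ⟨by simp, fun χ' h' => ?_, fun χ' h' => ?_⟩
      · cases heq.symm.trans h'
      · cases heq.symm.trans h'; exact ⟨_, List.mem_cons_self⟩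
    · rename_i h₁ h₂
      exact ⟨by simp, fun χ' h' => (h₁ _ h').elim, fun χ' h' => (h₂ _ h').elim⟩
  have hneg : ∀ ψ : Fm, (∃ i, ψ ∈ Γ i) → ¬ ∃ i, ψ.neg ∈ Γ i := fun ψ h₁ h₂ =>
    hcon' [ψ, ψ.neg] (by simp [h₁, h₂]) (.impE (φ := ψ) (.hyp (by simp [Fm.neg])) (.hyp (by simp)))
  refine ⟨{ψ | ∃ i, ψ ∈ Γ i}, ⟨?_, ?_, ?_, ?_, ?_⟩, ⟨0, List.mem_cons_self⟩⟩
  · intro Δ ψ hΔ hψ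
    refine Classical.byContradiction fun hn => ?_
    obtain ⟨i, hi, -⟩ := hstep ψ hn
    refine hcon' (ψ.neg :: Δ) (fun γ hγ => ?_) ?_
    · rcases List.mem_cons.mp hγ with rfl | hγ
      · exact ⟨i, hi⟩
      · exact hΔ γ hγ
    · exact .impE (φ := ψ) (.hyp (by simp [Fm.neg])) (hψ.weaken (List.subset_cons_self _ _))
  · exact fun hb => hcon' [.bot] (by simpa using hb) (.hyp (by simp))
  · exact fun ψ hψ => let ⟨i, hi⟩ := hstep ψ hψ; ⟨i, hi.1⟩
  · intro χ hχ
    refine Classical.byContradiction fun hn => ?_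
    obtain ⟨i, -, hi, -⟩ := hstep _ hn
    obtain ⟨t, ht⟩ := hi χ rfl
    exact hneg _ (hχ t) ⟨i, ht⟩
  · intro χ hχ
    refine Classical.byContradiction fun hn => ?_
    obtain ⟨i, -, -, hi⟩ := hstep _ hn
    obtain ⟨X, hX⟩ := hi χ rfl
    exact hneg _ (hχ X) ⟨i, hX⟩

/-- The axioms in `A` hold in `𝔐` under all valuations. -/
def Str.Models (𝔐 : Str) (A : Set Fm) : Prop := ∀ φ ∈ A, ∀ v e, φ.Holds 𝔐 v e

theorem provable_of_holds {φ : Fm}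
    (h : ∀ 𝔐 : Str, 𝔐.Models A → ∀ v e, φ.Holds 𝔐 v e) : Provable A φ := by
  by_contra hn
  obtain ⟨T, hT, hφ⟩ := exists_henkin hn
  have hM : hT.model.Models A := by
    intro ψ hψ v e
    -- Choosing representatives turns any valuation into a substitution, and the axioms remain
    -- derivable under substitutions.
    obtain ⟨σ, rfl⟩ : ∃ σ : ℕ → Tm, v = fun i => Quotient.mk hT.setoid (σ i) :=
      ⟨fun i => Quotient.out (s := hT.setoid) (v i), funext fun i => (Quotient.out_eq _).symm⟩
    refine (hT.holds_model _ _ _).mpr ?_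
    exact hT.closed (Γ := []) (by simp) (Prf.subst_of_forall (fun _ => .ax hψ) _ _)
  have h₁ := (hT.holds_model φ .var id).mp (h _ hM _ _)
  rw [Fm.subst_var] at h₁
  exact hT.bot ((hT.imp_iff φ .bot).mp hφ h₁)

end SOA

/-! ### Predicates on a structure that are definable with parameters. -/

namespace SOA

/-! ### Truth and substitution -/

theorem Tm.val_subst (𝔐 : Str) (t : Tm) (σ : ℕ → Tm) (v : ℕ → 𝔐.M) :
    (t.subst σ).val 𝔐 v = t.val 𝔐 fun i => (σ i).val 𝔐 v := by
  induction t <;> simp_all [subst, val]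

theorem Tm.val_up (𝔐 : Str) (σ : ℕ → Tm) (x : 𝔐.M) (v : ℕ → 𝔐.M) :
    (fun i => (Tm.up σ i).val 𝔐 (scons x v)) = scons x fun i => (σ i).val 𝔐 v := by
  funext i; cases i with
  | zero => rfl
  | succ i => simp only [up, shift, val_subst]; rfl

theorem Fm.holds_subst (𝔐 : Str) (φ : Fm) (σ : ℕ → Tm) (ρ : ℕ → ℕ) (v : ℕ → 𝔐.M)
    (e : ℕ → 𝔐.S) :
    (φ.subst σ ρ).Holds 𝔐 v e ↔ φ.Holds 𝔐 (fun i => (σ i).val 𝔐 v) fun i => e (ρ i) := by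
  induction φ generalizing σ ρ v e with
  | eq s t => simp only [subst, Holds, Tm.val_subst]
  | lt s t => simp only [subst, Holds, Tm.val_subst]
  | mem t X => simp only [subst, Holds, Tm.val_subst]
  | bot => rfl
  | imp φ ψ ihφ ihψ => simp only [subst, Holds, ihφ, ihψ]
  | all φ ih => simp only [subst, Holds, ih, Tm.val_up]
  | allS φ ih =>
    simp only [subst, Holds, ih]
    refine forall_congr' fun X => iff_of_eq (congrArg (fun e => Fm.Holds 𝔐 _ e φ) ?_)
    funext i; cases i <;> rfl

section
variable {𝔐 : Str} {v : ℕ → 𝔐.M} {e : ℕ → 𝔐.S} {φ ψ : Fm}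

@[simp] theorem Fm.holds_neg : φ.neg.Holds 𝔐 v e ↔ ¬ φ.Holds 𝔐 v e := Iff.rfl

@[simp] theorem Fm.holds_and : (φ.and ψ).Holds 𝔐 v e ↔ φ.Holds 𝔐 v e ∧ ψ.Holds 𝔐 v e := by
  simp only [Fm.and, holds_neg, Holds]; tauto

@[simp] theorem Fm.holds_or : (φ.or ψ).Holds 𝔐 v e ↔ φ.Holds 𝔐 v e ∨ ψ.Holds 𝔐 v e := by
  simp only [Fm.or, holds_neg, Holds]; tauto

@[simp] theorem Fm.holds_iff : (φ.iff ψ).Holds 𝔐 v e ↔ (φ.Holds 𝔐 v e ↔ ψ.Holds 𝔐 v e) := by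
  simp only [Fm.iff, holds_and, Holds]; tauto

@[simp] theorem Fm.holds_ex : φ.ex.Holds 𝔐 v e ↔ ∃ x, φ.Holds 𝔐 (scons x v) e := by
  simp only [Fm.ex, holds_neg, Holds, not_forall, not_not]

@[simp] theorem Fm.holds_exS : φ.exS.Holds 𝔐 v e ↔ ∃ X, φ.Holds 𝔐 v (scons X e) := by
  simp only [Fm.exS, holds_neg, Holds, not_forall, not_not]

end

theorem IsSigma00.subst {φ : Fm} (h : IsSigma00 φ) (σ : ℕ → Tm) (ρ : ℕ → ℕ) :
    IsSigma00 (φ.subst σ ρ) := by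
  induction h generalizing σ ρ with
  | eq s t => exact .eq _ _
  | lt s t => exact .lt _ _
  | mem t X => exact .mem _ _
  | bot => exact .bot
  | imp _ _ ih₁ ih₂ => exact .imp (ih₁ σ ρ) (ih₂ σ ρ)
  | ball t _ ih =>
    simp only [Fm.subst, Tm.shift_subst_up]
    exact .ball _ (ih _ _)
  | bex t _ ih =>
    simp only [Fm.ex, Fm.and, Fm.neg, Fm.subst, Tm.shift_subst_up]
    exact .bex _ (ih _ _)

/-! ### Definable predicates -/

/-- Two sequences merged into one. -/
def mix {α : Type} (f g : ℕ → α) (i : ℕ) : α := if i % 2 = 0 then f (i / 2) else g (i / 2)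

@[simp] theorem mix_even {α : Type} (f g : ℕ → α) (i : ℕ) : mix f g (2 * i) = f i := by
  simp [mix]

@[simp] theorem mix_odd {α : Type} (f g : ℕ → α) (i : ℕ) : mix f g (2 * i + 1) = g i := by
  simp [mix, Nat.add_mod, show (2 * i + 1) / 2 = i by omega]

variable {𝔐 : Str}

instance : Zero 𝔐.M := ⟨𝔐.zero⟩
instance : One 𝔐.M := ⟨𝔐.one⟩
instance : Add 𝔐.M := ⟨𝔐.add⟩
instance : Mul 𝔐.M := ⟨𝔐.mul⟩
instance : LT 𝔐.M := ⟨𝔐.lt⟩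
instance : Membership 𝔐.M 𝔐.S := ⟨fun X x => 𝔐.mem x X⟩

/-- Types of tuples of numbers, with their coordinates. -/
class Ctx (𝔐 : Str) (α : Type) where
  coord : Set (α → 𝔐.M)

instance : Ctx 𝔐 𝔐.M := ⟨{id}⟩
instance {α : Type} [Ctx 𝔐 α] : Ctx 𝔐 (α × 𝔐.M) :=
  ⟨{f | f = Prod.snd ∨ ∃ g ∈ Ctx.coord, f = g ∘ Prod.fst}⟩

variable {α β : Type} [Ctx 𝔐 α] [Ctx 𝔐 β]

/-- Coordinates and constants. -/
def IsVar (f : α → 𝔐.M) : Prop := f ∈ Ctx.coord ∨ ∃ c, f = fun _ => c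

/-- Functions given by a term with parameters. -/
class IsTerm (f : α → 𝔐.M) : Prop where
  intro ::
  out : ∃ (t : Tm) (g : ℕ → α → 𝔐.M), (∀ i, IsVar (g i)) ∧ ∀ a, f a = t.val 𝔐 fun i => g i a

/-- Maps between types of tuples given by terms. -/
class IsMap (𝔐 : Str) {α β : Type} [Ctx 𝔐 α] [Ctx 𝔐 β] (f : α → β) : Prop where
  intro ::
  out : ∀ c : β → 𝔐.M, c ∈ Ctx.coord → IsTerm fun a => c (f a)

/-- Predicates defined by a bounded formula with parameters. -/
class Sig0 (𝔐 : Str) {α : Type} [Ctx 𝔐 α] (P : α → Prop) : Prop where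
  intro ::
  out : ∃ θ, IsSigma00 θ ∧ ∃ g : ℕ → α → 𝔐.M, (∀ i, IsVar (g i)) ∧
    ∃ e, ∀ a, P a ↔ θ.Holds 𝔐 (fun i => g i a) e

/-- Predicates defined by a `Σ⁰₁` formula with parameters. -/
class Sig1 (𝔐 : Str) {α : Type} [Ctx 𝔐 α] (P : α → Prop) : Prop where
  intro ::
  out : ∃ Q : α → 𝔐.M → Prop, Sig0 𝔐 (fun p : α × 𝔐.M => Q p.1 p.2) ∧ ∀ a, P a ↔ ∃ y, Q a y

namespace IsTerm

theorem of_isVar {f : α → 𝔐.M} (h : IsVar f) : IsTerm f := ⟨.var 0, fun _ => f, fun _ => h, fun _ => rfl⟩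

theorem const (c : 𝔐.M) : IsTerm fun _ : α => c := of_isVar (.inr ⟨c, rfl⟩)

theorem val {g : ℕ → α → 𝔐.M} (hg : ∀ i, IsTerm (g i)) (t : Tm) :
    IsTerm fun a => t.val 𝔐 fun i => g i a := by
  choose s g' hg' h using fun i => (hg i).out
  -- The parameter sequences of all the terms are merged into one, indexed by `Nat.pair i j`.
  refine ⟨t.subst fun i => (s i).subst fun j => .var (Nat.pair i j),
    fun n => g' n.unpair.1 n.unpair.2, fun n => hg' _ _, fun a => ?_⟩
  simp only [Tm.val_subst, Tm.val, Nat.unpair_pair, h]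

theorem add {f g : α → 𝔐.M} (hf : IsTerm f) (hg : IsTerm g) : IsTerm fun a => f a + g a :=
  val (g := scons f fun _ => g) (fun i => by cases i <;> assumption) (.add (.var 0) (.var 1))

theorem mul {f g : α → 𝔐.M} (hf : IsTerm f) (hg : IsTerm g) : IsTerm fun a => f a * g a :=
  val (g := scons f fun _ => g) (fun i => by cases i <;> assumption) (.mul (.var 0) (.var 1))

theorem comp {f : α → 𝔐.M} (hf : IsTerm f) {m : β → α} (hm : IsMap 𝔐 m) :
    IsTerm fun b => f (m b) := by
  obtain ⟨t, g, hg, h⟩ := hf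
  simp only [h]
  refine val (fun i => ?_) t
  rcases hg i with hi | ⟨c, hi⟩
  · exact hm.out _ hi
  · simp only [hi]; exact const c

theorem snd {f : α → β × 𝔐.M} (hf : IsMap 𝔐 f) : IsTerm fun a => (f a).2 := hf.out _ (.inl rfl)

theorem base {f : α → 𝔐.M} (hf : IsMap 𝔐 f) : IsTerm f := hf.out _ rfl

end IsTerm

namespace IsMap

theorem id : IsMap 𝔐 fun a : α => a := ⟨fun _ hc => .of_isVar (.inl hc)⟩

theorem fst {f : α → β × 𝔐.M} (hf : IsMap 𝔐 f) : IsMap 𝔐 fun a => (f a).1 :=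
  ⟨fun c hc => hf.out (c ∘ Prod.fst) (.inr ⟨c, hc, rfl⟩)⟩

theorem mk {f : α → β} {t : α → 𝔐.M} (hf : IsMap 𝔐 f) (ht : IsTerm t) :
    IsMap 𝔐 fun a => (f a, t a) := by
  constructor
  rintro c (rfl | ⟨c, hc, rfl⟩)
  · exact ht
  · exact hf.out c hc

theorem of_isTerm {t : α → 𝔐.M} (ht : IsTerm t) : IsMap 𝔐 t := by
  constructor; rintro c rfl; exact ht

end IsMap

namespace Sig0

theorem holds {g : ℕ → α → 𝔐.M} (hg : ∀ i, IsTerm (g i)) {θ : Fm} (hθ : IsSigma00 θ)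
    (e : ℕ → 𝔐.S) : Sig0 𝔐 fun a => θ.Holds 𝔐 (fun i => g i a) e := by
  choose s g' hg' h using fun i => (hg i).out
  refine ⟨θ.subst (fun i => (s i).subst fun j => .var (Nat.pair i j)) id, hθ.subst _ _,
    fun n => g' n.unpair.1 n.unpair.2, fun n => hg' _ _, e, fun a => ?_⟩
  simp only [Fm.holds_subst, Tm.val_subst, Tm.val, Nat.unpair_pair, h]; rfl

theorem congr {P Q : α → Prop} (hP : Sig0 𝔐 P) (h : ∀ a, Q a ↔ P a) : Sig0 𝔐 Q := by
  rwa [show Q = P from funext fun a => propext (h a)]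

theorem comp {P : α → Prop} (hP : Sig0 𝔐 P) {m : β → α} (hm : IsMap 𝔐 m) :
    Sig0 𝔐 fun b => P (m b) := by
  obtain ⟨θ, hθ, g, hg, e, h⟩ := hP
  simp only [h]
  refine holds (fun i => ?_) hθ e
  rcases hg i with hi | ⟨c, hi⟩
  · exact hm.out _ hi
  · simp only [hi]; exact .const c

theorem eq {f g : α → 𝔐.M} (hf : IsTerm f) (hg : IsTerm g) [Nonempty 𝔐.S] :
    Sig0 𝔐 fun a => f a = g a :=
  holds (g := scons f fun _ => g) (fun i => by cases i <;> assumption)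
    (.eq (.var 0) (.var 1)) (fun _ => Classical.arbitrary _)

theorem lt {f g : α → 𝔐.M} (hf : IsTerm f) (hg : IsTerm g) [Nonempty 𝔐.S] :
    Sig0 𝔐 fun a => f a < g a :=
  holds (g := scons f fun _ => g) (fun i => by cases i <;> assumption)
    (.lt (.var 0) (.var 1)) (fun _ => Classical.arbitrary _)

theorem mem {f : α → 𝔐.M} (hf : IsTerm f) (X : 𝔐.S) : Sig0 𝔐 fun a => f a ∈ X :=
  holds (g := fun _ => f) (fun _ => hf) (.mem (.var 0) 0) (fun _ => X)

theorem imp {P Q : α → Prop} (hP : Sig0 𝔐 P) (hQ : Sig0 𝔐 Q) : Sig0 𝔐 fun a => P a → Q a := by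
  obtain ⟨θ, hθ, g, hg, e, h⟩ := hP
  obtain ⟨θ', hθ', g', hg', e', h'⟩ := hQ
  refine ⟨(θ.subst (fun i => .var (2 * i)) (2 * ·)).imp
    (θ'.subst (fun i => .var (2 * i + 1)) (2 * · + 1)), (hθ.subst _ _).imp (hθ'.subst _ _),
    mix g g', fun i => ?_, mix e e', fun a => ?_⟩
  · unfold mix; split_ifs
    · exact hg _
    · exact hg' _
  · simp only [Fm.Holds, Fm.holds_subst, Tm.val, h, h', mix_even, mix_odd]

theorem false [Nonempty 𝔐.S] : Sig0 𝔐 fun _ : α => False :=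
  ⟨.bot, .bot, fun _ _ => 𝔐.zero, fun _ => .inr ⟨_, rfl⟩, fun _ => Classical.arbitrary _, fun _ => Iff.rfl⟩

variable [Nonempty 𝔐.S]

theorem not {P : α → Prop} (hP : Sig0 𝔐 P) : Sig0 𝔐 fun a => ¬ P a := hP.imp false

theorem and {P Q : α → Prop} (hP : Sig0 𝔐 P) (hQ : Sig0 𝔐 Q) : Sig0 𝔐 fun a => P a ∧ Q a :=
  (hP.imp hQ.not).not.congr fun a => by tauto

theorem or {P Q : α → Prop} (hP : Sig0 𝔐 P) (hQ : Sig0 𝔐 Q) : Sig0 𝔐 fun a => P a ∨ Q a :=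
  (hP.not.imp hQ).congr fun a => by tauto

theorem iff {P Q : α → Prop} (hP : Sig0 𝔐 P) (hQ : Sig0 𝔐 Q) : Sig0 𝔐 fun a => P a ↔ Q a :=
  ((hP.imp hQ).and (hQ.imp hP)).congr fun a => by tauto

omit [Nonempty 𝔐.S] in
theorem ball {t : α → 𝔐.M} (ht : IsTerm t) {P : α → 𝔐.M → Prop}
    (hP : Sig0 𝔐 fun p : α × 𝔐.M => P p.1 p.2) : Sig0 𝔐 fun a => ∀ x, x < t a → P a x := by
  obtain ⟨θ, hθ, g, hg, e, h⟩ := hP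
  have hg' : ∀ i, ∃ (s : ℕ) (f : α → 𝔐.M), IsTerm f ∧
      ∀ p : α × 𝔐.M, g i p = if s = 0 then p.2 else f p.1 := by
    intro i
    rcases hg i with (hi | ⟨c, hc, hi⟩) | ⟨c, hi⟩
    · exact ⟨0, t, ht, fun p => by simp [hi]⟩
    · exact ⟨1, c, .of_isVar (.inl hc), fun p => by simp [hi]⟩
    · exact ⟨1, fun _ => c, .const c, fun p => by simp [hi]⟩
  choose s f hf hs using hg'
  -- Under the quantifier, variable 0 is x, variable 1 is the value of the bound, and variable i + 2
  -- is `f i`.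
  have := holds (g := scons t f) (fun i => by cases i; exacts [ht, hf _])
    (.ball (.var 0) (hθ.subst (fun i => .var (if s i = 0 then 0 else i + 2)) id)) e
  refine this.congr fun a => ?_
  simp only [Fm.Holds, Fm.holds_subst, Tm.val, Tm.shift, Tm.subst]
  refine forall_congr' fun x => imp_congr Iff.rfl ((h (a, x)).trans (iff_of_eq ?_))
  congr 1
  funext i
  rw [hs]
  split_ifs <;> rfl

theorem bex {t : α → 𝔐.M} (ht : IsTerm t) {P : α → 𝔐.M → Prop}
    (hP : Sig0 𝔐 fun p : α × 𝔐.M => P p.1 p.2) : Sig0 𝔐 fun a => ∃ x, x < t a ∧ P a x :=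
  (ball ht (P := fun a x => ¬ P a x) hP.not).not.congr fun a => by push Not; rfl

omit [Nonempty 𝔐.S] in
/-- A formula defining a binary predicate. -/
theorem formula₂ {Q : 𝔐.M → 𝔐.M → Prop} (hQ : Sig0 𝔐 fun p : 𝔐.M × 𝔐.M => Q p.1 p.2) :
    ∃ θ, IsSigma00 θ ∧ ∃ v e, ∀ x y, Q x y ↔ θ.Holds 𝔐 (scons y (scons x v)) e := by
  obtain ⟨θ, hθ, g, hg, e, h⟩ := hQ
  have hg' : ∀ i, ∃ (s : ℕ) (c : 𝔐.M), ∀ x y : 𝔐.M,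
      g i (x, y) = scons y (scons x fun _ => c) s := by
    intro i
    rcases hg i with (hi | ⟨c, hc, hi⟩) | ⟨c, hi⟩
    · exact ⟨0, 𝔐.zero, fun x y => by simp [hi]⟩
    · cases hc; exact ⟨1, 𝔐.zero, fun x y => by simp [hi]⟩
    · exact ⟨2, c, fun x y => by simp [hi]⟩
  choose s c hs using hg'
  refine ⟨θ.subst (fun i => .var (if s i = 0 then 0 else if s i = 1 then 1 else i + 2)) id,
    hθ.subst _ _, c, e, fun x y => (h (x, y)).trans ?_⟩
  rw [Fm.holds_subst]
  refine iff_of_eq ?_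
  congr 1
  funext i
  rw [hs]
  rcases hsi : s i with _ | _ | n <;> simp [Tm.val]

end Sig0

/-! ### Models of `RCA₀` -/

/-- Models of `RCA₀`. -/
class RCAModel (𝔐 : Str) : Prop where
  models : 𝔐.Models RCA0
  nonempty : Nonempty 𝔐.S

instance [RCAModel 𝔐] : Nonempty 𝔐.S := RCAModel.nonempty

theorem succSubst_val (v : ℕ → 𝔐.M) (x : 𝔐.M) :
    (fun i => (succSubst i).val 𝔐 (scons x v)) = scons (x + 1) v := by
  funext i; cases i <;> rfl

theorem single_val (v : ℕ → 𝔐.M) (t : Tm) :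
    (fun i => (Tm.single t i).val 𝔐 v) = scons (t.val 𝔐 v) v := by
  funext i; cases i <;> rfl

end SOA

/-! ### Models of RCA₀ as ordered semirings. -/

namespace SOA

variable {𝔐 : Str}

theorem Sig0.sig1 {α : Type} [Ctx 𝔐 α] {P : α → Prop} (hP : Sig0 𝔐 P) : Sig1 𝔐 P :=
  ⟨fun a _ => P a, hP.comp (IsMap.id.fst), fun _ => ⟨fun h => ⟨𝔐.zero, h⟩, fun ⟨_, h⟩ => h⟩⟩

theorem isTerm_id : IsTerm fun x : 𝔐.M => x := .base .id

instance : LE 𝔐.M := ⟨fun x y => x < y ∨ x = y⟩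

theorem Str.le_def {x y : 𝔐.M} : x ≤ y ↔ x < y ∨ x = y := Iff.rfl

variable [RCAModel 𝔐]

/-! ### Induction and the basic axioms -/

theorem Sig1.induction {P : 𝔐.M → Prop} (hP : Sig1 𝔐 P) (h0 : P 0)
    (hs : ∀ x, P x → P (x + 1)) : ∀ x, P x := by
  obtain ⟨Q, hQ, h⟩ := hP
  obtain ⟨θ, hθ, v, e, hQθ⟩ := hQ.formula₂
  have := RCAModel.models (𝔐 := 𝔐) _ (.induction ⟨θ, hθ, rfl⟩) v e
  simp only [inductionAx, Fm.inst, Fm.holds_subst, Fm.Holds, Fm.holds_and, succSubst_val,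
    single_val, id, Fm.holds_ex, ← hQθ, ← h] at this
  exact this ⟨h0, hs⟩

theorem Sig0.induction {P : 𝔐.M → Prop} (hP : Sig0 𝔐 P) (h0 : P 0)
    (hs : ∀ x, P x → P (x + 1)) : ∀ x, P x :=
  hP.sig1.induction h0 hs

namespace RCAModel

theorem basic {φ : Fm} (h : Basic φ) (x y : 𝔐.M) :
    φ.Holds 𝔐 (scons x fun _ => y) fun _ => Classical.arbitrary _ :=
  models _ (.basic h) _ _

protected theorem succ_ne_zero (x : 𝔐.M) : x + 1 ≠ 0 := basic .succ_ne_zero x x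
protected theorem succ_inj {x y : 𝔐.M} (h : x + 1 = y + 1) : x = y := basic .succ_inj x y h
protected theorem add_zero (x : 𝔐.M) : x + 0 = x := basic .add_zero x x
protected theorem add_succ (x y : 𝔐.M) : x + (y + 1) = x + y + 1 := basic .add_succ x y
protected theorem mul_zero (x : 𝔐.M) : x * 0 = 0 := basic .mul_zero x x
protected theorem mul_succ (x y : 𝔐.M) : x * (y + 1) = x * y + x := basic .mul_succ x y
protected theorem not_lt_zero (x : 𝔐.M) : ¬ x < 0 := basic .not_lt_zero x x
protected theorem lt_succ {x y : 𝔐.M} : x < y + 1 ↔ x < y ∨ x = y := by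
  have := basic .lt_succ x y
  rw [Fm.holds_iff, Fm.holds_or] at this
  exact this

theorem eq_induction (s t : 𝔐.M → 𝔐.M) (hs : IsTerm s) (ht : IsTerm t) (h0 : s 0 = t 0)
    (h : ∀ x, s x = t x → s (x + 1) = t (x + 1)) : ∀ x, s x = t x :=
  (Sig0.eq hs ht).induction h0 h

protected theorem zero_add (x : 𝔐.M) : 0 + x = x :=
  eq_induction (0 + ·) (fun x => x) (.add (.const _) isTerm_id) isTerm_id
    (RCAModel.add_zero 0) (fun x h => by rw [RCAModel.add_succ, h]) x

protected theorem succ_add (x y : 𝔐.M) : x + 1 + y = x + y + 1 :=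
  eq_induction (x + 1 + ·) (x + · + 1) (.add (.const _) isTerm_id)
    (.add (.add (.const _) isTerm_id) (.const _))
    (by simp only [RCAModel.add_zero]) (fun y h => by
      rw [RCAModel.add_succ, h, RCAModel.add_succ]) y

protected theorem add_comm (x y : 𝔐.M) : x + y = y + x :=
  eq_induction (x + ·) (· + x) (.add (.const _) isTerm_id) (.add isTerm_id (.const _))
    (by simp only [RCAModel.add_zero, RCAModel.zero_add])
    (fun y h => by rw [RCAModel.add_succ, h, RCAModel.succ_add]) y

protected theorem add_assoc (x y z : 𝔐.M) : x + y + z = x + (y + z) :=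
  eq_induction (x + y + ·) (fun z => x + (y + z)) (.add (.const _) isTerm_id)
    (.add (.const _) (.add (.const _) isTerm_id))
    (by simp only [RCAModel.add_zero])
    (fun z h => by simp only [RCAModel.add_succ, h]) z

protected theorem zero_mul (x : 𝔐.M) : 0 * x = 0 :=
  eq_induction (0 * ·) (fun _ => 0) (.mul (.const _) isTerm_id) (.const _)
    (RCAModel.mul_zero 0)
    (fun x h => by rw [RCAModel.mul_succ, h, RCAModel.add_zero]) x

protected theorem succ_mul (x y : 𝔐.M) : (x + 1) * y = x * y + y :=
  eq_induction ((x + 1) * ·) (fun y => x * y + y) (.mul (.const _) isTerm_id)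
    (.add (.mul (.const _) isTerm_id) isTerm_id)
    (by simp only [RCAModel.mul_zero, RCAModel.add_zero]) (fun y h => by
      rw [RCAModel.mul_succ, h, RCAModel.mul_succ, ← RCAModel.add_assoc, ← RCAModel.add_assoc,
        RCAModel.add_assoc _ y x, RCAModel.add_comm y x, RCAModel.add_assoc _ x y]) y

protected theorem mul_comm (x y : 𝔐.M) : x * y = y * x :=
  eq_induction (x * ·) (· * x) (.mul (.const _) isTerm_id) (.mul isTerm_id (.const _))
    (by simp only [RCAModel.mul_zero, RCAModel.zero_mul])
    (fun y h => by rw [RCAModel.mul_succ, h, RCAModel.succ_mul]) y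

protected theorem mul_add (x y z : 𝔐.M) : x * (y + z) = x * y + x * z :=
  eq_induction (fun z => x * (y + z)) (fun z => x * y + x * z)
    (.mul (.const _) (.add (.const _) isTerm_id)) (.add (.const _) (.mul (.const _) isTerm_id))
    (by simp only [RCAModel.add_zero, RCAModel.mul_zero]) (fun z h => by
      rw [RCAModel.add_succ, RCAModel.mul_succ, h, RCAModel.mul_succ, RCAModel.add_assoc]) z

protected theorem mul_assoc (x y z : 𝔐.M) : x * y * z = x * (y * z) :=
  eq_induction (fun z => x * y * z) (fun z => x * (y * z)) (.mul (.const _) isTerm_id)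
    (.mul (.const _) (.mul (.const _) isTerm_id))
    (by simp only [RCAModel.mul_zero])
    (fun z h => by
      rw [RCAModel.mul_succ, h, RCAModel.mul_succ, RCAModel.mul_add]) z

protected theorem mul_one (x : 𝔐.M) : x * 1 = x := by
  rw [← RCAModel.zero_add 1, RCAModel.mul_succ, RCAModel.mul_zero, RCAModel.zero_add]

instance : CommSemiring 𝔐.M where
  add_assoc := RCAModel.add_assoc
  zero_add := RCAModel.zero_add
  add_zero := RCAModel.add_zero
  add_comm := RCAModel.add_comm
  left_distrib := RCAModel.mul_add
  right_distrib x y z := by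
    rw [RCAModel.mul_comm, RCAModel.mul_add, RCAModel.mul_comm z x, RCAModel.mul_comm z y]
  zero_mul := RCAModel.zero_mul
  mul_zero := RCAModel.mul_zero
  mul_assoc := RCAModel.mul_assoc
  one_mul x := by rw [RCAModel.mul_comm, RCAModel.mul_one]
  mul_one := RCAModel.mul_one
  mul_comm := RCAModel.mul_comm
  nsmul := nsmulRec

theorem add_right_cancel' {x y z : 𝔐.M} (h : x + z = y + z) : x = y := by
  have : ∀ z, x + z = y + z → x = y :=
    Sig0.induction ((Sig0.eq (.add (.const _) isTerm_id) (.add (.const _) isTerm_id)).imp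
      (Sig0.eq (.const _) (.const _))) (by simp) (fun z ih h => ih (by
        rw [← add_assoc, ← add_assoc] at h; exact RCAModel.succ_inj h))
  exact this z h

instance : IsCancelAdd 𝔐.M where
  add_left_cancel x y z h := by
    have h : x + y = x + z := h
    rw [add_comm x, add_comm x] at h; exact add_right_cancel' h
  add_right_cancel _ _ _ h := add_right_cancel' h

theorem eq_zero_or_succ (x : 𝔐.M) : x = 0 ∨ ∃ y, x = y + 1 := by
  have : Sig1 𝔐 fun x : 𝔐.M => ∃ y, x = 0 ∨ x = y + 1 :=
    ⟨fun x y => x = 0 ∨ x = y + 1, (Sig0.eq (.base (.fst .id)) (.const _)).or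
      (Sig0.eq (.base (.fst .id)) (.add (.snd .id) (.const _))), fun _ => Iff.rfl⟩
  obtain ⟨y, h | h⟩ := this.induction ⟨0, .inl rfl⟩ (fun x _ => ⟨x, .inr rfl⟩) x
  · exact .inl h
  · exact .inr ⟨y, h⟩

theorem lt_iff_exists {x y : 𝔐.M} : x < y ↔ ∃ z, y = x + z + 1 := by
  constructor
  -- The existential quantifier stands in front of the implication to make the induction predicate
  -- Σ⁰₁; z is irrelevant where x < y fails.
  · have : ∀ y, ∃ z, x < y → y = x + z + 1 := Sig1.induction
      ⟨fun y z => x < y → y = x + z + 1, (Sig0.lt (.const _) (.base (.fst .id))).imp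
        (Sig0.eq (.base (.fst .id)) (.add (.add (.const _) (.snd .id)) (.const _))),
        fun _ => Iff.rfl⟩ ⟨0, fun h => (RCAModel.not_lt_zero _ h).elim⟩ (by
          rintro y ⟨z, hz⟩
          by_cases h : x < y
          · exact ⟨z + 1, fun _ => by rw [hz h]; ring⟩
          · refine ⟨0, fun h' => ?_⟩
            rcases RCAModel.lt_succ.mp h' with h' | h'
            · exact (h h').elim
            · rw [h', add_zero])
    obtain ⟨z, hz⟩ := this y
    exact fun h => ⟨z, hz h⟩
  · rintro ⟨z, rfl⟩
    revert z
    refine Sig0.induction (Sig0.lt (.const _) (.add (.add (.const _) isTerm_id) (.const _)))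
      ?_ fun z hz => ?_
    · exact RCAModel.lt_succ.mpr (.inr (add_zero x).symm)
    · exact RCAModel.lt_succ.mpr (.inl (by rwa [← add_assoc x z 1]))

theorem le_iff_exists {x y : 𝔐.M} : x ≤ y ↔ ∃ z, y = x + z := by
  rw [Str.le_def, lt_iff_exists]
  constructor
  · rintro (⟨z, rfl⟩ | rfl)
    · exact ⟨z + 1, by ring⟩
    · exact ⟨0, (add_zero x).symm⟩
  · rintro ⟨z, rfl⟩
    rcases eq_zero_or_succ z with rfl | ⟨z, rfl⟩
    · exact .inr (add_zero x).symm
    · exact .inl ⟨z, by ring⟩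

theorem add_eq_zero' {x y : 𝔐.M} (h : x + y = 0) : y = 0 := by
  rcases eq_zero_or_succ y with rfl | ⟨y, rfl⟩
  · rfl
  · exact (RCAModel.succ_ne_zero (x + y) (by rw [add_assoc, h])).elim

protected theorem le_total (x y : 𝔐.M) : x ≤ y ∨ y ≤ x := by
  revert y
  refine Sig0.induction (((Sig0.lt (.const _) isTerm_id).or (.eq (.const _) isTerm_id)).or
    ((Sig0.lt isTerm_id (.const _)).or (.eq isTerm_id (.const _)))) ?_ ?_
  · exact .inr (le_iff_exists.mpr ⟨x, (zero_add x).symm⟩)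
  · rintro y (h | h | h)
    · obtain ⟨z, rfl⟩ := le_iff_exists.mp h
      exact .inl (le_iff_exists.mpr ⟨z + 1, by ring⟩)
    · obtain ⟨z, rfl⟩ := lt_iff_exists.mp h
      exact .inr (le_iff_exists.mpr ⟨z, by ring⟩)
    · exact .inl (le_iff_exists.mpr ⟨1, by rw [h]⟩)

protected theorem le_antisymm {x y : 𝔐.M} (h₁ : x ≤ y) (h₂ : y ≤ x) : x = y := by
  obtain ⟨z, rfl⟩ := le_iff_exists.mp h₁
  obtain ⟨w, hw⟩ := le_iff_exists.mp h₂
  have : z + w = 0 := add_left_cancel (a := x) (by rw [← add_assoc, ← hw, add_zero])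
  rw [add_comm] at this
  rw [add_eq_zero' this, add_zero]

noncomputable instance : LinearOrder 𝔐.M where
  le_refl x := .inr rfl
  le_trans x y z h₁ h₂ := by
    obtain ⟨a, rfl⟩ := le_iff_exists.mp h₁
    obtain ⟨b, rfl⟩ := le_iff_exists.mp h₂
    exact le_iff_exists.mpr ⟨a + b, by ring⟩
  lt_iff_le_not_ge x y := by
    constructor
    · intro h
      refine ⟨.inl h, fun h' => ?_⟩
      have h'' := RCAModel.le_antisymm (.inl h) h'
      subst h''
      obtain ⟨z, hz⟩ := lt_iff_exists.mp h
      exact RCAModel.succ_ne_zero z (add_left_cancel (a := x) (by rw [← add_assoc, ← hz, add_zero]))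
    · rintro ⟨h | rfl, h'⟩
      · exact h
      · exact (h' (.inr rfl)).elim
  le_antisymm _ _ := RCAModel.le_antisymm
  le_total := RCAModel.le_total
  toDecidableLE := Classical.decRel _

instance : IsStrictOrderedRing 𝔐.M where
  add_le_add_left x y h z := by
    obtain ⟨a, rfl⟩ := le_iff_exists.mp h
    exact le_iff_exists.mpr ⟨a, by ring⟩
  zero_le_one := le_iff_exists.mpr ⟨1, (zero_add 1).symm⟩
  exists_pair_ne := ⟨0, 1, fun h => RCAModel.succ_ne_zero (0 : 𝔐.M) (by rw [zero_add, h])⟩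
  le_of_add_le_add_left x y z h := by
    obtain ⟨a, ha⟩ := le_iff_exists.mp h
    exact le_iff_exists.mpr ⟨a, add_left_cancel (a := x) (by rw [ha, add_assoc])⟩
  mul_lt_mul_of_pos_left _ hx y z h := by
    obtain ⟨a, rfl⟩ := lt_iff_exists.mp h
    obtain ⟨b, rfl⟩ := lt_iff_exists.mp hx
    exact lt_iff_exists.mpr ⟨a + b + b * a, by ring⟩
  mul_lt_mul_of_pos_right _ hx y z h := by
    obtain ⟨a, rfl⟩ := lt_iff_exists.mp h
    obtain ⟨b, rfl⟩ := lt_iff_exists.mp hx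
    exact lt_iff_exists.mpr ⟨a + b + b * a, by ring⟩

instance : CanonicallyOrderedAdd 𝔐.M where
  exists_add_of_le h := le_iff_exists.mp h
  le_add_self _ y := le_iff_exists.mpr ⟨y, add_comm _ _⟩
  le_self_add _ y := le_iff_exists.mpr ⟨y, rfl⟩

protected theorem lt_add_one_iff {x y : 𝔐.M} : x < y + 1 ↔ x ≤ y := RCAModel.lt_succ

protected theorem add_one_le_iff {x y : 𝔐.M} : x + 1 ≤ y ↔ x < y := by
  rw [le_iff_exists, lt_iff_exists]
  exact exists_congr fun z => by rw [add_right_comm]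

end RCAModel

end SOA

/-! ### Closure properties of Σ⁰₁, collection, least elements and comprehension. -/

namespace SOA

variable {𝔐 : Str} {α β : Type} [Ctx 𝔐 α] [Ctx 𝔐 β]

theorem IsMap.const (b : β) : IsMap 𝔐 fun _ : α => b := ⟨fun _ _ => .const _⟩

theorem Sig1.comp {P : α → Prop} (hP : Sig1 𝔐 P) {m : β → α} (hm : IsMap 𝔐 m) :
    Sig1 𝔐 fun b => P (m b) := by
  obtain ⟨Q, hQ, h⟩ := hP
  exact ⟨fun b y => Q (m b) y, hQ.comp (.mk ⟨fun c hc => (hm.out c hc).comp (.fst .id)⟩ (.snd .id)),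
    fun b => h (m b)⟩

theorem Sig1.congr {P Q : α → Prop} (hP : Sig1 𝔐 P) (h : ∀ a, Q a ↔ P a) : Sig1 𝔐 Q := by
  rwa [show Q = P from funext fun a => propext (h a)]

theorem Sig0.ex {P : α → 𝔐.M → Prop} (hP : Sig0 𝔐 fun p : α × 𝔐.M => P p.1 p.2) :
    Sig1 𝔐 fun a => ∃ x, P a x := ⟨P, hP, fun _ => Iff.rfl⟩

variable [RCAModel 𝔐]

theorem Sig0.le {f g : α → 𝔐.M} (hf : IsTerm f) (hg : IsTerm g) : Sig0 𝔐 fun a => f a ≤ g a :=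
  (lt hf hg).or (eq hf hg)

theorem Sig0.bex_le {t : α → 𝔐.M} (ht : IsTerm t) {P : α → 𝔐.M → Prop}
    (hP : Sig0 𝔐 fun p : α × 𝔐.M => P p.1 p.2) : Sig0 𝔐 fun a => ∃ x, x ≤ t a ∧ P a x :=
  (bex (ht.add (.const 1)) hP).congr fun a => by simp only [RCAModel.lt_add_one_iff]

theorem exists_gt₂ (x y : 𝔐.M) : ∃ z, x < z ∧ y < z :=
  ⟨max x y + 1, RCAModel.lt_add_one_iff.mpr (le_max_left _ _),
    RCAModel.lt_add_one_iff.mpr (le_max_right _ _)⟩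

namespace Sig1

/-- A common bound z for both witnesses merges two unbounded quantifiers into one. -/
theorem ex {P : α → 𝔐.M → Prop} (hP : Sig1 𝔐 fun p : α × 𝔐.M => P p.1 p.2) :
    Sig1 𝔐 fun a => ∃ x, P a x := by
  obtain ⟨Q, hQ, h⟩ := hP
  refine ⟨fun a z => ∃ x, x < z ∧ ∃ y, y < z ∧ Q (a, x) y, ?_, fun a => ?_⟩
  · refine .bex (.snd .id) (.bex (.snd (.fst .id)) ?_)
    exact hQ.comp (.mk (.mk (.fst (.fst (.fst .id))) (.snd (.fst .id))) (.snd .id))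
  · constructor
    · rintro ⟨x, hx⟩
      obtain ⟨y, hy⟩ := (h (a, x)).mp hx
      obtain ⟨z, hxz, hyz⟩ := exists_gt₂ x y
      exact ⟨z, x, hxz, y, hyz, hy⟩
    · rintro ⟨z, x, -, y, -, hy⟩
      exact ⟨x, (h (a, x)).mpr ⟨y, hy⟩⟩

theorem and {P Q : α → Prop} (hP : Sig1 𝔐 P) (hQ : Sig1 𝔐 Q) : Sig1 𝔐 fun a => P a ∧ Q a := by
  obtain ⟨P', hP', h⟩ := hP
  obtain ⟨Q', hQ', h'⟩ := hQ
  refine (ex (ex (Sig0.sig1 ((hP'.comp (m := fun p : (α × 𝔐.M) × 𝔐.M => (p.1.1, p.1.2))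
    (.mk (.fst (.fst .id)) (.snd (.fst .id)))).and (hQ'.comp
      (m := fun p : (α × 𝔐.M) × 𝔐.M => (p.1.1, p.2)) (.mk (.fst (.fst .id)) (.snd .id))))))
    (P := fun a x => ∃ y, P' a x ∧ Q' a y)).congr fun a => ?_
  simp only [h, h', exists_and_left, exists_and_right]

theorem or {P Q : α → Prop} (hP : Sig1 𝔐 P) (hQ : Sig1 𝔐 Q) : Sig1 𝔐 fun a => P a ∨ Q a := by
  obtain ⟨P', hP', h⟩ := hP
  obtain ⟨Q', hQ', h'⟩ := hQ
  refine (Sig0.ex (P := fun a x => P' a x ∨ Q' a x) (hP'.or hQ')).congr fun a => ?_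
  simp only [h, h', exists_or]

/-- Induction on j ≤ m. One number b bounds both the witness y and the witness z of the matrix, so
that the induction statement is Σ⁰₁. -/
theorem collection {P : 𝔐.M → 𝔐.M → Prop} (hP : Sig1 𝔐 fun p : 𝔐.M × 𝔐.M => P p.1 p.2) {m : 𝔐.M}
    (h : ∀ x, x < m → ∃ y, P x y) : ∃ b, ∀ x, x < m → ∃ y, y < b ∧ P x y := by
  obtain ⟨Q, hQ, hPQ⟩ := hP
  have h₁ : ∀ j, ∃ b, j ≤ m → ∀ x, x < j → ∃ y, y < b ∧ ∃ z, z < b ∧ Q (x, y) z := by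
    refine Sig1.induction (Sig0.ex ?_) ⟨0, fun _ x hx => (RCAModel.not_lt_zero _ hx).elim⟩ ?_
    · refine (Sig0.le (.base (.fst .id)) (.const _)).imp (.ball (.base (.fst .id))
        (.bex (.snd (.fst .id)) (.bex (.snd (.fst (.fst .id))) ?_)))
      exact hQ.comp (.mk (.mk (.of_isTerm (.snd (.fst (.fst .id)))) (.snd (.fst .id))) (.snd .id))
    · rintro j ⟨b, hb⟩
      by_cases hj : j < m
      · obtain ⟨y, hy⟩ := h j hj
        obtain ⟨z, hz⟩ := (hPQ (j, y)).mp hy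
        refine ⟨max b (max y z + 1), fun _ x hx => ?_⟩
        rcases RCAModel.lt_succ.mp hx with hx | rfl
        · obtain ⟨y', hy', z', hz', hq⟩ := hb hj.le x hx
          exact ⟨y', lt_max_of_lt_left hy', z', lt_max_of_lt_left hz', hq⟩
        · exact ⟨y, lt_max_of_lt_right (RCAModel.lt_add_one_iff.mpr (le_max_left _ _)), z,
            lt_max_of_lt_right (RCAModel.lt_add_one_iff.mpr (le_max_right _ _)), hz⟩
      · exact ⟨0, fun hj' => (hj (RCAModel.add_one_le_iff.mp hj')).elim⟩
  obtain ⟨b, hb⟩ := h₁ m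
  refine ⟨b, fun x hx => ?_⟩
  obtain ⟨y, hy, z, -, hq⟩ := hb le_rfl x hx
  exact ⟨y, hy, (hPQ (x, y)).mpr ⟨z, hq⟩⟩

/-- Collection bounds the witnesses uniformly, so the unbounded quantifier can be moved in front of
the bounded one. -/
theorem ball {t : α → 𝔐.M} (ht : IsTerm t) {P : α → 𝔐.M → Prop}
    (hP : Sig1 𝔐 fun p : α × 𝔐.M => P p.1 p.2) : Sig1 𝔐 fun a => ∀ x, x < t a → P a x := by
  obtain ⟨Q, hQ, h⟩ := hP
  refine (Sig0.ex (P := fun a b => ∀ x, x < t a → ∃ y, y < b ∧ Q (a, x) y) ?_).congr fun a => ?_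
  · exact .ball (ht.comp (.fst .id)) (.bex (.snd (.fst .id))
      (hQ.comp (.mk (.mk (.fst (.fst (.fst .id))) (.snd (.fst .id))) (.snd .id))))
  · constructor
    · intro ha
      have hQ' : Sig0 𝔐 fun p : 𝔐.M × 𝔐.M => Q (a, p.1) p.2 :=
        hQ.comp (.mk (.mk (.const a) (.base (.fst .id))) (.snd .id))
      exact collection hQ'.sig1 fun x hx => (h (a, x)).mp (ha x hx)
    · rintro ⟨b, hb⟩ x hx
      obtain ⟨y, -, hy⟩ := hb x hx
      exact (h (a, x)).mpr ⟨y, hy⟩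

end Sig1

/-- The least number principle for `Π⁰₁` predicates. -/
theorem Sig1.exists_least {P : 𝔐.M → Prop} (hP : Sig1 𝔐 fun x => ¬ P x) (h : ∃ x, P x) :
    ∃ x, P x ∧ ∀ y, y < x → ¬ P y := by
  refine Classical.byContradiction fun hn => ?_
  -- That P fails everywhere below x is a Σ⁰₁ condition on x, and it is inductive if P has no least
  -- element.
  have : ∀ x, ∀ y, y < x → ¬ P y := by
    refine Sig1.induction (.ball (.base .id) (hP.comp (.of_isTerm (.snd .id))))
      (fun y hy => (RCAModel.not_lt_zero _ hy).elim) fun x ih y hy => ?_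
    rcases RCAModel.lt_succ.mp hy with hy | rfl
    · exact ih y hy
    · exact fun hy => hn ⟨y, hy, ih⟩
  obtain ⟨x, hx⟩ := h
  exact this (x + 1) x (RCAModel.lt_add_one_iff.mpr le_rfl) hx

theorem Sig0.exists_least {P : 𝔐.M → Prop} (hP : Sig0 𝔐 P) (h : ∃ x, P x) :
    ∃ x, P x ∧ ∀ y, y < x → ¬ P y := hP.not.sig1.exists_least h

theorem Sig1.comprehension {P : 𝔐.M → Prop} (hP : Sig1 𝔐 P) (hP' : Sig1 𝔐 fun x => ¬ P x) :
    ∃ X : 𝔐.S, ∀ x, x ∈ X ↔ P x := by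
  obtain ⟨Q, hQ, h⟩ := hP
  obtain ⟨Q', hQ', h'⟩ := hP'
  obtain ⟨θ, hθ, v, e, hQθ⟩ := hQ.formula₂
  obtain ⟨θ', hθ', v', e', hQθ'⟩ := Sig0.formula₂ (Q := fun x y => ¬ Q' x y) hQ'.not
  -- Variables 0 and 1 stay in place; the parameters of the two formulas move to the even and odd
  -- places of one merged valuation.
  let σ : ℕ → Tm := scons (.var 0) (scons (.var 1) fun i => .var (2 * i + 2))
  let σ' : ℕ → Tm := scons (.var 0) (scons (.var 1) fun i => .var (2 * i + 3))
  have hσ : ∀ x y, (fun i => (σ i).val 𝔐 (scons y (scons x (mix v v')))) =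
      scons y (scons x v) := by
    intro x y; funext i; rcases i with _ | _ | i
    · rfl
    · rfl
    · exact mix_even v v' i
  have hσ' : ∀ x y, (fun i => (σ' i).val 𝔐 (scons y (scons x (mix v v')))) =
      scons y (scons x v') := by
    intro x y; funext i; rcases i with _ | _ | i
    · rfl
    · rfl
    · exact mix_odd v v' i
  have := RCAModel.models (𝔐 := 𝔐) _ (.comprehension ⟨θ.subst σ (2 * ·), hθ.subst _ _, rfl⟩
    ⟨θ'.subst σ' (2 * · + 1), hθ'.subst _ _, rfl⟩) (mix v v') (mix e e')
  simp only [comprehensionAx, Fm.holds_exS, Fm.shiftS, Fm.holds_subst, Fm.Holds, Fm.holds_iff,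
    Fm.holds_ex, Tm.val, scons_succ, scons_zero, hσ, hσ', mix_even, mix_odd, ← hQθ, ← hQθ',
    ← not_exists, ← h, ← h', not_not, implies_true, true_implies] at this
  exact this

theorem Sig0.comprehension {P : 𝔐.M → Prop} (hP : Sig0 𝔐 P) :
    ∃ X : 𝔐.S, ∀ x, x ∈ X ↔ P x := hP.sig1.comprehension hP.not.sig1

/-! ### Inference of definability -/

section
variable {f g : α → 𝔐.M} {P Q : α → Prop} {R : α → 𝔐.M → Prop}

instance : IsMap 𝔐 fun a : α => a := .id
instance {f : α → β × 𝔐.M} [h : IsMap 𝔐 f] : IsMap 𝔐 fun a => (f a).1 := .fst h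

instance (priority := low) [h : IsMap 𝔐 f] : IsTerm f := .base h
instance {f : α → β × 𝔐.M} [h : IsMap 𝔐 f] : IsTerm fun a => (f a).2 := .snd h
instance (c : 𝔐.M) : IsTerm fun _ : α => c := .const c
instance [h : IsTerm f] [h' : IsTerm g] : IsTerm fun a => f a + g a := .add h h'
instance [h : IsTerm f] [h' : IsTerm g] : IsTerm fun a => f a * g a := .mul h h'

instance [h : IsTerm f] [h' : IsTerm g] : Sig0 𝔐 fun a => f a = g a := .eq h h'
instance [h : IsTerm f] [h' : IsTerm g] : Sig0 𝔐 fun a => f a < g a := .lt h h'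
instance [h : IsTerm f] (X : 𝔐.S) : Sig0 𝔐 fun a => f a ∈ X := .mem h X
instance [h : Sig0 𝔐 P] : Sig0 𝔐 fun a => ¬ P a := h.not
instance [h : Sig0 𝔐 P] [h' : Sig0 𝔐 Q] : Sig0 𝔐 fun a => P a → Q a := h.imp h'
instance [h : Sig0 𝔐 P] [h' : Sig0 𝔐 Q] : Sig0 𝔐 fun a => P a ∧ Q a := h.and h'
instance [h : Sig0 𝔐 P] [h' : Sig0 𝔐 Q] : Sig0 𝔐 fun a => P a ∨ Q a := h.or h'
instance [h : Sig0 𝔐 P] [h' : Sig0 𝔐 Q] : Sig0 𝔐 fun a => P a ↔ Q a := h.iff h'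
instance [h : IsTerm f] [h' : Sig0 𝔐 fun p : α × 𝔐.M => R p.1 p.2] :
    Sig0 𝔐 fun a => ∀ x, x < f a → R a x := .ball h h'
instance [h : IsTerm f] [h' : Sig0 𝔐 fun p : α × 𝔐.M => R p.1 p.2] :
    Sig0 𝔐 fun a => ∃ x, x < f a ∧ R a x := .bex h h'
instance [h : IsTerm f] [h' : Sig0 𝔐 fun p : α × 𝔐.M => R p.1 p.2] :
    Sig0 𝔐 fun a => ∃ x, x ≤ f a ∧ R a x := .bex_le h h'

instance (priority := high) [h : Sig0 𝔐 P] : Sig1 𝔐 P := h.sig1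
instance [h : Sig1 𝔐 P] [h' : Sig1 𝔐 Q] : Sig1 𝔐 fun a => P a ∧ Q a := h.and h'
instance [h : Sig1 𝔐 P] [h' : Sig1 𝔐 Q] : Sig1 𝔐 fun a => P a ∨ Q a := h.or h'
instance [h : Sig1 𝔐 fun p : α × 𝔐.M => R p.1 p.2] : Sig1 𝔐 fun a => ∃ x, R a x := .ex h
instance [h : IsTerm f] [h' : Sig1 𝔐 fun p : α × 𝔐.M => R p.1 p.2] :
    Sig1 𝔐 fun a => ∀ x, x < f a → R a x := .ball h h'

end

/-! In the following, the definability assumptions have a dummy parameter, because an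
abstraction `fun x => l + x` would be eta-reduced during the inference. -/

section
variable (P : 𝔐.M → Prop)

omit [RCAModel 𝔐] in
theorem Sig0.of_snd (h : Sig0 𝔐 fun p : 𝔐.M × 𝔐.M => P p.2 := by infer_instance) : Sig0 𝔐 P :=
  h.comp (.mk (.const 𝔐.zero) (.base .id))

omit [RCAModel 𝔐] in
theorem Sig1.of_snd (h : Sig1 𝔐 fun p : 𝔐.M × 𝔐.M => P p.2 := by infer_instance) : Sig1 𝔐 P :=
  h.comp (.mk (.const 𝔐.zero) (.base .id))

theorem sig1_induction (h0 : P 0) (hs : ∀ x, P x → P (x + 1)) (x : 𝔐.M)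
    (h : Sig1 𝔐 fun p : 𝔐.M × 𝔐.M => P p.2 := by infer_instance) : P x :=
  (Sig1.of_snd P).induction h0 hs x

theorem sig0_exists_least (hP : ∃ x, P x)
    (h : Sig0 𝔐 fun p : 𝔐.M × 𝔐.M => P p.2 := by infer_instance) :
    ∃ x, P x ∧ ∀ y, y < x → ¬ P y :=
  (Sig0.of_snd P).exists_least hP

theorem sig0_comprehension (h : Sig0 𝔐 fun p : 𝔐.M × 𝔐.M => P p.2 := by infer_instance) :
    ∃ X : 𝔐.S, ∀ x, x ∈ X ↔ P x :=
  (Sig0.of_snd P).comprehension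

theorem sig1_comprehension (Q : 𝔐.M → Prop) (hPQ : ∀ x, ¬ P x ↔ Q x)
    (h : Sig1 𝔐 fun p : 𝔐.M × 𝔐.M => P p.2 := by infer_instance)
    (h' : Sig1 𝔐 fun p : 𝔐.M × 𝔐.M => Q p.2 := by infer_instance) :
    ∃ X : 𝔐.S, ∀ x, x ∈ X ↔ P x :=
  (Sig1.of_snd P).comprehension ((Sig1.of_snd Q).congr hPQ)

end

end SOA

/-! ### Codes of finite sets in a model. -/

namespace SOA

set_option synthInstance.maxSize 100000
set_option synthInstance.maxHeartbeats 400000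

variable {𝔐 : Str} {α β : Type} [Ctx 𝔐 α] [Ctx 𝔐 β] [RCAModel 𝔐]

/-! ### Arithmetic -/

namespace RCAModel

theorem le_self_mul_self (x : 𝔐.M) : x ≤ x * x := by
  rcases eq_zero_or_succ x with rfl | ⟨y, rfl⟩
  · simp
  · exact le_iff_exists.mpr ⟨y * y + y, by ring⟩

/-- Subtraction is replaced by a comparison of the two quotients. -/
theorem dvd_of_dvd_add {a b c : 𝔐.M} (h₁ : a ∣ b) (h : a ∣ b + c) : a ∣ c := by
  obtain ⟨u, rfl⟩ := h₁
  obtain ⟨v, hv⟩ := h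
  rcases RCAModel.le_total u v with h | h
  · obtain ⟨w, rfl⟩ := le_iff_exists.mp h
    exact ⟨w, add_left_cancel (a := a * u) (by rw [hv]; ring)⟩
  · obtain ⟨w, rfl⟩ := le_iff_exists.mp h
    have : c = 0 := add_eq_zero' (x := a * w) (add_left_cancel (a := a * v) (by rw [add_zero]; linear_combination hv))
    exact this ▸ dvd_zero a

end RCAModel

open RCAModel

instance {f g : α → 𝔐.M} [IsTerm f] [IsTerm g] : Sig0 𝔐 fun a => f a ∣ g a := by
  refine Sig0.congr (P := fun a => ∃ q, q ≤ g a ∧ g a = f a * q) ?_ fun a => ?_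
  · have : IsTerm fun p : α × 𝔐.M => g p.1 := IsTerm.comp ‹_› inferInstance
    have : IsTerm fun p : α × 𝔐.M => f p.1 := IsTerm.comp ‹_› inferInstance
    infer_instance
  · constructor
    · rintro ⟨q, hq⟩
      -- The quotient has to be at most `g a`. This is automatic for a nonzero divisor; for divisor
      -- 0 the quotient 0 serves.
      rcases eq_zero_or_succ (f a) with h | ⟨b, h⟩
      · exact ⟨0, zero_le, by rw [hq, h, zero_mul, mul_zero]⟩
      · exact ⟨q, le_iff_exists.mpr ⟨b * q, by rw [hq, h]; ring⟩, hq⟩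
    · rintro ⟨q, -, hq⟩
      exact ⟨q, hq⟩

/-! ### Pairs and codes of finite sets -/

/-- The pair `(i, j) = (i + j)² + i`. -/
def pr (i j : 𝔐.M) : 𝔐.M := (i + j) * (i + j) + i

def IsTriple (x : 𝔐.M) : Prop := ∃ k m n, x = pr k (pr m n)

def Elts (x i : 𝔐.M) : Prop := ∃ k m n, x = pr k (pr m n) ∧ i < k ∧ m * (i + 1) + 1 ∣ n

def IsFin (x : 𝔐.M) : Prop :=
  IsTriple x ∧ ∀ y, y < x → IsTriple y →
    ¬ ((∀ i, Elts y i → Elts x i) ∧ ∀ i, Elts x i → Elts y i)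

theorem pr_mono {i j i' j' : 𝔐.M} (h : i ≤ i') (h' : j ≤ j') : pr i j ≤ pr i' j' := by
  unfold pr; gcongr

theorem fst_le_pr (i j : 𝔐.M) : i ≤ pr i j := le_add_self

theorem snd_le_pr (i j : 𝔐.M) : j ≤ pr i j :=
  (le_add_self.trans (le_self_mul_self (i + j))).trans le_self_add

/-- Since i ≤ i + j, the value (i + j)² + i lies below (i + j + 1)². So a pair determines the sum of
its components, which is the key to injectivity. -/
theorem pr_lt_pr {i j i' j' : 𝔐.M} (h : i + j < i' + j') : pr i j < pr i' j' := by
  obtain ⟨z, hz⟩ := lt_iff_exists.mp h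
  refine lt_iff_exists.mpr ⟨i + 2 * j + 2 * z * (i + j) + z * z + 2 * z + i', ?_⟩
  simp only [pr, hz]; ring

theorem pr_lt_pr_right {i j j' : 𝔐.M} (h : j < j') : pr i j < pr i j' :=
  pr_lt_pr (by gcongr)

theorem pr_inj {i j i' j' : 𝔐.M} : pr i j = pr i' j' ↔ i = i' ∧ j = j' := by
  refine ⟨fun h => ?_, fun h => by rw [h.1, h.2]⟩
  have hs : i + j = i' + j' := by
    rcases lt_trichotomy (i + j) (i' + j') with h' | h' | h'
    · exact ((pr_lt_pr h').ne h).elim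
    · exact h'
    · exact ((pr_lt_pr h').ne' h).elim
  have hi : i = i' := by
    simp only [pr, hs] at h
    exact add_left_cancel h
  subst hi
  exact ⟨rfl, add_left_cancel hs⟩

instance {f g : α → 𝔐.M} [IsTerm f] [IsTerm g] : IsTerm fun a => pr (f a) (g a) := by
  unfold pr; infer_instance

theorem Elts.lt {x i : 𝔐.M} (h : Elts x i) : i < x := by
  obtain ⟨k, m, n, rfl, h, -⟩ := h
  exact h.trans_le (fst_le_pr _ _)

theorem elts_pr {k m n i : 𝔐.M} : Elts (pr k (pr m n)) i ↔ i < k ∧ m * (i + 1) + 1 ∣ n := by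
  constructor
  · rintro ⟨k', m', n', h, h'⟩
    obtain ⟨hk, h⟩ := pr_inj.mp h
    obtain ⟨hm, hn⟩ := pr_inj.mp h
    rwa [hk, hm, hn]
  · exact fun h => ⟨k, m, n, rfl, h⟩

theorem triple_le (k m n : 𝔐.M) :
    k ≤ pr k (pr m n) ∧ m ≤ pr k (pr m n) ∧ n ≤ pr k (pr m n) :=
  ⟨fst_le_pr _ _, (fst_le_pr _ _).trans (snd_le_pr _ _), (snd_le_pr _ _).trans (snd_le_pr _ _)⟩

/-- The components of a triple are at most the triple, so all quantifiers can be bounded by it. -/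
theorem sig0_elts : Sig0 𝔐 fun p : 𝔐.M × 𝔐.M => Elts p.1 p.2 := by
  refine Sig0.congr (P := fun p : 𝔐.M × 𝔐.M => ∃ k, k ≤ p.1 ∧ ∃ m, m ≤ p.1 ∧ ∃ n, n ≤ p.1 ∧
    p.1 = pr k (pr m n) ∧ p.2 < k ∧ m * (p.2 + 1) + 1 ∣ n) (by infer_instance) fun p => ?_
  constructor
  · rintro ⟨k, m, n, h, h'⟩
    have := triple_le k m n
    rw [← h] at this
    exact ⟨k, this.1, m, this.2.1, n, this.2.2, h, h'⟩
  · rintro ⟨k, -, m, -, n, -, h⟩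
    exact ⟨k, m, n, h⟩

instance {f g : α → 𝔐.M} [IsTerm f] [h : IsTerm g] : Sig0 𝔐 fun a => Elts (f a) (g a) :=
  sig0_elts.comp (.mk (.of_isTerm ‹_›) h)

theorem sig0_isTriple : Sig0 𝔐 fun x : 𝔐.M => IsTriple x := by
  refine Sig0.congr (P := fun x : 𝔐.M => ∃ k, k ≤ x ∧ ∃ m, m ≤ x ∧ ∃ n, n ≤ x ∧
    x = pr k (pr m n)) (by infer_instance) fun x => ?_
  constructor
  · rintro ⟨k, m, n, h⟩
    have := triple_le k m n
    rw [← h] at this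
    exact ⟨k, this.1, m, this.2.1, n, this.2.2, h⟩
  · rintro ⟨k, -, m, -, n, -, h⟩
    exact ⟨k, m, n, h⟩

instance {f : α → 𝔐.M} [IsTerm f] : Sig0 𝔐 fun a => IsTriple (f a) :=
  sig0_isTriple.comp (.of_isTerm ‹_›)

theorem sig0_isFin : Sig0 𝔐 fun x : 𝔐.M => IsFin x := by
  refine Sig0.congr (Sig0.of_snd fun x : 𝔐.M => IsTriple x ∧ ∀ y, y < x → IsTriple y →
    ¬ ((∀ i, i < y → Elts y i → Elts x i) ∧ ∀ i, i < x → Elts x i → Elts y i)) fun x => ?_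
  unfold IsFin
  refine and_congr Iff.rfl (forall₃_congr fun y _ _ => not_congr (and_congr ?_ ?_)) <;>
  exact ⟨fun h i _ hi => h i hi, fun h i hi => h i hi.lt hi⟩

instance {f : α → 𝔐.M} [IsTerm f] : Sig0 𝔐 fun a => IsFin (f a) :=
  sig0_isFin.comp (.of_isTerm ‹_›)

theorem IsFin.ext {x y : 𝔐.M} (hx : IsFin x) (hy : IsFin y) (h : ∀ i, Elts x i ↔ Elts y i) :
    x = y := by
  rcases lt_trichotomy x y with hxy | hxy | hxy
  · exact (hy.2 x hxy hx.1 ⟨fun i => (h i).mp, fun i => (h i).mpr⟩).elim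
  · exact hxy
  · exact (hx.2 y hxy hy.1 ⟨fun i => (h i).mpr, fun i => (h i).mp⟩).elim

/-- Take the least triple with the same elements. Elements are smaller than codes, so agreement
below y + x suffices and the condition is bounded. -/
theorem IsTriple.exists_isFin {x : 𝔐.M} (hx : IsTriple x) :
    ∃ y, y ≤ x ∧ IsFin y ∧ ∀ i, Elts y i ↔ Elts x i := by
  have hiff : ∀ y, (∀ i, i < y + x → (Elts y i ↔ Elts x i)) ↔ ∀ i, Elts y i ↔ Elts x i :=
    fun y => ⟨fun h i => ⟨fun hi => (h i (hi.lt.trans_le le_self_add)).mp hi,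
      fun hi => (h i (hi.lt.trans_le le_add_self)).mpr hi⟩, fun h i _ => h i⟩
  obtain ⟨y, ⟨hy, hyx⟩, hmin⟩ := sig0_exists_least (𝔐 := 𝔐)
    (fun y => IsTriple y ∧ ∀ i, i < y + x → (Elts y i ↔ Elts x i))
    ⟨x, hx, fun _ _ => Iff.rfl⟩
  rw [hiff] at hyx
  refine ⟨y, ?_, ⟨hy, fun z hz hz' h => ?_⟩, hyx⟩
  · exact not_lt.mp fun h => hmin x h ⟨hx, fun _ _ => Iff.rfl⟩
  · exact hmin z hz ⟨hz', (hiff z).mpr fun i =>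
      ⟨fun hi => (hyx i).mp (h.1 i hi), fun hi => h.2 i ((hyx i).mpr hi)⟩⟩

/-! ### Coding of bounded sets -/

/-- `b` is the pair of `m` and the pair of a common multiple `l` of `1, …, m` and a common
multiple of the numbers `l (i + 1) + 1` for `i < m`. -/
def CodeBound (m b : 𝔐.M) : Prop :=
  ∃ l, l ≤ b ∧ ∃ N, N ≤ b ∧ b = pr m (pr l N) ∧ 0 < l ∧ 0 < N ∧
    (∀ i, i < m → i + 1 ∣ l) ∧ ∀ i, i < m → l * (i + 1) + 1 ∣ N

instance {f g : α → 𝔐.M} [IsTerm f] [h : IsTerm g] : Sig0 𝔐 fun a => CodeBound (f a) (g a) :=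
  Sig0.comp (P := fun p : 𝔐.M × 𝔐.M => CodeBound p.1 p.2) (by unfold CodeBound; infer_instance)
    (.mk (.of_isTerm ‹_›) h)

theorem exists_common_multiple (f : 𝔐.M → 𝔐.M) (hf : ∀ x, 0 < f x) (m : 𝔐.M)
    (hf' : IsTerm fun p : 𝔐.M × 𝔐.M => f p.2 := by infer_instance) :
    ∃ l, 0 < l ∧ ∀ i, i < m → f i ∣ l := by
  have : IsTerm fun p : ((𝔐.M × 𝔐.M) × 𝔐.M) × 𝔐.M => f p.2 :=
    hf'.comp (.mk (.fst (.fst (.fst .id))) inferInstance)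
  refine sig1_induction (fun m => ∃ l, 0 < l ∧ ∀ i, i < m → f i ∣ l)
    ⟨1, zero_lt_one, fun i hi => (RCAModel.not_lt_zero _ hi).elim⟩ ?_ m
  rintro m ⟨l, hl, h⟩
  refine ⟨l * f m, mul_pos hl (hf m), fun i hi => ?_⟩
  rcases RCAModel.lt_succ.mp hi with hi | rfl
  · exact (h i hi).mul_right _
  · exact dvd_mul_left _ _

theorem exists_codeBound (m : 𝔐.M) : ∃ b, CodeBound m b := by
  obtain ⟨l, hl, hl'⟩ := exists_common_multiple (𝔐 := 𝔐) (fun i => i + 1)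
    (fun x => RCAModel.lt_add_one_iff.mpr zero_le) m
  obtain ⟨N, hN, hN'⟩ := exists_common_multiple (𝔐 := 𝔐) (fun i => l * (i + 1) + 1)
    (fun x => RCAModel.lt_add_one_iff.mpr zero_le) m
  have := triple_le m l N
  exact ⟨_, l, this.2.1, N, this.2.2, rfl, hl, hN, hl', hN'⟩

/-- The modulus l(i + 1) + 1 is coprime to l: it divides xl(i + 1), which differs from a multiple of
the modulus by x. -/
theorem dvd_of_dvd_mul_factor {l i x : 𝔐.M} (h : l * (i + 1) + 1 ∣ x * l) :
    l * (i + 1) + 1 ∣ x := by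
  refine dvd_of_dvd_add (h.mul_right (i + 1)) (c := x) ?_
  exact ⟨x, by ring⟩

/-- Distinct moduli are coprime. They differ by l(e + 1) with e < m, and e + 1 divides l; so the
modulus divides xl², and l can be cancelled twice. -/
theorem dvd_of_dvd_mul_modulus {m l i j x : 𝔐.M} (hl : ∀ i, i < m → i + 1 ∣ l) (hi : i < m)
    (hj : j < m) (hij : i ≠ j) (h : l * (i + 1) + 1 ∣ x * (l * (j + 1) + 1)) :
    l * (i + 1) + 1 ∣ x := by
  have key : ∀ e, e < m → l * (i + 1) + 1 ∣ x * l * (e + 1) → l * (i + 1) + 1 ∣ x := by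
    intro e he h
    obtain ⟨q, hq⟩ := hl e he
    have := h.mul_right q
    rw [mul_assoc (x * l), ← hq] at this
    exact dvd_of_dvd_mul_factor (dvd_of_dvd_mul_factor this)
  rcases lt_or_gt_of_ne hij with hij | hij
  · obtain ⟨e, rfl⟩ := lt_iff_exists.mp hij
    refine key e (lt_of_le_of_lt ?_ hj) (dvd_of_dvd_add (b := x * (l * (i + 1) + 1))
      (dvd_mul_left _ _) ?_)
    · rw [add_assoc, add_comm, add_assoc]; exact le_self_add
    · convert h using 1; ring
  · obtain ⟨e, rfl⟩ := lt_iff_exists.mp hij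
    refine key e (lt_of_le_of_lt ?_ hi) (dvd_of_dvd_add h ?_)
    · rw [add_assoc, add_comm, add_assoc]; exact le_self_add
    · exact ⟨x, by ring⟩

/-- Bounded Σ⁰₁ comprehension. Take the least n > 0 divisible by the moduli of all i < m in A; this
condition is Π⁰₁. If the modulus of some j outside A divided n, the quotient would be smaller and,
by coprimality, still divisible by the required moduli. Minimality replaces the formation of a
product over A, and also gives n ≤ N. -/
theorem CodeBound.exists_code {m b : 𝔐.M} (h : CodeBound m b) (A : 𝔐.M → Prop)
    (hA : Sig1 𝔐 fun p : 𝔐.M × 𝔐.M => A p.2 := by infer_instance) :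
    ∃ x, x ≤ b ∧ IsFin x ∧ ∀ i, Elts x i ↔ i < m ∧ A i := by
  obtain ⟨l, -, N, -, rfl, hl, hN, hl', hN'⟩ := h
  have hA' : Sig1 𝔐 fun p : (𝔐.M × 𝔐.M) × 𝔐.M => A p.2 := hA.comp (.mk (.const 0) inferInstance)
  obtain ⟨n, ⟨hn, hn'⟩, hmin⟩ := Sig1.exists_least (𝔐 := 𝔐)
    (P := fun n => 0 < n ∧ ∀ i, i < m → A i → l * (i + 1) + 1 ∣ n)
    (Sig1.congr (Sig1.of_snd fun n => ¬ 0 < n ∨ ∃ i, A i ∧ i < m ∧ ¬ l * (i + 1) + 1 ∣ n) fun n => by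
        constructor
        · intro h
          by_contra! h'
          exact h ⟨h'.1, fun i hi hi' => h'.2 i hi' hi⟩
        · rintro (h | ⟨i, hi, hi', h⟩) h'
          · exact h h'.1
          · exact h (h'.2 i hi' hi)) ⟨N, hN, fun i hi _ => hN' i hi⟩
  have hnN : n ≤ N := not_lt.mp fun h => hmin N h ⟨hN, fun i hi _ => hN' i hi⟩
  obtain ⟨x, hx, hx', hxe⟩ := IsTriple.exists_isFin (x := pr m (pr l n)) ⟨_, _, _, rfl⟩
  refine ⟨x, hx.trans (pr_mono le_rfl (pr_mono le_rfl hnN)), hx', fun j => ?_⟩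
  rw [hxe, elts_pr]
  refine and_congr_right fun hj => ⟨fun ⟨q, hq⟩ => ?_, hn' j hj⟩
  by_contra hAj
  rw [hq] at hn
  refine hmin q ?_ ⟨pos_of_mul_pos_right hn zero_le, fun i hi hAi => ?_⟩
  · have hq0 := pos_of_mul_pos_right hn zero_le
    rw [hq, add_mul, one_mul]
    have := mul_pos (mul_pos hl (RCAModel.lt_add_one_iff.mpr (zero_le : 0 ≤ j))) hq0
    exact lt_add_of_pos_left _ this
  · refine dvd_of_dvd_mul_modulus hl' hi hj (fun h => hAj (h ▸ hAi)) (x := q) ?_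
    rw [mul_comm q, ← hq]
    exact hn' i hi hAi

theorem exists_code (m : 𝔐.M) (A : 𝔐.M → Prop)
    (hA : Sig1 𝔐 fun p : 𝔐.M × 𝔐.M => A p.2 := by infer_instance) :
    ∃ x, IsFin x ∧ ∀ i, Elts x i ↔ i < m ∧ A i := by
  obtain ⟨b, hb⟩ := exists_codeBound m
  obtain ⟨x, -, hx⟩ := hb.exists_code A
  exact ⟨x, hx⟩

/-- With this, quantifiers over the codes of all subsets of {0, …, m - 1} can be bounded by b. -/
theorem CodeBound.le {m b x : 𝔐.M} (h : CodeBound m b) (hx : IsFin x) (hxm : ∀ i, Elts x i → i < m) :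
    x ≤ b := by
  obtain ⟨y, hy, hy', h⟩ := h.exists_code fun i => Elts x i
  rwa [hx.ext hy' fun i => ⟨fun hi => (h i).mpr ⟨hxm i hi, hi⟩, fun hi => ((h i).mp hi).2⟩]

end SOA

/-! ### Sequences, colourings and the combinatorial principles read inside a model. -/

namespace SOA

set_option synthInstance.maxSize 100000
set_option synthInstance.maxHeartbeats 400000

variable {𝔐 : Str} {α β : Type} [Ctx 𝔐 α] [Ctx 𝔐 β] [RCAModel 𝔐]

open RCAModel

/-! ### Finite sequences, colourings and homogeneous sets in a model -/

/-- `f` is the graph of a function `P → Q`. -/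
def IsFun (f P Q : 𝔐.M → Prop) : Prop :=
  (∀ z, f z → ∃ x y, z = pr x y ∧ P x ∧ Q y) ∧
    ∀ x, P x → ∃ y, f (pr x y) ∧ ∀ y', f (pr x y') → y' = y

/-- `s` codes a sequence of length `l` with entries in `P`. -/
def IsSeq (P : 𝔐.M → Prop) (l s : 𝔐.M) : Prop := IsFin s ∧ IsFun (Elts s) (· < l) P

/-- `s` codes an increasing sequence of length `d` with entries in `P`. -/
def Tuples (P : 𝔐.M → Prop) (d s : 𝔐.M) : Prop :=
  IsSeq P d s ∧ ∀ i i' x x', Elts s (pr i x) ∧ Elts s (pr i' x') ∧ i < i' → x < x'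

/-- `H` has exactly `n` elements. -/
def HasSize (H : 𝔐.M → Prop) (n : 𝔐.M) : Prop :=
  ∃ s, Tuples H n s ∧ ∀ x, H x → ∃ i, Elts s (pr i x)

/-- `P` is unbounded. -/
def IsInf (P : 𝔐.M → Prop) : Prop := ∀ m, ∃ n, m < n ∧ P n

/-- `C` is constant on the `d`-subsets of `H`. -/
def IsHomog (d : 𝔐.M) (C H : 𝔐.M → Prop) : Prop :=
  ∀ s t c, Tuples H d s ∧ Tuples H d t ∧ C (pr s c) → C (pr t c)

/-- Ramsey's theorem holds in the model. -/
def RTIn (k d : 𝔐.M) : Prop :=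
  ∀ C : 𝔐.S, IsFun (· ∈ C) (Tuples (fun x => x = x) d) (· < k) →
    ∃ H : 𝔐.S, IsInf (· ∈ H) ∧ IsHomog d (· ∈ C) (· ∈ H)

/-- `F` is asymptotically stable in the model. -/
def ASIn (F : 𝔐.S) : Prop :=
  IsFun (· ∈ F) IsFin (fun x => x = x) ∧
  ∀ X : 𝔐.S, (IsFun (· ∈ X) (fun x => x = x) IsFin ∧
      ∀ i x y, pr i x ∈ X ∧ pr (i + 1) y ∈ X → ∀ z, Elts x z → Elts y z) →
    ∃ i, ∀ j, i ≤ j → ∀ x y u, pr i x ∈ X ∧ pr j y ∈ X ∧ pr x u ∈ F → pr y u ∈ F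

/-- The finite version of Ramsey's theorem holds in the model. -/
def FRTIn (k d : 𝔐.M) : Prop :=
  ∀ F : 𝔐.S, ASIn F → ∃ R, ∀ C, IsFin C ∧ IsFun (Elts C) (Tuples (· ≤ R) d) (· < k) →
    ∃ H, IsFin H ∧ (∀ x, Elts H x → x ≤ R) ∧ IsHomog d (Elts C) (Elts H) ∧
      ∃ n y, HasSize (Elts H) n ∧ pr H y ∈ F ∧ y < n

/-- `T` is a binary tree in the model. -/
def BinTreeIn (T : 𝔐.S) : Prop :=
  (∀ s, s ∈ T → ∃ l, IsSeq (· < 1 + 1) l s) ∧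
  ∀ s t l, s ∈ T ∧ IsSeq (fun x => x = x) l t ∧ (∀ z, Elts t z → Elts s z) → t ∈ T

/-- `g` is a path through `T` in the model. -/
def PathIn (g T : 𝔐.S) : Prop :=
  IsFun (· ∈ g) (fun x => x = x) (· < 1 + 1) ∧
  ∀ n, ∃ s, s ∈ T ∧ IsSeq (fun x => x = x) n s ∧ ∀ z, Elts s z → z ∈ g

/-- Weak König's lemma holds in the model. -/
def WKLIn (𝔐 : Str) [RCAModel 𝔐] : Prop :=
  ∀ T : 𝔐.S, BinTreeIn T ∧ IsInf (· ∈ T) → ∃ g, PathIn g T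

-- The map m is arbitrary, so a local copy of this lemma acts as an instance under any number of
-- further quantifiers.
omit [RCAModel 𝔐] in
theorem IsTerm.weaken {f : α → 𝔐.M} (h : IsTerm f) {γ : Type} [Ctx 𝔐 γ] (m : γ → α)
    [hm : IsMap 𝔐 m] : IsTerm fun c => f (m c) := h.comp hm

omit [RCAModel 𝔐] in
theorem Sig0.weaken {P : α → 𝔐.M → Prop} (h : Sig0 𝔐 fun p : α × 𝔐.M => P p.1 p.2) {γ : Type}
    [Ctx 𝔐 γ] (m : γ → α) (t : γ → 𝔐.M) [hm : IsMap 𝔐 m] [ht : IsTerm t] :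
    Sig0 𝔐 fun c => P (m c) (t c) := h.comp (.mk hm ht)

/-- Bounding the quantifiers by the code is possible since indices and entries are smaller than it;
this makes the notion Σ⁰₀ whenever P is. -/
theorem isSeq_iff {P : 𝔐.M → Prop} {l s : 𝔐.M} : IsSeq P l s ↔ IsFin s ∧
    (∀ z, z < s → Elts s z → ∃ x, x ≤ z ∧ ∃ y, y ≤ z ∧ z = pr x y ∧ x < l ∧ P y) ∧
    ∀ x, x < l → ∃ y, y < s ∧ Elts s (pr x y) ∧ ∀ y', y' < s → Elts s (pr x y') → y' = y := by
  refine and_congr_right fun _ => and_congr ⟨fun h z _ hz => ?_, fun h z hz => ?_⟩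
    (forall₂_congr fun x _ => ⟨?_, ?_⟩)
  · obtain ⟨x, y, rfl, h'⟩ := h z hz
    exact ⟨x, fst_le_pr _ _, y, snd_le_pr _ _, rfl, h'⟩
  · obtain ⟨x, -, y, -, h'⟩ := h z hz.lt hz
    exact ⟨x, y, h'⟩
  · rintro ⟨y, h, h'⟩
    exact ⟨y, (snd_le_pr _ _).trans_lt h.lt, h, fun y' _ => h' y'⟩
  · rintro ⟨y, -, h, h'⟩
    exact ⟨y, h, fun y' hy' => h' y' ((snd_le_pr _ _).trans_lt hy'.lt) hy'⟩

instance {P : α → 𝔐.M → Prop} {l s : α → 𝔐.M} [hP : Sig0 𝔐 fun p : α × 𝔐.M => P p.1 p.2]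
    [hl : IsTerm l] [hs : IsTerm s] : Sig0 𝔐 fun a => IsSeq (P a) (l a) (s a) := by
  simp only [isSeq_iff]
  have hl := @hl.weaken
  have hs' := @hs.weaken
  have hP := @hP.weaken
  infer_instance

instance {P : α → 𝔐.M → Prop} {l s : α → 𝔐.M} [hP : Sig0 𝔐 fun p : α × 𝔐.M => P p.1 p.2]
    [hl : IsTerm l] [hs : IsTerm s] : Sig0 𝔐 fun a => Tuples (P a) (l a) (s a) := by
  refine Sig0.congr (P := fun a => IsSeq (P a) (l a) (s a) ∧ ∀ i, i < s a → ∀ i', i' < s a →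
    ∀ x, x < s a → ∀ x', x' < s a → Elts (s a) (pr i x) ∧ Elts (s a) (pr i' x') ∧ i < i' → x < x')
    ?_ fun a => and_congr_right fun _ => ⟨fun h i _ i' _ x _ x' _ => h i i' x x', ?_⟩
  · have hs' := @hs.weaken
    infer_instance
  · rintro h i i' x x' ⟨h₁, h₂, h₃⟩
    exact h i ((fst_le_pr _ _).trans_lt h₁.lt) i' ((fst_le_pr _ _).trans_lt h₂.lt) x
      ((snd_le_pr _ _).trans_lt h₁.lt) x' ((snd_le_pr _ _).trans_lt h₂.lt) ⟨h₁, h₂, h₃⟩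

section
variable {P Q : 𝔐.M → Prop} {l d s : 𝔐.M}

theorem Elts.fst_lt {i x : 𝔐.M} (h : Elts s (pr i x)) : i < s := (fst_le_pr _ _).trans_lt h.lt

theorem Elts.snd_lt {i x : 𝔐.M} (h : Elts s (pr i x)) : x < s := (snd_le_pr _ _).trans_lt h.lt

theorem IsSeq.lt (h : IsSeq P l s) {i x : 𝔐.M} (hi : Elts s (pr i x)) : i < l := by
  obtain ⟨_, _, h₁, h₂, -⟩ := h.2.1 _ hi
  obtain ⟨rfl, -⟩ := pr_inj.mp h₁
  exact h₂

theorem IsSeq.val (h : IsSeq P l s) {i x : 𝔐.M} (hi : Elts s (pr i x)) : P x := by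
  obtain ⟨_, _, h₁, -, h₂⟩ := h.2.1 _ hi
  obtain ⟨-, rfl⟩ := pr_inj.mp h₁
  exact h₂

theorem IsFun.unique {f : 𝔐.M → Prop} (h : IsFun f P Q) {x y y' : 𝔐.M}
    (hy : f (pr x y)) (hy' : f (pr x y')) : y = y' := by
  obtain ⟨x', z, hz, hx, -⟩ := h.1 _ hy
  obtain ⟨rfl, rfl⟩ := pr_inj.mp hz
  obtain ⟨w, -, hw⟩ := h.2 _ hx
  rw [hw _ hy, hw _ hy']

theorem IsSeq.congr (h : IsSeq P l s) (h' : ∀ i x, Elts s (pr i x) → Q x) : IsSeq Q l s := by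
  refine ⟨h.1, fun z hz => ?_, h.2.2⟩
  obtain ⟨x, y, rfl, hx, -⟩ := h.2.1 _ hz
  exact ⟨x, y, rfl, hx, h' x y hz⟩

theorem Tuples.congr (h : Tuples P d s) (h' : ∀ i x, Elts s (pr i x) → Q x) : Tuples Q d s :=
  ⟨h.1.congr h', h.2⟩

theorem Tuples.mono (h : Tuples P d s) (h' : ∀ x, P x → Q x) : Tuples Q d s :=
  h.congr fun _ _ hx => h' _ (h.1.val hx)

theorem Tuples.le_val (h : Tuples P d s) (i : 𝔐.M) : ∀ x, x < s → Elts s (pr i x) → i ≤ x := by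
  refine sig1_induction (fun i => ∀ x, x < s → Elts s (pr i x) → i ≤ x) (fun _ _ _ => zero_le) ?_ i
  intro i ih x _ hx
  obtain ⟨y, hy, -⟩ := h.1.2.2 i ((RCAModel.lt_add_one_iff.mpr le_rfl).trans (h.1.lt hx))
  have := ih y hy.snd_lt hy
  exact RCAModel.add_one_le_iff.mpr
    (this.trans_lt (h.2 _ _ _ _ ⟨hy, hx, RCAModel.lt_add_one_iff.mpr le_rfl⟩))

/-- The last entry of an increasing sequence is at least its index, so no pigeonhole principle is
needed to bound the length. -/
theorem Tuples.le {b : 𝔐.M} (h : Tuples P d s) (hb : ∀ x, P x → x < b) : d ≤ b := by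
  rcases eq_zero_or_succ d with rfl | ⟨i, rfl⟩
  · exact zero_le
  · obtain ⟨x, hx, -⟩ := h.1.2.2 i (RCAModel.lt_add_one_iff.mpr le_rfl)
    exact RCAModel.add_one_le_iff.mpr ((h.le_val i x hx.snd_lt hx).trans_lt (hb x (h.1.val hx)))

end

end SOA

/-! ### Truth values of the sentences in a model. -/

namespace SOA

/-! ### Denotations of formulas written with Lean-level binders -/

variable {𝔐 : Str}

/-- The numbers of enclosing quantifiers, with a valuation. -/
structure World (𝔐 : Str) where
  n : ℕ
  m : ℕ
  v : ℕ → 𝔐.M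
  e : ℕ → 𝔐.S

instance : Preorder (World 𝔐) where
  le W W' := ∃ j k, W'.n = W.n + j ∧ W'.m = W.m + k ∧ (∀ i, W'.v (i + j) = W.v i) ∧
    ∀ i, W'.e (i + k) = W.e i
  le_refl W := ⟨0, 0, rfl, rfl, fun _ => rfl, fun _ => rfl⟩
  le_trans W₁ W₂ W₃ := by
    rintro ⟨j, k, hn, hm, hv, he⟩ ⟨j', k', hn', hm', hv', he'⟩
    refine ⟨j + j', k + k', by omega, by omega, fun i => ?_, fun i => ?_⟩
    · rw [← hv, ← hv', add_assoc]
    · rw [← he, ← he', add_assoc]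

/-- `t` denotes `x` in `W` and its extensions. -/
def Den (t : Ter) (W : World 𝔐) (x : 𝔐.M) : Prop := ∀ W', W ≤ W' → (t W'.n).val 𝔐 W'.v = x

def SDen (X : SVar) (W : World 𝔐) (A : 𝔐.S) : Prop := ∀ W', W ≤ W' → W'.e (X W'.m) = A

def FDen (φ : Form) (W : World 𝔐) (p : Prop) : Prop :=
  ∀ W', W ≤ W' → ((φ W'.n W'.m).Holds 𝔐 W'.v W'.e ↔ p)

def CDen (P : Cls) (W : World 𝔐) (A : 𝔐.M → Prop) : Prop :=
  ∀ W', W ≤ W' → ∀ t x, Den t W' x → FDen (P t) W' (A x)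

section
variable {W W' : World 𝔐} {s t : Ter} {x y : 𝔐.M} {φ ψ : Form} {p q : Prop} {X : SVar} {A : 𝔐.S}
  {P : Cls} {B : 𝔐.M → Prop}

theorem Den.mono (h : Den t W x) (hW : W ≤ W' := by order) : Den t W' x :=
  fun _ h' => h _ (hW.trans h')

theorem SDen.mono (h : SDen X W A) (hW : W ≤ W' := by order) : SDen X W' A :=
  fun _ h' => h _ (hW.trans h')

theorem CDen.mono (h : CDen P W B) (hW : W ≤ W' := by order) : CDen P W' B :=
  fun _ h' => h _ (hW.trans h')

theorem CDen.app (h : CDen P W B) (ht : Den t W' x) (hW : W ≤ W' := by order) :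
    FDen (P t) W' (B x) := h _ hW _ _ ht

theorem Den.one : Den one W (1 : 𝔐.M) := fun _ _ => rfl

theorem Den.add (hs : Den s W x) (ht : Den t W y) : Den (s ⊹ t) W (x + y) := fun W' h =>
  congrArg₂ 𝔐.add (hs W' h) (ht W' h)

theorem Den.mul (hs : Den s W x) (ht : Den t W y) : Den (s ⊛ t) W (x * y) := fun W' h =>
  congrArg₂ 𝔐.mul (hs W' h) (ht W' h)

theorem Den.pair (hs : Den s W x) (ht : Den t W y) : Den (pair s t) W (pr x y) :=
  .add (.mul (.add hs ht) (.add hs ht)) hs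

namespace FDen

theorem congr (h : FDen φ W p) (hpq : p ↔ q) : FDen φ W q := propext hpq ▸ h

theorem eq (hs : Den s W x) (ht : Den t W y) : FDen (s ≐ t) W (x = y) := fun W' h =>
  iff_of_eq (congrArg₂ Eq (hs W' h) (ht W' h))

theorem lt (hs : Den s W x) (ht : Den t W y) : FDen (s ≺ t) W (x < y) := fun W' h =>
  iff_of_eq (congrArg₂ 𝔐.lt (hs W' h) (ht W' h))

theorem mem (hs : Den s W x) (hX : SDen X W A) : FDen (mem s X) W (x ∈ A) := fun W' h =>
  iff_of_eq (congrArg₂ 𝔐.mem (hs W' h) (hX W' h))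

theorem neg (h : FDen φ W p) : FDen (neg φ) W (¬ p) := fun W' hW => not_congr (h W' hW)

theorem imp (h : FDen φ W p) (h' : FDen ψ W q) : FDen (φ ⇒ ψ) W (p → q) :=
  fun W' hW => imp_congr (h W' hW) (h' W' hW)

theorem and (h : FDen φ W p) (h' : FDen ψ W q) : FDen (φ ⋏ ψ) W (p ∧ q) :=
  fun W' hW => Fm.holds_and.trans (and_congr (h W' hW) (h' W' hW))

theorem or (h : FDen φ W p) (h' : FDen ψ W q) : FDen (φ ⋎ ψ) W (p ∨ q) :=
  fun W' hW => Fm.holds_or.trans (or_congr (h W' hW) (h' W' hW))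

theorem le (hs : Den s W x) (ht : Den t W y) : FDen (le s t) W (x ≤ y) :=
  .or (.lt hs ht) (.eq hs ht)

/-- At depth n + 1 + j the variable has index j, which is where an extension by j further variables
puts the old variable 0. Hence the denotation persists under all later binders, as `Den` demands. -/
theorem bound_var (W : World 𝔐) (x : 𝔐.M) :
    W ≤ ⟨W.n + 1, W.m, scons x W.v, W.e⟩ ∧
      Den (fun n' => .var (n' - (W.n + 1))) ⟨W.n + 1, W.m, scons x W.v, W.e⟩ x := by
  refine ⟨⟨1, 0, rfl, rfl, fun _ => rfl, fun _ => rfl⟩, ?_⟩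
  rintro W' ⟨j, k, hn, -, hv, -⟩
  have := hv 0
  simp only [zero_add] at this
  simp only [Tm.val, hn, Nat.add_sub_cancel_left, this, scons_zero]

theorem bound_varS (W : World 𝔐) (A : 𝔐.S) :
    W ≤ ⟨W.n, W.m + 1, W.v, scons A W.e⟩ ∧
      SDen (fun m' => m' - (W.m + 1)) ⟨W.n, W.m + 1, W.v, scons A W.e⟩ A := by
  refine ⟨⟨0, 1, rfl, rfl, fun _ => rfl, fun _ => rfl⟩, ?_⟩
  rintro W' ⟨j, k, -, hm, -, he⟩
  have := he 0
  simp only [zero_add] at this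
  simp only [hm, Nat.add_sub_cancel_left, this, scons_zero]

theorem all {φ : Ter → Form} {p : 𝔐.M → Prop}
    (h : ∀ W', W ≤ W' → ∀ t x, Den t W' x → FDen (φ t) W' (p x)) :
    FDen (all φ) W (∀ x, p x) := fun W' hW => forall_congr' fun x =>
  let ⟨h₁, h₂⟩ := bound_var W' x
  h _ (hW.trans h₁) _ x h₂ _ le_rfl

theorem ex {φ : Ter → Form} {p : 𝔐.M → Prop}
    (h : ∀ W', W ≤ W' → ∀ t x, Den t W' x → FDen (φ t) W' (p x)) :
    FDen (ex φ) W (∃ x, p x) := fun W' hW => Fm.holds_ex.trans <| exists_congr fun x =>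
  let ⟨h₁, h₂⟩ := bound_var W' x
  h _ (hW.trans h₁) _ x h₂ _ le_rfl

theorem allS {φ : SVar → Form} {p : 𝔐.S → Prop}
    (h : ∀ W', W ≤ W' → ∀ X A, SDen X W' A → FDen (φ X) W' (p A)) :
    FDen (allS φ) W (∀ A, p A) := fun W' hW => forall_congr' fun A =>
  let ⟨h₁, h₂⟩ := bound_varS W' A
  h _ (hW.trans h₁) _ A h₂ _ le_rfl

theorem exS {φ : SVar → Form} {p : 𝔐.S → Prop}
    (h : ∀ W', W ≤ W' → ∀ X A, SDen X W' A → FDen (φ X) W' (p A)) :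
    FDen (exS φ) W (∃ A, p A) := fun W' hW => Fm.holds_exS.trans <| exists_congr fun A =>
  let ⟨h₁, h₂⟩ := bound_varS W' A
  h _ (hW.trans h₁) _ A h₂ _ le_rfl

end FDen

theorem CDen.univ : CDen univ W fun x : 𝔐.M => x = x := fun _ _ _ _ h => .eq h h

theorem CDen.ofSet (hX : SDen X W A) : CDen (ofSet X) W fun x => x ∈ A :=
  fun _ _ _ _ h => .mem h hX.mono

theorem CDen.below (ht : Den t W y) : CDen (below t) W fun x => x < y :=
  fun _ _ _ _ h => .lt h ht.mono

theorem CDen.le (ht : Den t W y) : CDen (fun i => le i t) W fun x => x ≤ y :=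
  fun _ _ _ _ h => .le h ht.mono

end

section
variable [RCAModel 𝔐] {W : World 𝔐} {s t : Ter} {x y : 𝔐.M} {X Y : SVar} {A B : 𝔐.S}
  {f P Q : Cls} {f' P' Q' : 𝔐.M → Prop}

namespace FDen

theorem dvd (hs : Den s W x) (ht : Den t W y) : FDen (dvd s t) W (x ∣ y) :=
  FDen.congr (.ex fun _ _ _ _ hq => .eq (.mul hs.mono hq) ht.mono)
    (exists_congr fun _ => eq_comm)

omit [RCAModel 𝔐] in
theorem isTriple (hs : Den s W x) : FDen (isTriple s) W (IsTriple x) :=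
  .ex fun _ _ _ _ hk => .ex fun _ _ _ _ hm => .ex fun _ _ _ _ hn =>
    .eq hs.mono (.pair hk.mono (.pair hm.mono hn))

omit [RCAModel 𝔐] in
theorem sub (hP : CDen P W P') (hQ : CDen Q W Q') : FDen (sub P Q) W (∀ x, P' x → Q' x) :=
  .all fun _ _ _ _ hx => .imp (hP.app hx) (hQ.app hx)

theorem elts (hs : Den s W x) : CDen (elts s) W (Elts x) :=
  fun _ _ _ _ hi => .ex fun _ _ _ _ hk => .ex fun _ _ _ _ hm => .ex fun _ _ _ _ hn =>
    .and (.eq hs.mono (.pair hk.mono (.pair hm.mono hn))) (.and (.lt hi.mono hk.mono)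
      (.dvd (.add (.mul hm.mono (.add hi.mono .one)) .one) hn))

theorem isFin (hs : Den s W x) : FDen (isFin s) W (IsFin x) :=
  .and (.isTriple hs) (.all fun _ _ _ _ hy => .imp (.lt hy hs.mono) (.imp (.isTriple hy)
    (.neg (.and (.sub (elts hy) (elts hs.mono)) (.sub (elts hs.mono) (elts hy))))))

theorem isFinC : CDen (𝔐 := 𝔐) SOA.isFin W IsFin := fun _ _ _ _ h => .isFin h

omit [RCAModel 𝔐] in
theorem isFun (hf : CDen f W f') (hP : CDen P W P') (hQ : CDen Q W Q') :
    FDen (isFun f P Q) W (IsFun f' P' Q') :=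
  .and
    (.all fun _ _ _ _ hz => .imp (hf.app hz) (.ex fun _ _ _ _ hx => .ex fun _ _ _ _ hy =>
      .and (.eq hz.mono (.pair hx.mono hy)) (.and (hP.app hx.mono) (hQ.app hy))))
    (.all fun _ _ _ _ hx => .imp (hP.app hx) (.ex fun _ _ _ _ hy =>
      .and (hf.app (.pair hx.mono hy)) (.all fun _ _ _ _ hy' =>
        .imp (hf.app (.pair hx.mono hy')) (.eq hy' hy.mono))))

theorem isSeq (hP : CDen P W P') (hs : Den s W x) (ht : Den t W y) :
    FDen (isSeq P s t) W (IsSeq P' x y) :=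
  .and (.isFin ht) (.isFun (elts ht) (.below hs) hP)

theorem tuples (hP : CDen P W P') (hs : Den s W x) : CDen (tuples P s) W (Tuples P' x) :=
  fun _ _ _ _ ht => .and (.isSeq hP.mono hs.mono ht)
    (.all fun _ _ _ _ hi => .all fun _ _ _ _ hi' => .all fun _ _ _ _ hx => .all fun _ _ _ _ hx' =>
      .imp (.and ((elts ht).app (.pair hi.mono hx.mono))
        (.and ((elts ht).app (.pair hi'.mono hx')) (.lt hi.mono hi'.mono))) (.lt hx.mono hx'))

theorem hasSize (hP : CDen P W P') (hs : Den s W x) : FDen (hasSize P s) W (HasSize P' x) :=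
  .ex fun _ _ _ _ ht => .and ((tuples hP hs).app ht) (.all fun _ _ _ _ hx =>
    .imp (hP.app hx) (.ex fun _ _ _ _ hi => (elts ht).app (.pair hi hx.mono)))

omit [RCAModel 𝔐] in
theorem isInfinite (hP : CDen P W P') : FDen (isInfinite P) W (IsInf P') :=
  .all fun _ _ _ _ hm => .ex fun _ _ _ _ hn => .and (.lt hm.mono hn) (hP.app hn)

theorem isHomog (hs : Den s W x) (hP : CDen P W P') (hQ : CDen Q W Q') :
    FDen (isHomog s P Q) W (IsHomog x P' Q') :=
  .all fun _ _ _ _ hs' => .all fun _ _ _ _ ht => .all fun _ _ _ _ hc =>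
    .imp (.and ((tuples hQ hs).app hs'.mono) (.and ((tuples hQ hs).app ht.mono)
      (hP.app (.pair hs'.mono hc)))) (hP.app (.pair ht.mono hc))

theorem rt (hs : Den s W x) (ht : Den t W y) : FDen (RT s t) W (RTIn x y) :=
  .allS fun _ _ _ _ hC => .imp (.isFun (.ofSet hC) (tuples .univ ht.mono) (.below hs.mono))
    (.exS fun _ _ _ _ hH => .and (.isInfinite (.ofSet hH))
      (.isHomog ht.mono (.ofSet hC.mono) (.ofSet hH)))

theorem isAS (hX : SDen X W A) : FDen (isAS X) W (ASIn A) :=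
  .and (.isFun (.ofSet hX) isFinC .univ) (.allS fun _ _ _ _ hY => .imp
    (.and (.isFun (.ofSet hY) .univ isFinC) (.all fun _ _ _ _ hi => .all fun _ _ _ _ hx =>
      .all fun _ _ _ _ hy => .imp (.and (.mem (.pair hi.mono hx.mono) hY.mono)
        (.mem (.pair (.add hi.mono .one) hy) hY.mono)) (.sub (elts hx.mono) (elts hy))))
    (.ex fun _ _ _ _ hi => .all fun _ _ _ _ hj => .imp (.le hi.mono hj)
      (.all fun _ _ _ _ hx => .all fun _ _ _ _ hy => .all fun _ _ _ _ hu =>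
        .imp (.and (.mem (.pair hi.mono hx.mono) hY.mono)
          (.and (.mem (.pair hj.mono hy.mono) hY.mono) (.mem (.pair hx.mono hu) hX.mono)))
          (.mem (.pair hy.mono hu) hX.mono))))

theorem frt (hs : Den s W x) (ht : Den t W y) : FDen (FRT s t) W (FRTIn x y) :=
  .allS fun _ _ _ _ hF => .imp (.isAS hF) (.ex fun _ _ _ _ hR => .all fun _ _ _ _ hC =>
    .imp (.and (.isFin hC) (.isFun (elts hC) (tuples (.le hR.mono) ht.mono) (.below hs.mono)))
      (.ex fun _ _ _ _ hH => .and (.isFin hH) (.and (.sub (elts hH) (.le hR.mono))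
        (.and (.isHomog ht.mono (elts hC.mono) (elts hH))
          (.ex fun _ _ _ _ hn => .ex fun _ _ _ _ hy => .and (.hasSize (elts hH.mono) hn.mono)
            (.and (.mem (.pair hH.mono hy) hF.mono) (.lt hy hn.mono)))))))

theorem isBinTree (hX : SDen X W A) : FDen (isBinTree X) W (BinTreeIn A) :=
  .and (.all fun _ _ _ _ hs => .imp (.mem hs hX.mono) (.ex fun _ _ _ _ hl =>
      .isSeq (.below (.add .one .one)) hl hs.mono))
    (.all fun _ _ _ _ hs => .all fun _ _ _ _ ht => .all fun _ _ _ _ hl =>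
      .imp (.and (.mem hs.mono hX.mono) (.and (.isSeq .univ hl ht.mono)
        (.sub (elts ht.mono) (elts hs.mono)))) (.mem ht.mono hX.mono))

theorem isPath (hX : SDen X W A) (hY : SDen Y W B) : FDen (isPath X Y) W (PathIn A B) :=
  .and (.isFun (.ofSet hX) .univ (.below (.add .one .one)))
    (.all fun _ _ _ _ hn => .ex fun _ _ _ _ hs => .and (.mem hs hY.mono)
      (.and (.isSeq .univ hn.mono hs) (.sub (elts hs) (.ofSet hX.mono))))

theorem wkl : FDen WKL W (WKLIn 𝔐) :=
  .allS fun _ _ _ _ hT => .imp (.and (.isBinTree hT) (.isInfinite (.ofSet hT)))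
    (.exS fun _ _ _ _ hg => .isPath hg hT.mono)

end FDen

end

theorem provable_close {A : Set Fm} (hA : RCA0 ⊆ A) {φ : Form} {p : ∀ 𝔐 : Str, [RCAModel 𝔐] → Prop}
    (hφ : ∀ (𝔐 : Str) [RCAModel 𝔐] (W : World 𝔐), FDen φ W (p 𝔐))
    (h : ∀ (𝔐 : Str) [RCAModel 𝔐], 𝔐.Models A → p 𝔐) : Provable A φ.close := by
  refine provable_of_holds fun 𝔐 h𝔐 v e => ?_
  have : RCAModel 𝔐 := ⟨fun ψ hψ => h𝔐 ψ (hA hψ), ⟨e 0⟩⟩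
  exact (hφ 𝔐 ⟨0, 0, v, e⟩ _ le_rfl).mpr (h 𝔐 h𝔐)

end SOA

/-! ### From the finitary to the infinite Ramsey theorem in RCA₀. -/

namespace SOA

set_option synthInstance.maxSize 100000
set_option synthInstance.maxHeartbeats 400000

variable {𝔐 : Str} {α : Type} [Ctx 𝔐 α] [RCAModel 𝔐]

open RCAModel

/-! ### Increasing sequences of finite sets -/

theorem lt_add_one_self (x : 𝔐.M) : x < x + 1 := RCAModel.lt_add_one_iff.mpr le_rfl

/-- A set coding a sequence of finite sets that is increasing under inclusion. -/
structure IsChain (X : 𝔐.S) : Prop where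
  isFun : IsFun (· ∈ X) (fun x => x = x) IsFin
  step : ∀ i x y, pr i x ∈ X ∧ pr (i + 1) y ∈ X → ∀ z, Elts x z → Elts y z

namespace IsChain

variable {X : 𝔐.S}

theorem exists_mem (hX : IsChain X) (i : 𝔐.M) : ∃ x, pr i x ∈ X :=
  (hX.isFun.2 i rfl).imp fun _ h => h.1

theorem isFin (hX : IsChain X) {i x : 𝔐.M} (h : pr i x ∈ X) : IsFin x := by
  obtain ⟨_, _, h₁, -, h₂⟩ := hX.isFun.1 _ h
  obtain ⟨-, rfl⟩ := pr_inj.mp h₁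
  exact h₂

theorem mono (hX : IsChain X) {i j x y : 𝔐.M} (hij : i ≤ j) (hx : pr i x ∈ X) (hy : pr j y ∈ X)
    {z : 𝔐.M} (hz : Elts x z) : Elts y z := by
  obtain ⟨l, rfl⟩ := RCAModel.le_iff_exists.mp hij
  have key := sig1_induction (fun l => ∃ y, pr (i + l) y ∈ X ∧ Elts y z)
    ⟨x, by rwa [add_zero], hz⟩ (fun l ⟨y, hy, hz⟩ => by
      obtain ⟨y', hy'⟩ := hX.exists_mem (i + l + 1)
      exact ⟨y', by rwa [← add_assoc], hX.step _ _ _ ⟨hy, hy'⟩ z hz⟩) l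
  obtain ⟨y', hy', hz'⟩ := key
  rwa [hX.isFun.unique hy hy']

/-- A chain with bounded union is eventually constant. -/
theorem eventually_const (hX : IsChain X) {m : 𝔐.M}
    (hm : ∀ i x z, pr i x ∈ X → Elts x z → z < m) :
    ∃ i, ∀ j x y, i ≤ j → pr i x ∈ X → pr j y ∈ X → x = y := by
  -- The union of the chain is a bounded Σ⁰₁ set and so has a code u. Collection yields a stage by
  -- which all its elements have appeared.
  obtain ⟨u, -, hu⟩ := exists_code m fun z => ∃ i, ∃ x, pr i x ∈ X ∧ Elts x z
  -- The first disjunct covers the z outside u, since collection needs a witness for every z < u.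
  have hcol : ∀ z, z < u → ∃ i, ¬ Elts u z ∨ ∃ x, pr i x ∈ X ∧ Elts x z := by
    intro z _
    by_cases hz : Elts u z
    · obtain ⟨-, i, h⟩ := (hu z).mp hz
      exact ⟨i, .inr h⟩
    · exact ⟨0, .inl hz⟩
  obtain ⟨b, hb⟩ := Sig1.collection (P := fun z i => ¬ Elts u z ∨ ∃ x, pr i x ∈ X ∧ Elts x z)
    (by infer_instance) hcol
  refine ⟨b, fun j x y hj hx hy => (hX.isFin hx).ext (hX.isFin hy) fun z =>
    ⟨hX.mono hj hx hy, fun hz => ?_⟩⟩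
  have hzu : Elts u z := (hu z).mpr ⟨hm _ _ _ hy hz, j, y, hy, hz⟩
  obtain ⟨i, hi, h⟩ := hb z hzu.lt
  obtain ⟨x', hx', hz'⟩ := h.resolve_left (not_not.mpr hzu)
  exact hX.mono hi.le hx' hx hz'

end IsChain

/-- `x` is the largest element of `u`. -/
def IsMax (u x : 𝔐.M) : Prop := Elts u x ∧ ∀ y, y < u → Elts u y → y ≤ x

instance {u x : α → 𝔐.M} [hu : IsTerm u] [hx : IsTerm x] : Sig0 𝔐 fun a => IsMax (u a) (x a) := by
  have hu' := @hu.weaken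
  have hx' := @hx.weaken
  unfold IsMax
  infer_instance

theorem exists_isMax {u z : 𝔐.M} (hz : Elts u z) : ∃ x, z ≤ x ∧ IsMax u x := by
  obtain ⟨b, hb, hmin⟩ := sig0_exists_least (fun b => ∀ y, y < u → Elts u y → y ≤ b)
    ⟨u, fun y hy _ => hy.le⟩
  refine ⟨b, hb z hz.lt hz, Classical.byContradiction fun hbu => ?_, hb⟩
  have hne : ∀ y, Elts u y → y < b := fun y hy =>
    lt_of_le_of_ne (hb y hy.lt hy) fun h => hbu (h ▸ hy)
  rcases eq_zero_or_succ b with rfl | ⟨b', rfl⟩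
  · exact RCAModel.not_lt_zero _ (hne z hz)
  · exact hmin b' (lt_add_one_self _) fun y _ hy => RCAModel.lt_add_one_iff.mp (hne y hy)

/-- The largest elements of the members of an unbounded chain form a set. -/
theorem IsChain.exists_maxima {X : 𝔐.S} (hX : IsChain X)
    (hunb : ∀ m, ∃ i x z, pr i x ∈ X ∧ Elts x z ∧ m < z) :
    ∃ H : 𝔐.S, ∀ z, z ∈ H ↔ ∃ i, ∃ x, pr i x ∈ X ∧ IsMax x z := by
  -- The complement is Σ⁰₁ as well: once a member contains an element above z, no later member has
  -- maximum z, so only the finitely many earlier ones need checking.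
  refine sig1_comprehension (fun z => ∃ i, ∃ x, pr i x ∈ X ∧ IsMax x z)
    (fun z => ∃ i, ∃ x, (pr i x ∈ X ∧ ∃ y, y < x ∧ Elts x y ∧ z < y) ∧
      ∀ i', i' < i → ∃ u, pr i' u ∈ X ∧ ¬ IsMax u z) fun z => ⟨fun h => ?_, ?_⟩
  · obtain ⟨i, x, y, hx, hy, hlt⟩ := hunb z
    refine ⟨i, x, ⟨hx, y, hy.lt, hy, hlt⟩, fun i' _ => ?_⟩
    obtain ⟨u, hu⟩ := hX.exists_mem i'
    exact ⟨u, hu, fun hmax => h ⟨i', u, hu, hmax⟩⟩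
  · rintro ⟨i, x, ⟨hx, y, -, hy, hlt⟩, h⟩ ⟨j, u, hu, hmax⟩
    rcases lt_or_ge j i with hji | hij
    · obtain ⟨u', hu', hmax'⟩ := h j hji
      exact hmax' (hX.isFun.unique hu hu' ▸ hmax)
    · have hyu := hX.mono hij hx hu hy
      exact (hmax.2 y hyu.lt hyu).not_gt hlt

/-! ### The infinite version from the finite one -/

/-- There are two `d`-subsets of `H`, with codes below some element of `H`, which `C`
distinguishes. -/
def Distinguished (d : 𝔐.M) (C : 𝔐.S) (H : 𝔐.M) : Prop :=
  ∃ x, x < H ∧ Elts H x ∧ ∃ s, s < x ∧ ∃ t, t < x ∧ ∃ c, c < x ∧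
    Tuples (Elts H) d s ∧ Tuples (Elts H) d t ∧ pr s c ∈ C ∧ ¬ pr t c ∈ C

instance {d : 𝔐.M} {C : 𝔐.S} {H : α → 𝔐.M} [hH : IsTerm H] :
    Sig0 𝔐 fun a => Distinguished d C (H a) := by
  have hH' := @hH.weaken
  unfold Distinguished
  infer_instance

/-- The codes are bounded by an element of H and not by the code of H, because a superset keeps its
elements but may have a smaller code. -/
theorem Distinguished.mono {d H H' : 𝔐.M} {C : 𝔐.S} (h : Distinguished d C H)
    (hH : ∀ z, Elts H z → Elts H' z) : Distinguished d C H' := by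
  obtain ⟨x, -, hx, s, hs, t, ht, c, hc, hs', ht', h⟩ := h
  exact ⟨x, (hH x hx).lt, hH x hx, s, hs, t, ht, c, hc, hs'.mono hH, ht'.mono hH, h⟩

/-- All pairs of an index below d and an entry at most r are at most `pr d r`. -/
theorem Tuples.code_le {P : 𝔐.M → Prop} {d s r b : 𝔐.M} (h : Tuples P d s) (hP : ∀ x, P x → x ≤ r)
    (hb : CodeBound (pr d r + 1) b) : s ≤ b := by
  refine hb.le h.1.1 fun z hz => ?_
  obtain ⟨i, x, rfl, hi, hx⟩ := h.1.2.1 z hz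
  exact RCAModel.lt_add_one_iff.mpr (pr_mono hi.le (hP x hx))

/-- The restriction of a colouring to the tuples from `{0, …, r}` has a code. -/
theorem exists_restriction {C : 𝔐.S} {k d : 𝔐.M}
    (hC : IsFun (· ∈ C) (Tuples (fun x => x = x) d) (· < k)) (r : 𝔐.M) :
    ∃ C', IsFin C' ∧ IsFun (Elts C') (Tuples (· ≤ r) d) (· < k) ∧
      ∀ s c, Tuples (· ≤ r) d s → (Elts C' (pr s c) ↔ pr s c ∈ C) := by
  obtain ⟨b, hb⟩ := exists_codeBound (pr d r + 1)
  -- As b bounds the codes of the tuples, `pr b k` bounds every pair of such a tuple and its colour.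
  obtain ⟨C', hC', h⟩ := exists_code (pr b k + 1) fun z =>
    z ∈ C ∧ ∃ s, s ≤ z ∧ ∃ c, c ≤ z ∧ z = pr s c ∧ Tuples (· ≤ r) d s
  have key : ∀ s c, Tuples (· ≤ r) d s → (Elts C' (pr s c) ↔ pr s c ∈ C) := by
    intro s c hs
    rw [h]
    refine ⟨fun h => h.2.1, fun hsc =>
      ⟨?_, hsc, s, fst_le_pr _ _, c, snd_le_pr _ _, rfl, hs⟩⟩
    obtain ⟨s', c', hsc', -, hc⟩ := hC.1 _ hsc
    obtain ⟨rfl, rfl⟩ := pr_inj.mp hsc'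
    exact RCAModel.lt_add_one_iff.mpr (pr_mono (hs.code_le (fun _ h => h) hb) hc.le)
  refine ⟨C', hC', ⟨fun z hz => ?_, fun s hs => ?_⟩, key⟩
  · obtain ⟨-, hzC, s, -, c, -, rfl, hs⟩ := (h z).mp hz
    obtain ⟨s', c', hsc', -, hc⟩ := hC.1 _ hzC
    obtain ⟨rfl, rfl⟩ := pr_inj.mp hsc'
    exact ⟨s, c, rfl, hs, hc⟩
  · obtain ⟨c, hc, huniq⟩ := hC.2 s (hs.mono fun _ _ => rfl)
    exact ⟨c, (key s c hs).mpr hc, fun c' hc' => huniq c' ((key s c' hs).mp hc')⟩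

theorem RTIn.of_frtIn {k d : 𝔐.M} (h : FRTIn k d) : RTIn k d := by
  intro C hC
  refine Classical.byContradiction fun hno => ?_
  -- The value is 0 on distinguished sets. On all others it is the code of H, which no size of H can
  -- exceed.
  obtain ⟨F, hF⟩ := sig0_comprehension (𝔐 := 𝔐) fun z => ∃ H, H ≤ z ∧ ∃ y, y ≤ z ∧ z = pr H y ∧
    IsFin H ∧ ((Distinguished d C H ∧ y = 0) ∨ (¬ Distinguished d C H ∧ y = H))
  have hF' : ∀ H y, pr H y ∈ F ↔
      IsFin H ∧ ((Distinguished d C H ∧ y = 0) ∨ (¬ Distinguished d C H ∧ y = H)) := by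
    intro H y
    rw [hF]
    constructor
    · rintro ⟨_, -, _, -, h₁, h₂⟩
      obtain ⟨rfl, rfl⟩ := pr_inj.mp h₁
      exact h₂
    · exact fun h => ⟨H, fst_le_pr _ _, y, snd_le_pr _ _, rfl, h⟩
  have hAS : ASIn F := by
    refine ⟨⟨fun z hz => ?_, fun H hH => ?_⟩, fun X ⟨hX₁, hX₂⟩ => ?_⟩
    · obtain ⟨H, -, y, -, rfl, hH, -⟩ := (hF z).mp hz
      exact ⟨H, y, rfl, hH, rfl⟩
    · by_cases hd : Distinguished d C H
      · exact ⟨0, (hF' _ _).mpr ⟨hH, .inl ⟨hd, rfl⟩⟩, fun y' hy' =>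
          (((hF' _ _).mp hy').2.resolve_right fun h => h.1 hd).2⟩
      · exact ⟨H, (hF' _ _).mpr ⟨hH, .inr ⟨hd, rfl⟩⟩, fun y' hy' =>
          (((hF' _ _).mp hy').2.resolve_left fun h => hd h.1).2⟩
    · have hX : IsChain X := ⟨hX₁, hX₂⟩
      by_cases hd : ∃ i x, pr i x ∈ X ∧ Distinguished d C x
      · obtain ⟨i, x, hx, hd⟩ := hd
        refine ⟨i, fun j hij x' y u ⟨hx', hy, hu⟩ => ?_⟩
        obtain rfl := hX.isFun.unique hx hx'
        have hu0 := (((hF' _ _).mp hu).2.resolve_right fun h => h.1 hd).2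
        exact (hF' _ _).mpr
          ⟨hX.isFin hy, .inl ⟨hd.mono fun z hz => hX.mono hij hx hy hz, hu0⟩⟩
      · by_cases hb : ∃ m, ∀ i x z, pr i x ∈ X → Elts x z → z < m
        · obtain ⟨m, hm⟩ := hb
          obtain ⟨i, hi⟩ := hX.eventually_const hm
          exact ⟨i, fun j hij x y u ⟨hx, hy, hu⟩ => hi j x y hij hx hy ▸ hu⟩
        · have hunb : ∀ m, ∃ i x z, pr i x ∈ X ∧ Elts x z ∧ m < z := by
            intro m
            refine Classical.byContradiction fun hn => hb ⟨m + 1, fun i x z hx hz => ?_⟩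
            exact RCAModel.lt_add_one_iff.mpr (not_lt.mp fun hmz => hn ⟨i, x, z, hx, hz, hmz⟩)
          obtain ⟨H, hH⟩ := hX.exists_maxima hunb
          have hinf : IsInf (· ∈ H) := by
            intro m
            obtain ⟨i, x, z, hx, hz, hmz⟩ := hunb m
            obtain ⟨n, hzn, hn⟩ := exists_isMax hz
            exact ⟨n, hmz.trans_le hzn, (hH n).mpr ⟨i, x, hx, hn⟩⟩
          refine (hno ⟨H, hinf, fun s t c ⟨hs, ht, hsc⟩ => ?_⟩).elim
          refine Classical.byContradiction fun htc => hd ?_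
          -- A maximum n beyond both tuples and the colour serves as the element required by
          -- `Distinguished`.
          obtain ⟨n, hn, hnH⟩ := hinf (max s (max t c))
          obtain ⟨hsn, hn⟩ := max_lt_iff.mp hn
          obtain ⟨htn, hcn⟩ := max_lt_iff.mp hn
          obtain ⟨i, x, hx, hmax⟩ := (hH n).mp hnH
          -- A smaller maximum v belongs to the member x with maximum n: it cannot be the maximum of
          -- a later member, which would contain n.
          have hsub : ∀ v, v < n → v ∈ H → Elts x v := by
            intro v hv hvH
            obtain ⟨j, y, hy, hmax'⟩ := (hH v).mp hvH
            rcases le_total j i with hji | hij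
            · exact hX.mono hji hy hx hmax'.1
            · have hny := hX.mono hij hx hy hmax.1
              exact ((hmax'.2 n hny.lt hny).not_gt hv).elim
          exact ⟨i, x, hx, n, hmax.1.lt, hmax.1, s, hsn, t, htn, c, hcn,
            hs.congr fun i v hv => hsub v (hv.snd_lt.trans hsn) (hs.1.val hv),
            ht.congr fun i v hv => hsub v (hv.snd_lt.trans htn) (ht.1.val hv), hsc, htc⟩
  obtain ⟨r, hr⟩ := h F hAS
  obtain ⟨C', hC', hfun, hCC'⟩ := exists_restriction hC r
  obtain ⟨H, hH, hHr, hhom, n, y, ⟨q, hq, -⟩, hy, hyn⟩ := hr C' ⟨hC', hfun⟩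
  have hnd : ¬ Distinguished d C H := by
    rintro ⟨x, -, -, s, -, t, -, c, -, hs, ht, hsc, htc⟩
    exact htc ((hCC' t c (ht.mono hHr)).mp
      (hhom s t c ⟨hs, ht, (hCC' s c (hs.mono hHr)).mpr hsc⟩))
  obtain ⟨-, rfl⟩ := ((hF' _ _).mp hy).2.resolve_left fun h => hnd h.1
  -- The elements of H are smaller than its code, so its size is at most that code, which is F(H).
  exact (hq.le fun x hx => hx.lt).not_gt hyn

end SOA

/-! ### From the infinite to the finitary Ramsey theorem with weak König's lemma. -/

namespace SOA

set_option synthInstance.maxSize 100000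
set_option synthInstance.maxHeartbeats 400000

variable {𝔐 : Str} {α : Type} [Ctx 𝔐 α] [RCAModel 𝔐]

open RCAModel

/-! ### Compactness from weak König's lemma -/

theorem IsSeq.exists_val {P : 𝔐.M → Prop} {l s : 𝔐.M} (h : IsSeq P l s) {i : 𝔐.M} (hi : i < l) :
    ∃ x, Elts s (pr i x) := (h.2.2 i hi).imp fun _ h => h.1

/-- Otherwise s would be an index of the sequence, but every index is smaller than the code. -/
theorem IsSeq.length_le {P : 𝔐.M → Prop} {l s : 𝔐.M} (h : IsSeq P l s) : l ≤ s := by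
  refine le_of_not_gt fun hs => ?_
  obtain ⟨x, hx⟩ := h.exists_val hs
  exact hx.fst_lt.false

theorem IsSeq.length_le_length {P Q : 𝔐.M → Prop} {l l' s t : 𝔐.M} (hs : IsSeq P l s)
    (ht : IsSeq Q l' t) (h : ∀ z, Elts s z → Elts t z) : l ≤ l' := by
  refine le_of_not_gt fun hl => ?_
  obtain ⟨x, hx⟩ := hs.exists_val hl
  exact (ht.lt (h _ hx)).false

/-- If the values of a finite sequence `s` of length `l` agree with the function `f`, then both
have the value `y` at the same places. -/
theorem IsSeq.elts_iff {P Q R : 𝔐.M → Prop} {l s : 𝔐.M} {f : 𝔐.M → Prop} (hs : IsSeq P l s)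
    (hf : IsFun f Q R) (h : ∀ z, Elts s z → f z) {i y : 𝔐.M} (hi : i < l) :
    Elts s (pr i y) ↔ f (pr i y) := by
  refine ⟨h _, fun hy => ?_⟩
  obtain ⟨x, hx⟩ := hs.exists_val hi
  rwa [hf.unique hy (h _ hx)]

/-- Every finite set below `m` has a characteristic sequence of length `m`. -/
theorem exists_characteristic_seq (m x : 𝔐.M) :
    ∃ s, IsSeq (· < 1 + 1) m s ∧ ∀ z, z < m → (Elts s (pr z 1) ↔ Elts x z) := by
  obtain ⟨s, hs, h⟩ := exists_code (pr m 1 + 1) fun w => ∃ z, z < m ∧ ∃ v, v < 1 + 1 ∧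
    w = pr z v ∧ (v = 1 ↔ Elts x z)
  have h' : ∀ z v, Elts s (pr z v) ↔ z < m ∧ v < 1 + 1 ∧ (v = 1 ↔ Elts x z) := by
    intro z v
    rw [h]
    constructor
    · rintro ⟨-, _, hz, _, hv, hw, h⟩
      obtain ⟨rfl, rfl⟩ := pr_inj.mp hw
      exact ⟨hz, hv, h⟩
    · rintro ⟨hz, hv, h⟩
      exact ⟨RCAModel.lt_add_one_iff.mpr (pr_mono hz.le (RCAModel.lt_add_one_iff.mp hv)),
        z, hz, v, hv, rfl, h⟩
  have h01 : ∀ v : 𝔐.M, v < 1 + 1 ↔ v = 0 ∨ v = 1 := by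
    intro v
    rw [RCAModel.lt_succ, ← zero_add (1 : 𝔐.M), RCAModel.lt_succ]
    simp
  refine ⟨s, ⟨hs, fun w hw => ?_, fun z hz => ?_⟩, fun z hz => ?_⟩
  · obtain ⟨-, z, hz, v, hv, rfl, -⟩ := (h w).mp hw
    exact ⟨z, v, rfl, hz, hv⟩
  · by_cases hx : Elts x z
    · exact ⟨1, (h' _ _).mpr ⟨hz, (h01 1).mpr (.inr rfl), by simp [hx]⟩, fun v hv =>
        ((h' _ _).mp hv).2.2.mpr hx⟩
    · refine ⟨0, (h' _ _).mpr ⟨hz, (h01 0).mpr (.inl rfl), ?_⟩, fun v hv => ?_⟩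
      · simp [hx]
      · obtain ⟨-, hv, hv'⟩ := (h' _ _).mp hv
        exact ((h01 v).mp hv).resolve_right fun h => hx (hv'.mp h)
  · rw [h']
    simp [hz, h01]

/-- If every finite approximation `Q l` to a property of sets is satisfied by a finite set, where
`Q l` concerns only the elements below `l`, then some set satisfies all of them. -/
theorem WKLIn.compactness (hW : WKLIn 𝔐) (Q : 𝔐.M → (𝔐.M → Prop) → Prop)
    (hQ : Sig0 𝔐 fun p : 𝔐.M × 𝔐.M => Q p.2 fun z => Elts p.1 (pr z 1))
    (hloc : ∀ l l' A B, l ≤ l' → (∀ z, z < l → (A z ↔ B z)) → Q l' A → Q l B)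
    (hex : ∀ l, ∃ x, Q l (Elts x)) : ∃ X : 𝔐.S, ∀ l, Q l (· ∈ X) := by
  have hQ' : Sig0 𝔐 fun p : (𝔐.M × 𝔐.M) × 𝔐.M => Q p.2 fun z => Elts p.1.2 (pr z 1) :=
    hQ.comp (m := fun p : (𝔐.M × 𝔐.M) × 𝔐.M => (p.1.2, p.2))
      (.mk (.of_isTerm inferInstance) inferInstance)
  -- The tree of characteristic sequences that satisfy the approximation for their length. Locality
  -- closes it under initial segments, and it is unbounded because lengths are at most codes.
  obtain ⟨T, hT⟩ := sig0_comprehension (𝔐 := 𝔐) fun s => ∃ l, l ≤ s ∧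
    (IsSeq (· < 1 + 1) l s ∧ Q l fun z => Elts s (pr z 1))
  have htree : BinTreeIn T := by
    refine ⟨fun s hs => ?_, fun s t l ⟨hs, ht, hts⟩ => ?_⟩
    · obtain ⟨l, -, h, -⟩ := (hT s).mp hs
      exact ⟨l, h⟩
    · obtain ⟨l', -, hs, hq⟩ := (hT s).mp hs
      refine (hT t).mpr ⟨l, ht.length_le, ht.congr fun i x hx => hs.val (hts _ hx),
        hloc _ _ _ _ (ht.length_le_length hs hts) (fun z hz => ?_) hq⟩
      exact (ht.elts_iff hs.2 hts hz).symm
  have hinf : IsInf (· ∈ T) := by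
    intro m
    obtain ⟨x, hx⟩ := hex (m + 1)
    obtain ⟨s, hs, h⟩ := exists_characteristic_seq (m + 1) x
    exact ⟨s, RCAModel.add_one_le_iff.mp hs.length_le, (hT s).mpr ⟨m + 1, hs.length_le, hs,
      hloc _ _ _ _ le_rfl (fun z hz => (h z hz).symm) hx⟩⟩
  obtain ⟨g, hg, hpath⟩ := hW T ⟨htree, hinf⟩
  obtain ⟨X, hX⟩ := sig0_comprehension (𝔐 := 𝔐) fun z => pr z 1 ∈ g
  refine ⟨X, fun l => ?_⟩
  obtain ⟨s, hs, hl, hsg⟩ := hpath l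
  obtain ⟨l', -, hl', hq⟩ := (hT s).mp hs
  refine hloc _ _ _ _ (hl.length_le_length hl' fun _ h => h) (fun z hz => ?_) hq
  rw [hX]
  exact hl.elts_iff hg hsg hz

/-! ### Initial segments of an infinite set -/

/-- Appending a new largest element to an increasing sequence. -/
theorem Tuples.exists_snoc {P : 𝔐.M → Prop} {n q h : 𝔐.M} (hq : Tuples P n q) (hP : P h)
    (hlt : ∀ i x, Elts q (pr i x) → x < h) :
    ∃ q', Tuples P (n + 1) q' ∧ ∀ z, Elts q' z ↔ Elts q z ∨ z = pr n h := by
  obtain ⟨q', hfin, hq'⟩ := exists_code (q + (pr n h + 1)) fun z => Elts q z ∨ z = pr n h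
  have hiff : ∀ z, Elts q' z ↔ Elts q z ∨ z = pr n h := by
    refine fun z => (hq' z).trans (and_iff_right_of_imp ?_)
    rintro (hz | rfl)
    · exact hz.lt.trans_le le_self_add
    · exact (lt_add_one_self _).trans_le le_add_self
  refine ⟨q', ⟨⟨hfin, fun z hz => ?_, fun i hi => ?_⟩, ?_⟩, hiff⟩
  · rcases (hiff z).mp hz with hz | rfl
    · obtain ⟨i, x, rfl, hi, hx⟩ := hq.1.2.1 z hz
      exact ⟨i, x, rfl, hi.trans (lt_add_one_self _), hx⟩
    · exact ⟨n, h, rfl, lt_add_one_self _, hP⟩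
  · rcases RCAModel.lt_succ.mp hi with hi | rfl
    · obtain ⟨x, hx, huniq⟩ := hq.1.2.2 i hi
      refine ⟨x, (hiff _).mpr (.inl hx), fun y hy => ?_⟩
      rcases (hiff _).mp hy with hy | hy
      · exact huniq y hy
      · exact (hi.ne (pr_inj.mp hy).1).elim
    · refine ⟨h, (hiff _).mpr (.inr rfl), fun y hy => ?_⟩
      rcases (hiff _).mp hy with hy | hy
      · exact ((hq.1.lt hy).false).elim
      · exact (pr_inj.mp hy).2
  · rintro i i' x x' ⟨hx, hx', hii'⟩
    rcases (hiff _).mp hx with hx | hx <;> rcases (hiff _).mp hx' with hx' | hx'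
    · exact hq.2 i i' x x' ⟨hx, hx', hii'⟩
    · obtain ⟨-, rfl⟩ := pr_inj.mp hx'
      exact hlt i x hx
    · obtain ⟨rfl, -⟩ := pr_inj.mp hx
      exact ((hq.1.lt hx').not_gt hii').elim
    · obtain ⟨rfl, -⟩ := pr_inj.mp hx
      obtain ⟨rfl, -⟩ := pr_inj.mp hx'
      exact hii'.false.elim

theorem exists_tuples_zero (P : 𝔐.M → Prop) : ∃ q, Tuples P 0 q ∧ ∀ z, ¬ Elts q z := by
  obtain ⟨q, hq, h⟩ := exists_code (𝔐 := 𝔐) 0 fun z => z = z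
  have hn : ∀ z, ¬ Elts q z := fun z hz => RCAModel.not_lt_zero _ ((h z).mp hz).1
  exact ⟨q, ⟨⟨hq, fun z hz => (hn z hz).elim, fun i hi => (RCAModel.not_lt_zero _ hi).elim⟩,
    fun _ _ _ _ h => (hn _ h.1).elim⟩, hn⟩

/-- Every number is the size of some initial segment of an infinite set. -/
theorem exists_initial_segment {H : 𝔐.S} (hH : IsInf (· ∈ H)) (n : 𝔐.M) :
    ∃ j, ∃ q, Tuples (fun x => x ∈ H ∧ x < j) n q ∧
      ∀ x, x < j → x ∈ H → ∃ i, i < q ∧ Elts q (pr i x) := by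
  -- The bound i < q on the covering index keeps the induction statement Σ⁰₁.
  refine sig1_induction (fun n => ∃ j, ∃ q, Tuples (fun x => x ∈ H ∧ x < j) n q ∧
      ∀ x, x < j → x ∈ H → ∃ i, i < q ∧ Elts q (pr i x)) ?_ ?_ n
  · obtain ⟨q, hq, -⟩ := exists_tuples_zero (𝔐 := 𝔐) fun x => x ∈ H ∧ x < 0
    exact ⟨0, q, hq, fun x hx => (RCAModel.not_lt_zero _ hx).elim⟩
  · rintro n ⟨j, q, hq, hcov⟩
    -- The next element of H is appended, and the cut moves just past it.
    obtain ⟨h, ⟨hh, hjh⟩, hmin⟩ := sig0_exists_least (fun h => h ∈ H ∧ j ≤ h)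
      ((hH j).imp fun _ h => ⟨h.2, h.1.le⟩)
    have hle : j ≤ h + 1 := hjh.trans (lt_add_one_self _).le
    obtain ⟨q', hq', hiff⟩ := (hq.mono (Q := fun x => x ∈ H ∧ x < h + 1)
      fun x hx => ⟨hx.1, hx.2.trans_le hle⟩).exists_snoc (h := h) ⟨hh, lt_add_one_self _⟩
      fun i x hx => (hq.1.val hx).2.trans_le hjh
    refine ⟨h + 1, q', hq', fun x hx hxH => ?_⟩
    suffices ∃ i, Elts q' (pr i x) from this.imp fun i hi => ⟨hi.fst_lt, hi⟩
    rcases lt_or_ge x j with hxj | hjx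
    · obtain ⟨i, -, hi⟩ := hcov x hxj hxH
      exact ⟨i, (hiff _).mpr (.inl hi)⟩
    · obtain rfl : x = h := (RCAModel.lt_succ.mp hx).resolve_left fun hlt => hmin x hlt ⟨hxH, hjx⟩
      exact ⟨n, (hiff _).mpr (.inr rfl)⟩

/-- The sequence of the initial segments of a set. -/
theorem exists_chain_of_initial_segments (H : 𝔐.S) : ∃ X : 𝔐.S, IsChain X ∧
    ∀ i x, pr i x ∈ X ↔ IsFin x ∧ ∀ z, Elts x z ↔ z < i ∧ z ∈ H := by
  obtain ⟨X, hX⟩ := sig0_comprehension (𝔐 := 𝔐) fun w => ∃ i, i ≤ w ∧ ∃ x, x ≤ w ∧ w = pr i x ∧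
    IsFin x ∧ (∀ z, z < x → Elts x z → z < i ∧ z ∈ H) ∧ ∀ z, z < i → z ∈ H → Elts x z
  have hiff : ∀ i x, pr i x ∈ X ↔ IsFin x ∧ ∀ z, Elts x z ↔ z < i ∧ z ∈ H := by
    intro i x
    rw [hX]
    constructor
    · rintro ⟨_, -, _, -, hw, hx, h₁, h₂⟩
      obtain ⟨rfl, rfl⟩ := pr_inj.mp hw
      exact ⟨hx, fun z => ⟨fun hz => h₁ z hz.lt hz, fun hz => h₂ z hz.1 hz.2⟩⟩
    · exact fun ⟨hx, h⟩ => ⟨i, fst_le_pr _ _, x, snd_le_pr _ _, rfl, hx,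
        fun z _ hz => (h z).mp hz, fun z h₁ h₂ => (h z).mpr ⟨h₁, h₂⟩⟩
  refine ⟨X, ⟨⟨fun w hw => ?_, fun i _ => ?_⟩, fun i x y ⟨hx, hy⟩ z hz => ?_⟩, hiff⟩
  · obtain ⟨i, -, x, -, rfl, hx, -⟩ := (hX w).mp hw
    exact ⟨i, x, rfl, rfl, hx⟩
  · obtain ⟨x, hx, h⟩ := exists_code i fun z => z ∈ H
    refine ⟨x, (hiff i x).mpr ⟨hx, h⟩, fun y hy => ?_⟩
    obtain ⟨hy, h'⟩ := (hiff i y).mp hy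
    exact hy.ext hx fun z => (h' z).trans (h z).symm
  · obtain ⟨h₁, h₂⟩ := (((hiff i x).mp hx).2 z).mp hz
    exact (((hiff _ y).mp hy).2 z).mpr ⟨h₁.trans (lt_add_one_self _), h₂⟩

/-! ### The finite version from the infinite one -/

/-- The part of `A` below `l` looks like a colouring `[ℕ]^d → k` for which every homogeneous
finite set `H` satisfies `|H| ≤ F(H)`. -/
def LooksBad (k d : 𝔐.M) (F : 𝔐.S) (l : 𝔐.M) (A : 𝔐.M → Prop) : Prop :=
  (∀ z, z < l → A z → ∃ t, t ≤ z ∧ ∃ c, c ≤ z ∧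
    z = pr t c ∧ Tuples (fun x => x = x) d t ∧ c < k) ∧
  (∀ t, t < l → ∀ c, c < l → ∀ c', c' < l → pr t c < l ∧ pr t c' < l ∧
    A (pr t c) ∧ A (pr t c') → c' = c) ∧
  (∀ t, t < l → pr t k < l ∧ Tuples (fun x => x = x) d t → ∃ c, c < k ∧ A (pr t c)) ∧
  ∀ H, H < l → ∀ n, n < l → ∀ y, y < l → ∀ q, q < l → ∀ b, b < l →
    IsFin H ∧ pr H y ∈ F ∧ Tuples (Elts H) n q ∧
      (∀ x, x < H → Elts H x → ∃ i, i < q ∧ Elts q (pr i x)) ∧ y < n ∧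
      CodeBound (pr d H + 1) b ∧ pr b k < l →
    ∃ s, s ≤ b ∧ ∃ t, t ≤ b ∧ ∃ c, c < k ∧ Tuples (Elts H) d s ∧ Tuples (Elts H) d t ∧
      A (pr s c) ∧ ¬ A (pr t c)

/-- The guards `pr t k < l` and `pr b k < l` keep every pair that is looked up below l: colours are
less than k, and b bounds the codes of the d-subsets of H. Asking for the enumeration q and the
bound b below l, as hypotheses, makes the condition Σ⁰₀. -/
theorem LooksBad.local {k d : 𝔐.M} {F : 𝔐.S} (l l' : 𝔐.M) (A B : 𝔐.M → Prop) (hl : l ≤ l')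
    (h : ∀ z, z < l → (A z ↔ B z)) (hA : LooksBad k d F l' A) : LooksBad k d F l B := by
  refine ⟨fun z hz hB => hA.1 z (hz.trans_le hl) ((h z hz).mpr hB), fun t ht c hc c' hc' => ?_,
    fun t ht => ?_, fun H hH n hn y hy q hq b hb => ?_⟩
  · exact fun ⟨h₁, h₂, h₃, h₄⟩ => hA.2.1 t (ht.trans_le hl) c (hc.trans_le hl) c' (hc'.trans_le hl)
      ⟨h₁.trans_le hl, h₂.trans_le hl, (h _ h₁).mpr h₃, (h _ h₂).mpr h₄⟩
  · rintro ⟨h₁, h₂⟩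
    obtain ⟨c, hc, hA⟩ := hA.2.2.1 t (ht.trans_le hl) ⟨h₁.trans_le hl, h₂⟩
    exact ⟨c, hc, (h _ ((pr_lt_pr_right hc).trans h₁)).mp hA⟩
  · rintro ⟨h₁, h₂, h₃, h₄, h₅, h₆, h₇⟩
    obtain ⟨s, hs, t, ht, c, hc, hs', ht', h₈, h₉⟩ := hA.2.2.2 H (hH.trans_le hl) n (hn.trans_le hl)
      y (hy.trans_le hl) q (hq.trans_le hl) b (hb.trans_le hl)
      ⟨h₁, h₂, h₃, h₄, h₅, h₆, h₇.trans_le hl⟩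
    have hlt : ∀ s, s ≤ b → pr s c < l := fun s hs =>
      ((pr_mono hs le_rfl).trans_lt (pr_lt_pr_right hc)).trans h₇
    exact ⟨s, hs, t, ht, c, hc, hs', ht', (h _ (hlt s hs)).mp h₈,
      fun hB => h₉ ((h _ (hlt t ht)).mpr hB)⟩

theorem sig0_looksBad {k d : 𝔐.M} {F : 𝔐.S} :
    Sig0 𝔐 fun p : 𝔐.M × 𝔐.M => LooksBad k d F p.2 fun z => Elts p.1 (pr z 1) := by
  unfold LooksBad
  infer_instance

/-- A bad colouring of the d-subsets of {0, …, l} serves at level l, because tuples and sets with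
codes below l have only elements below l. -/
theorem exists_looksBad {k d : 𝔐.M} {F : 𝔐.S}
    (h : ∀ r, ∃ C, IsFin C ∧ IsFun (Elts C) (Tuples (· ≤ r) d) (· < k) ∧
      ∀ H, IsFin H → (∀ x, Elts H x → x ≤ r) → IsHomog d (Elts C) (Elts H) →
        ∀ n y, HasSize (Elts H) n → pr H y ∈ F → ¬ y < n) (l : 𝔐.M) :
    ∃ x, LooksBad k d F l (Elts x) := by
  obtain ⟨C, -, hC, hbad⟩ := h l
  refine ⟨C, fun z _ hz => ?_, fun t _ c _ c' _ h => hC.unique h.2.2.2 h.2.2.1, fun t ht h => ?_, ?_⟩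
  · obtain ⟨t, c, rfl, ht, hc⟩ := hC.1 z hz
    exact ⟨t, fst_le_pr _ _, c, snd_le_pr _ _, rfl, ht.mono fun _ _ => rfl, hc⟩
  · obtain ⟨c, hc, -⟩ := hC.2 t (h.2.congr fun i x hx => (hx.snd_lt.trans ht).le)
    obtain ⟨_, _, heq, -, hck⟩ := hC.1 _ hc
    obtain ⟨-, rfl⟩ := pr_inj.mp heq
    exact ⟨c, hck, hc⟩
  · rintro H hH n - y - q - b - ⟨hfin, hy, hq, hcov, hyn, hb, -⟩
    refine Classical.byContradiction fun hno => ?_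
    refine hbad H hfin (fun x hx => (hx.lt.trans hH).le) (fun s t c ⟨hs, ht, hsc⟩ => ?_) n y
      ⟨q, hq, fun x hx => (hcov x hx.lt hx).imp fun _ h => h.2⟩ hy hyn
    refine Classical.byContradiction fun htc => hno ?_
    obtain ⟨_, _, heq, -, hck⟩ := hC.1 _ hsc
    obtain ⟨-, rfl⟩ := pr_inj.mp heq
    exact ⟨s, hs.code_le (fun x hx => hx.lt.le) hb, t, ht.code_le (fun x hx => hx.lt.le) hb, c,
      hck, hs, ht, hsc, htc⟩

theorem isFun_of_looksBad {k d : 𝔐.M} {F C : 𝔐.S} (h : ∀ l, LooksBad k d F l (· ∈ C)) :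
    IsFun (· ∈ C) (Tuples (fun x => x = x) d) (· < k) := by
  refine ⟨fun z hz => ?_, fun t ht => ?_⟩
  · obtain ⟨t, -, c, -, rfl, h⟩ := (h (z + 1)).1 z (lt_add_one_self z) hz
    exact ⟨t, c, rfl, h⟩
  · obtain ⟨c, -, hc⟩ := (h (pr t k + 1)).2.2.1 t
      (RCAModel.lt_add_one_iff.mpr (fst_le_pr _ _)) ⟨lt_add_one_self _, ht⟩
    refine ⟨c, hc, fun c' hc' => ?_⟩
    obtain ⟨l, h₁, h₂⟩ := exists_gt₂ (pr t c) (pr t c')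
    exact (h l).2.1 t ((fst_le_pr _ _).trans_lt h₁) c ((snd_le_pr _ _).trans_lt h₁) c'
      ((snd_le_pr _ _).trans_lt h₂) ⟨h₁, h₂, hc, hc'⟩

theorem FRTIn.of_rtIn (hW : WKLIn 𝔐) {k d : 𝔐.M} (h : RTIn k d) : FRTIn k d := by
  intro F hF
  refine Classical.byContradiction fun hno => ?_
  have hbad : ∀ r, ∃ C, IsFin C ∧ IsFun (Elts C) (Tuples (· ≤ r) d) (· < k) ∧
      ∀ H, IsFin H → (∀ x, Elts H x → x ≤ r) → IsHomog d (Elts C) (Elts H) →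
        ∀ n y, HasSize (Elts H) n → pr H y ∈ F → ¬ y < n := by
    intro r
    refine Classical.byContradiction fun hr => hno ⟨r, fun C hC => ?_⟩
    refine Classical.byContradiction fun hH => hr ⟨C, hC.1, hC.2, ?_⟩
    exact fun H h₁ h₂ h₃ n y h₄ h₅ h₆ => hH ⟨H, h₁, h₂, h₃, n, y, h₄, h₅, h₆⟩
  obtain ⟨C, hC⟩ := hW.compactness (LooksBad k d F) sig0_looksBad LooksBad.local
    (exists_looksBad hbad)
  obtain ⟨H, hinf, hhom⟩ := h C (isFun_of_looksBad hC)
  obtain ⟨X, hX, hXH⟩ := exists_chain_of_initial_segments H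
  obtain ⟨i, hi⟩ := hF.2 X ⟨hX.isFun, hX.step⟩
  obtain ⟨x, hx⟩ := hX.exists_mem i
  obtain ⟨y, hy, -⟩ := hF.1.2 x (hX.isFin hx)
  -- Size i + (y + 1) does two things: the cut j is at least the size, hence past the stabilisation
  -- point i, and the size exceeds the stable value y.
  obtain ⟨j, q, hq, hcov⟩ := exists_initial_segment hinf (i + (y + 1))
  have hij : i ≤ j := le_self_add.trans (hq.le fun x hx => hx.2)
  obtain ⟨u, hu⟩ := hX.exists_mem j
  have huH := ((hXH j u).mp hu).2
  obtain ⟨b, hb⟩ := exists_codeBound (pr d u + 1)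
  obtain ⟨s, -, t, -, c, -, hs, ht, hsc, htc⟩ :=
    -- The level exceeds every number mentioned in the last clause of `LooksBad`. That clause then
    -- yields two d-subsets of H of different colours.
    (hC (max u (max (i + (y + 1)) (max y (max q (max b (pr b k))))) + 1)).2.2.2
    u (by simp [RCAModel.lt_add_one_iff]) (i + (y + 1)) (by simp [RCAModel.lt_add_one_iff])
    y (by simp [RCAModel.lt_add_one_iff]) q (by simp [RCAModel.lt_add_one_iff])
    b (by simp [RCAModel.lt_add_one_iff])
    ⟨hX.isFin hu, hi j hij x u y ⟨hx, hu, hy⟩, hq.mono fun z hz => (huH z).mpr hz.symm,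
      fun z _ hz => hcov z ((huH z).mp hz).1 ((huH z).mp hz).2,
      (lt_add_one_self y).trans_le le_add_self, hb, by simp [RCAModel.lt_add_one_iff]⟩
  exact htc (hhom s t c ⟨hs.mono fun z hz => ((huH z).mp hz).2,
    ht.mono fun z hz => ((huH z).mp hz).2, hsc⟩)

theorem WKLIn.of_models (h : 𝔐.Models WKL0) (e : ℕ → 𝔐.S) : WKLIn 𝔐 :=
  (FDen.wkl ⟨0, 0, fun _ => 0, e⟩ le_rfl).mp (h _ (Or.inr rfl) (fun _ => 0) e)

end SOA

open SOA in
/-- `RCA₀ ⊢ ∀ k ∀ d (FRT^k_d → RT^k_d)` and `WKL₀ ⊢ ∀ k ∀ d (RT^k_d → FRT^k_d)`. -/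
theorem theorem1 :
    Provable RCA0 (Form.close (all fun k => all fun d => FRT k d ⇒ RT k d)) ∧
    Provable WKL0 (Form.close (all fun k => all fun d => RT k d ⇒ FRT k d)) := by
  constructor
  · refine provable_close (p := fun 𝔐 _ => ∀ k d : 𝔐.M, FRTIn k d → RTIn k d) (fun _ h => h)
      (fun 𝔐 _ W => ?_) fun 𝔐 _ _ k d => RTIn.of_frtIn
    exact .all fun _ _ _ _ hk => .all fun _ _ _ _ hd => .imp (.frt hk.mono hd) (.rt hk.mono hd)
  · refine provable_close (p := fun 𝔐 _ => ∀ k d : 𝔐.M, RTIn k d → FRTIn k d) (fun _ h => .inl h)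
      (fun 𝔐 _ W => ?_) fun 𝔐 _ h k d => ?_
    · exact .all fun _ _ _ _ hk => .all fun _ _ _ _ hd => .imp (.rt hk.mono hd) (.frt hk.mono hd)
    · obtain ⟨X⟩ := RCAModel.nonempty (𝔐 := 𝔐)
      exact FRTIn.of_rtIn (.of_models h fun _ => X)
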